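/- Let $\mathcal H$ be a separable complex Hilbert space, $H$ a self-adjoint (possibly unbounded) operator in $\mathcal H$, $V$ a bounded self-adjoint operator, and $H_V=H+V$ with $\operatorname{dom}H_V=\operatorname{dom}H$; assume that $H$ and $H_V$ are bounded from below. Write $V=\sqrt{|V|}\,J\sqrt{|V|}$ with $J^*=J$, $J^2=1$, and put $R(z)=(z-H)^{-1}$, $R_V(z)=(z-H_V)^{-1}$, $P_\nu=\chi_{(-\infty,\nu]}(H)$, $\Pi_\nu=\chi_{(-\infty,\nu]}(H_V)$ and $K(z)=\sqrt{|V|}R(z)\sqrt{|V|}J$ (the Birman--Schwinger operator). Let $B_1$ be the trace class with its trace norm. Fix $\nu\in\mathbb R$ and assume that $K(\nu+is)\in B_1$ and $R_V(\nu+is)-R(\nu+is)\in B_1$ for all $s>0$. Assume furthermore that at least one of the following holds: (a) (limiting absorption principle at $\nu$; $\nu$ may lie in the essential spectrum) the limits of $K(\nu+is)$ and of $R_V(\nu+is)-R(\nu+is)$ for $s\to+0$ exist in $B_1$; (b) $\nu$ is an isolated eigenvalue of $H$ or $H_V$, in the sense that some punctured real neighbourhood of $\nu$ does not meet $\sigma(H)\cup\sigma(H_V)$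 (the case that $\nu$ is in the resolvent set of one or both operators is included). Then the Fredholm determinant $\Delta(z)=\det(1-K(z))$ has a unique holomorphic logarithm $\ln\Delta$ on $\mathbb C\setminus[\inf(\sigma(H)\cup\sigma(H_V)),\infty)$ with $\ln\Delta(x)\to0$ as $x\to-\infty$, $x\in\mathbb R$. For $x\in\mathbb R$ let $\xi(x)=\frac1\pi\lim_{y\to+0}\operatorname{Im}\ln\Delta(x+iy)$ wherever this limit exists. In case (a) the limit $\xi(\nu)$ exists; in case (b) $\xi$ exists and is constant on some interval $(\nu,\nu+\delta)$, $\delta>0$, and $\xi(\nu)$ in the formula below denotes this constant, i.e. the right-sided limit at $\nu$ (if both (a) and (b) hold, the two values agree). Let $f:\mathbb C\to\mathbb C$ be entire and let $\Gamma_\nu$ be a closed, positively oriented, piecewise continuously differentiable contour that meets the real axis at exactly two points: at $\nu$, where it crosses perpendicularly, and at one point $a<\nu$ below $\sigma(H)$ and $\sigma(H_V)$. Then $f(H_V)\Pi_\nu-f(H)P_\nu\in B_1$, the function $f'\ln\Delta$ is integrable along $\Gamma_\nu$, and $$\operatorname{tr}\big[f(H_V)\Pi_\nu-f(H)P_\nu\big]=-f(\nu)\,\xi(\nu)-\frac1{2\pi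 i}\int_{\Gamma_\nu}f'(z)\ln\Delta(z)\,dz .$$ -/

import Mathlib

open Filter Topology MeasureTheory Set

open scoped ENNReal InnerProductSpace

noncomputable section

namespace EnergyDifference

variable {E : Type*} [NormedAddCommGroup E] [InnerProductSpace ℂ E] [CompleteSpace E]

/-! ### Trace class, trace and Fredholm determinant

All three are computed in one fixed Hilbert basis; none of them depends on that basis. -/

variable (E) in
/-- The index set of a fixed Hilbert basis of `E`. -/
def BasisIndex : Set E := (exists_hilbertBasis ℂ E).choose

variable (E) in
/-- A fixed Hilbert basis of `E`. -/
def basis : HilbertBasis (BasisIndex E) ℂ E := (exists_hilbertBasis ℂ E).choose_spec.choose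

/-- The trace norm `‖A‖₁ = tr |A|`, with value `∞` if `A` is not of trace class. -/
def traceNorm (A : E →L[ℂ] E) : ℝ≥0∞ :=
  ∑' i, ENNReal.ofReal (⟪basis E i, CFC.abs A (basis E i)⟫_ℂ).re

/-- `A` belongs to the trace class `B₁`. -/
def IsTraceClass (A : E →L[ℂ] E) : Prop := traceNorm A ≠ ∞

/-- The trace of a trace class operator. -/
def trace (A : E →L[ℂ] E) : ℂ := ∑' i, ⟪basis E i, A (basis E i)⟫_ℂ

open Classical in
/-- The Fredholm determinant `det (1 + A)` of a trace class operator `A`, as the limit of the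
determinants of its finite sections. -/
def fredholmDet (A : E →L[ℂ] E) : ℂ :=
  limUnder atTop fun s : Finset (BasisIndex E) =>
    Matrix.det (1 + Matrix.of fun i j : s => ⟪basis E i, A (basis E j)⟫_ℂ)

/-! ### Unbounded operators: resolvent, spectrum, functional calculus -/

/-- `R` is a bounded two-sided inverse of `z - H`. -/
def IsResolventAt (H : E →ₗ.[ℂ] E) (z : ℂ) (R : E →L[ℂ] E) : Prop :=
  (∀ x : E, ∃ hx : R x ∈ H.domain, z • R x - H ⟨R x, hx⟩ = x) ∧
    ∀ y : H.domain, R (z • (y : E) - H y) = y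

/-- The spectrum of `H`. -/
def opSpectrum (H : E →ₗ.[ℂ] E) : Set ℂ := {z | ¬ ∃ R, IsResolventAt H z R}

open Classical in
/-- The resolvent `R(z) = (z - H)⁻¹`, for `z` outside the spectrum (where it is unique). -/
def opResolvent (H : E →ₗ.[ℂ] E) (z : ℂ) : E →L[ℂ] E :=
  if h : ∃ R, IsResolventAt H z R then h.choose else 0

/-- `H` is bounded from below as a quadratic form. -/
def SemiboundedBelow (H : E →ₗ.[ℂ] E) : Prop :=
  ∃ m : ℝ, ∀ x : H.domain, m * ‖(x : E)‖ ^ 2 ≤ (⟪(x : E), H x⟫_ℂ).re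

/-- `μ` is the spectral measure of `H` at the vector `x`, i.e. the finite Borel measure on `ℝ`
with `(x, (z - H)⁻¹ x) = ∫ (z - t)⁻¹ dμ(t)` for all nonreal `z`. For self-adjoint `H` it exists,
is unique, and `μ(B) = (x, χ_B(H) x)`. -/
def IsSpectralMeasureAt (H : E →ₗ.[ℂ] E) (x : E) (μ : Measure ℝ) : Prop :=
  IsFiniteMeasure μ ∧
    ∀ z : ℂ, z.im ≠ 0 → ⟪x, opResolvent H z x⟫_ℂ = ∫ t : ℝ, (z - (t : ℂ))⁻¹ ∂μ

open Classical in
/-- The spectral measure of `H` at `x`. -/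
def spectralMeasure (H : E →ₗ.[ℂ] E) (x : E) : Measure ℝ :=
  if h : ∃ μ, IsSpectralMeasureAt H x μ then h.choose else 0

/-- `T = g(H)` in the Borel functional calculus: `(x, T x) = ∫ g dμ_x` for all vectors `x`. -/
def IsBorelCalculus (H : E →ₗ.[ℂ] E) (g : ℝ → ℂ) (T : E →L[ℂ] E) : Prop :=
  ∀ x : E, Integrable g (spectralMeasure H x) ∧ ⟪x, T x⟫_ℂ = ∫ t, g t ∂(spectralMeasure H x)

open Classical in
/-- The bounded operator `g(H)`, for `g` bounded on the spectrum of `H`. -/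
def borelCalculus (H : E →ₗ.[ℂ] E) (g : ℝ → ℂ) : E →L[ℂ] E :=
  if h : ∃ T, IsBorelCalculus H g T then h.choose else 0

/-- The operator `f(H) χ_{(-∞, ν]}(H) = (f χ_{(-∞, ν]})(H)`. -/
def cutCalculus (H : E →ₗ.[ℂ] E) (f : ℂ → ℂ) (ν : ℝ) : E →L[ℂ] E :=
  borelCalculus H ((Iic ν).indicator fun t : ℝ => f (t : ℂ))

/-! ### The perturbed operator, the Birman--Schwinger operator, the limiting absorption principle -/

/-- `H_V = H + V`, with the domain of `H`. -/
def perturbed (H : E →ₗ.[ℂ] E) (V : E →L[ℂ] E) : E →ₗ.[ℂ] E := (V : E →ₗ[ℂ] E) +ᵥ H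

/-- `√|V|`. -/
def sqrtAbs (V : E →L[ℂ] E) : E →L[ℂ] E := CFC.sqrt (CFC.abs V)

/-- Rollnik's factorization `V = √|V| J √|V|` with `J* = J` and `J² = 1`. -/
structure IsRollnikSign (V J : E →L[ℂ] E) : Prop where
  factorization : V = sqrtAbs V * J * sqrtAbs V
  selfAdjoint : IsSelfAdjoint J
  sq_eq_one : J * J = 1

/-- The Birman--Schwinger operator `K(z) = √|V| R(z) √|V| J`. -/
def birmanSchwinger (H : E →ₗ.[ℂ] E) (V J : E →L[ℂ] E) (z : ℂ) : E →L[ℂ] E :=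
  sqrtAbs V * opResolvent H z * sqrtAbs V * J

/-- `R_V(z) - R(z)`. -/
def resolventDiff (H : E →ₗ.[ℂ] E) (V : E →L[ℂ] E) (z : ℂ) : E →L[ℂ] E :=
  opResolvent (perturbed H V) z - opResolvent H z

/-- The perturbation determinant `Δ(z) = det (1 - K(z))`. -/
def perturbationDet (H : E →ₗ.[ℂ] E) (V J : E →L[ℂ] E) (z : ℂ) : ℂ :=
  fredholmDet (-birmanSchwinger H V J z)

/-- The trace class requirements at the points `ν + is`, `s > 0`. -/
structure TraceClassAbove (H : E →ₗ.[ℂ] E) (V J : E →L[ℂ] E) (ν : ℝ) : Prop where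
  birmanSchwinger_mem : ∀ s : ℝ, 0 < s →
    IsTraceClass (birmanSchwinger H V J (ν + s * Complex.I))
  resolventDiff_mem : ∀ s : ℝ, 0 < s → IsTraceClass (resolventDiff H V (ν + s * Complex.I))

/-- The limit of `F(s)` for `s → +0` exists with respect to the trace norm. -/
def HasTraceNormLimit (F : ℝ → E →L[ℂ] E) : Prop :=
  ∃ T : E →L[ℂ] E, IsTraceClass T ∧ Tendsto (fun s => traceNorm (F s - T)) (𝓝[>] 0) (𝓝 0)

/-- The trace class limiting absorption principle at `ν`. -/
structure LimitingAbsorption (H : E →ₗ.[ℂ] E) (V J : E →L[ℂ] E) (ν : ℝ) : Prop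
    extends TraceClassAbove H V J ν where
  birmanSchwinger_lim : HasTraceNormLimit fun s => birmanSchwinger H V J (ν + s * Complex.I)
  resolventDiff_lim : HasTraceNormLimit fun s => resolventDiff H V (ν + s * Complex.I)

/-- `σ(H) ∪ σ(H_V)`. -/
def jointSpectrum (H : E →ₗ.[ℂ] E) (V : E →L[ℂ] E) : Set ℂ :=
  opSpectrum H ∪ opSpectrum (perturbed H V)

/-- `a` lies strictly below `σ(H)` and `σ(H_V)`. -/
def IsBelowSpectra (H : E →ₗ.[ℂ] E) (V : E →L[ℂ] E) (a : ℝ) : Prop :=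
  ∀ w ∈ jointSpectrum H V, a < w.re

/-- A punctured real neighbourhood of `ν` is free of `σ(H) ∪ σ(H_V)`: `ν` is an isolated
eigenvalue of `H` or `H_V` (the multiplicity zero being allowed for each of them). -/
def IsIsolatedEnergy (H : E →ₗ.[ℂ] E) (V : E →L[ℂ] E) (ν : ℝ) : Prop :=
  ∀ᶠ x in 𝓝[≠] ν, (x : ℂ) ∉ jointSpectrum H V

/-! ### The logarithm of the perturbation determinant and the spectral shift function -/

/-- The plane without the half-line that starts at the infimum of `σ(H) ∪ σ(H_V)`. -/
def cutPlane (H : E →ₗ.[ℂ] E) (V : E →L[ℂ] E) : Set ℂ :=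
  {z | z.im ≠ 0 ∨ IsBelowSpectra H V z.re}

/-- `L = ln Δ` on the cut plane: the holomorphic branch that vanishes at `-∞`. These properties
determine `L` on the cut plane. -/
structure IsLogDet (H : E →ₗ.[ℂ] E) (V J : E →L[ℂ] E) (L : ℂ → ℂ) : Prop where
  differentiableOn : DifferentiableOn ℂ L (cutPlane H V)
  exp_eq : ∀ z ∈ cutPlane H V, Complex.exp (L z) = perturbationDet H V J z
  tendsto_zero : Tendsto (fun x : ℝ => L (x : ℂ)) atBot (𝓝 0)

/-- Krein's formula `ξ = π⁻¹ lim_{y → +0} Im ln Δ(x + iy)`, where `L = ln Δ`. -/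
def HasSpectralShift (L : ℂ → ℂ) (x ξ : ℝ) : Prop :=
  Tendsto (fun y : ℝ => Real.pi⁻¹ * (L (x + y * Complex.I)).im) (𝓝[>] 0) (𝓝 ξ)

/-! ### Contours and the energy formula -/

/-- A closed, positively oriented, piecewise continuously differentiable contour that meets the
real axis only at `ν`, where it crosses perpendicularly, and at one point to the left of `ν` below
`σ(H)` and `σ(H_V)`. It is run through from `ν` through the upper half-plane to the second point
and back to `ν` through the lower half-plane. -/
structure IsFermiContour (H : E →ₗ.[ℂ] E) (V : E →L[ℂ] E) (ν : ℝ) (γ : ℝ → ℂ) : Prop where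
  continuousOn : ContinuousOn γ (Icc 0 1)
  piecewise : ∃ (S : Finset ℝ) (C : ℝ),
    (∀ t ∈ Ioo (0 : ℝ) 1 \ S, DifferentiableAt ℝ γ t ∧ ‖deriv γ t‖ ≤ C) ∧
      ContinuousOn (deriv γ) (Ioo (0 : ℝ) 1 \ S)
  start_eq : γ 0 = ν
  finish_eq : γ 1 = ν
  perp_start : ∃ v : ℝ, 0 < v ∧ HasDerivWithinAt γ (v * Complex.I) (Ici 0) 0
  perp_finish : ∃ v : ℝ, 0 < v ∧ HasDerivWithinAt γ (v * Complex.I) (Iic 1) 1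
  crossing : ∃ c ∈ Ioo (0 : ℝ) 1,
    (γ c).im = 0 ∧ (γ c).re < ν ∧ IsBelowSpectra H V (γ c).re ∧
      (∀ t ∈ Ioo 0 c, 0 < (γ t).im) ∧ ∀ t ∈ Ioo c 1, (γ t).im < 0

/-- `f(H_V) Π_ν - f(H) P_ν`. -/
def energyOperator (H : E →ₗ.[ℂ] E) (V : E →L[ℂ] E) (f : ℂ → ℂ) (ν : ℝ) : E →L[ℂ] E :=
  cutCalculus (perturbed H V) f ν - cutCalculus H f ν

/-- The energy difference `tr [f(H_V) Π_ν - f(H) P_ν]` and the contour integral of `f' ln Δ` are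
well-defined and the former equals `-f(ν) ξ - (2πi)⁻¹ ∫_γ f'(z) ln Δ(z) dz`. -/
def EnergyFormula (H : E →ₗ.[ℂ] E) (V : E →L[ℂ] E) (L : ℂ → ℂ) (f : ℂ → ℂ) (ν ξ : ℝ)
    (γ : ℝ → ℂ) : Prop :=
  IsBorelCalculus H ((Iic ν).indicator fun t : ℝ => f (t : ℂ)) (cutCalculus H f ν) ∧
  IsBorelCalculus (perturbed H V) ((Iic ν).indicator fun t : ℝ => f (t : ℂ))
    (cutCalculus (perturbed H V) f ν) ∧
  IsTraceClass (energyOperator H V f ν) ∧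
  IntervalIntegrable (fun t => deriv f (γ t) * L (γ t) * deriv γ t) volume 0 1 ∧
  trace (energyOperator H V f ν) =
    -f ν * ξ - (2 * Real.pi * Complex.I)⁻¹ *
      ∫ t in (0 : ℝ)..1, deriv f (γ t) * L (γ t) * deriv γ t

end EnergyDifference

end

open Filter Topology MeasureTheory Set

open scoped ENNReal InnerProductSpace

set_option linter.unusedSectionVars false

noncomputable section

namespace EnergyDifference

variable {E : Type*} [NormedAddCommGroup E] [InnerProductSpace ℂ E] [CompleteSpace E]

/-! Why the formula holds. Write D(z) = R_V(z) - R(z). On the cut plane (ln Δ)' = tr D, because K' =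
-√|V| R² √|V| J and cyclicity of the trace turns -tr((1 - K)⁻¹ K') into tr D
(`hasDerivAt_perturbationDet`). Suppose first that the trace norm of D(ν + is) stays bounded for
small s > 0. Cauchy's formula on the circle with diameter [a, ν] then gives f(H_V)Π_ν - f(H)P_ν =
(2πi)⁻¹ ∮ f D dz as a trace norm convergent integral (`energyOperator_eq`), hence the trace is
(2πi)⁻¹ ∮ f (ln Δ)' dz. Integration by parts moves the derivative to f. The contour starts and ends
at ν on different sides of the cut, and since ln Δ is symmetric under conjugation its jump there is
-2i Im ln Δ(ν + i0) = -2πi ξ(ν); this is the term -f(ν) ξ(ν). The remaining integral of f' ln Δ is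
evaluated by a primitive on the cut plane, so that only the boundary values of the primitive at ν
matter and every admissible contour gives the same number (`trace_energyOperator_eq`,
`energyFormula_of_bound`).

The delicate point is that the contour runs through ν, which may lie in the spectrum of both
operators. The transfer identity `resolventDiff_transfer` spreads the bound on the vertical line
through ν to a sector around it, and a perpendicular crossing keeps the contour in that sector. On
the level of quadratic forms Cauchy's formula concerns the difference of two Stieltjes transforms of
spectral measures. Boundedness of D forces the two measures to have the same atom at ν (`atom_eq`),
and the weight f is approximated by weights vanishing at ν, for which Fubini's theorem applies
(`circleIntegral_stieltjes_sub`).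

Limiting absorption supplies the bound on D directly. At an isolated point D may have a pole, which
is at most simple; then ln Δ grows at most like |Im z|^(-1/2), a crude but integrable substitute for
a logarithm (`exists_trace_pole_bound`, `exists_boxBound_logDet`). The points ν + u with small u > 0
lie in both resolvent sets, so that the bounded case applies to them. The operator difference does
not depend on u, the choice f = 1 shows that neither does ξ(ν + u), and u → 0 is harmless because
the boundary values of the primitive are continuous up to ν (`energyFormula_of_isolated`).

The operator theory is built on finite sections in the fixed basis. A duality characterisation of
the trace norm makes the trace class an ideal; dimension-free determinant inequalities give
existence, multiplicativity and first order expansion of the Fredholm determinant. Spectral measures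
come from the continuous functional calculus of the bounded operator (H - a)⁻¹, and are identified
with the measures of the definition by uniqueness of the Stieltjes transform. -/

omit [CompleteSpace E] in
lemma op_mul_apply (A B : E →L[ℂ] E) (x : E) : (A * B) x = A (B x) := rfl

/-! ### Hilbert–Schmidt sums -/

/-- The squared Hilbert–Schmidt norm, with value `∞` if `A` is not Hilbert–Schmidt. -/
def hsSq (A : E →L[ℂ] E) : ℝ≥0∞ := ∑' i, ‖A (basis E i)‖ₑ ^ 2

/-- `A` is a Hilbert–Schmidt operator. -/
def IsHS (A : E →L[ℂ] E) : Prop := hsSq A ≠ ∞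

/-- The Hilbert–Schmidt norm. -/
def hsNorm (A : E →L[ℂ] E) : ℝ := √(hsSq A).toReal

lemma norm_basis (i : BasisIndex E) : ‖basis E i‖ = 1 := (basis E).orthonormal.norm_eq_one i

lemma tsum_enorm_inner_sq (x : E) : ∑' i, ‖⟪basis E i, x⟫_ℂ‖ₑ ^ 2 = ‖x‖ₑ ^ 2 := by
  have h := (basis E).hasSum_inner_mul_inner x x
  have h2 : HasSum (fun i => ‖⟪basis E i, x⟫_ℂ‖ ^ 2) (‖x‖ ^ 2) := by
    have := Complex.hasSum_re h
    convert this using 1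
    · ext i
      rw [← inner_conj_symm x, ← Complex.normSq_eq_conj_mul_self, Complex.ofReal_re,
        Complex.normSq_eq_norm_sq]
    · rw [inner_self_eq_norm_sq_to_K]; norm_cast
  have h3 := ENNReal.ofReal_tsum_of_nonneg (fun i => by positivity) h2.summable
  rw [h2.tsum_eq] at h3
  simp only [← ofReal_norm, ← ENNReal.ofReal_pow (norm_nonneg _)]
  exact h3.symm

lemma hsSq_eq_tsum_tsum (A : E →L[ℂ] E) :
    hsSq A = ∑' i, ∑' j, ‖⟪basis E j, A (basis E i)⟫_ℂ‖ₑ ^ 2 := by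
  simp only [hsSq, tsum_enorm_inner_sq]

/-- The double sum of squared matrix entries is symmetric in its two indices. Right multiplication
is thereby reduced to left multiplication. -/
lemma hsSq_adjoint (A : E →L[ℂ] E) : hsSq (star A) = hsSq A := by
  rw [hsSq_eq_tsum_tsum, hsSq_eq_tsum_tsum, ENNReal.tsum_comm]
  congr 1; ext i; congr 1; ext j
  rw [ContinuousLinearMap.star_eq_adjoint, ContinuousLinearMap.adjoint_inner_right,
    ← ofReal_norm, ← ofReal_norm, norm_inner_symm]

lemma hsSq_mul_left_le (X A : E →L[ℂ] E) : hsSq (X * A) ≤ ‖X‖ₑ ^ 2 * hsSq A := by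
  rw [hsSq, hsSq, ← ENNReal.tsum_mul_left]
  refine ENNReal.tsum_le_tsum fun i => ?_
  rw [← mul_pow]
  gcongr
  exact X.le_opENorm _

lemma hsSq_mul_right_le (A X : E →L[ℂ] E) : hsSq (A * X) ≤ ‖X‖ₑ ^ 2 * hsSq A := by
  rw [← hsSq_adjoint, ← hsSq_adjoint A, star_mul]
  refine (hsSq_mul_left_le _ _).trans ?_
  rw [← ofReal_norm, norm_star, ofReal_norm]

lemma hsNorm_nonneg (A : E →L[ℂ] E) : 0 ≤ hsNorm A := Real.sqrt_nonneg _

lemma hsNorm_sq (A : E →L[ℂ] E) : hsNorm A ^ 2 = (hsSq A).toReal :=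
  Real.sq_sqrt ENNReal.toReal_nonneg

lemma IsHS.adjoint {A : E →L[ℂ] E} (hA : IsHS A) : IsHS (star A) := by
  rwa [IsHS, hsSq_adjoint]

lemma hsNorm_adjoint (A : E →L[ℂ] E) : hsNorm (star A) = hsNorm A := by
  rw [hsNorm, hsSq_adjoint, hsNorm]

lemma IsHS.mul_left {A : E →L[ℂ] E} (hA : IsHS A) (X : E →L[ℂ] E) : IsHS (X * A) :=
  ne_top_of_le_ne_top (ENNReal.mul_ne_top (by simp) hA) (hsSq_mul_left_le X A)

lemma IsHS.mul_right {A : E →L[ℂ] E} (hA : IsHS A) (X : E →L[ℂ] E) : IsHS (A * X) :=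
  ne_top_of_le_ne_top (ENNReal.mul_ne_top (by simp) hA) (hsSq_mul_right_le A X)

lemma hsNorm_le_of_hsSq_le {A B X : E →L[ℂ] E} (hA : IsHS A)
    (h : hsSq B ≤ ‖X‖ₑ ^ 2 * hsSq A) : hsNorm B ≤ ‖X‖ * hsNorm A := by
  have := ENNReal.toReal_mono (ENNReal.mul_ne_top (by simp) hA) h
  rw [ENNReal.toReal_mul, ENNReal.toReal_pow, toReal_enorm] at this
  refine (Real.sqrt_le_sqrt this).trans ?_
  rw [Real.sqrt_mul (by positivity), Real.sqrt_sq (norm_nonneg _), hsNorm]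

lemma IsHS.hsNorm_mul_right_le {A : E →L[ℂ] E} (hA : IsHS A) (X : E →L[ℂ] E) :
    hsNorm (A * X) ≤ hsNorm A * ‖X‖ :=
  (hsNorm_le_of_hsSq_le hA (hsSq_mul_right_le A X)).trans_eq (mul_comm _ _)

lemma IsHS.hasSum_norm_sq {A : E →L[ℂ] E} (hA : IsHS A) :
    HasSum (fun i => ‖A (basis E i)‖ ^ 2) (hsNorm A ^ 2) := by
  have h : ∀ i, (‖A (basis E i)‖ₑ ^ 2).toReal = ‖A (basis E i)‖ ^ 2 := fun i => by simp
  have h1 : Summable fun i => ‖A (basis E i)‖ ^ 2 := by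
    simpa only [h] using ENNReal.summable_toReal hA
  rw [hsNorm_sq, hsSq, ENNReal.tsum_toReal_eq (fun i => by simp)]
  simpa only [h] using h1.hasSum

lemma isHS_of_sum_le {A : E →L[ℂ] E} {C : ℝ}
    (h : ∀ s : Finset (BasisIndex E), ∑ i ∈ s, ‖A (basis E i)‖ ^ 2 ≤ C) : IsHS A := by
  have hs : Summable fun i => ‖A (basis E i)‖ ^ 2 :=
    summable_of_sum_le (fun i => by positivity) h
  have := hs.tsum_ofReal_ne_top
  simpa only [IsHS, hsSq, ← ofReal_norm, ← ENNReal.ofReal_pow (norm_nonneg _)] using this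

lemma IsHS.sum_mul_le {A B : E →L[ℂ] E} (hA : IsHS A) (hB : IsHS B) (s : Finset (BasisIndex E)) :
    ∑ i ∈ s, ‖A (basis E i)‖ * ‖B (basis E i)‖ ≤ hsNorm A * hsNorm B := by
  refine (Real.sum_mul_le_sqrt_mul_sqrt s _ _).trans ?_
  have hle : ∀ {A : E →L[ℂ] E}, IsHS A → √(∑ i ∈ s, ‖A (basis E i)‖ ^ 2) ≤ hsNorm A := fun hA =>
    (Real.sqrt_le_sqrt (sum_le_hasSum s (fun i _ => by positivity) hA.hasSum_norm_sq)).trans_eq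
      (Real.sqrt_sq (hsNorm_nonneg _))
  exact mul_le_mul (hle hA) (hle hB) (Real.sqrt_nonneg _) (hsNorm_nonneg _)

/-! ### Trace norm -/

lemma isSelfAdjoint_sqrtAbs (A : E →L[ℂ] E) : IsSelfAdjoint (sqrtAbs A) :=
  (CFC.sqrt_nonneg _).isSelfAdjoint

lemma sqrtAbs_mul_self (A : E →L[ℂ] E) : sqrtAbs A * sqrtAbs A = CFC.abs A :=
  CFC.sqrt_mul_sqrt_self _ (CFC.abs_nonneg A)

lemma inner_star_left (A : E →L[ℂ] E) (x y : E) : ⟪(star A) x, y⟫_ℂ = ⟪x, A y⟫_ℂ :=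
  A.adjoint_inner_left y x

lemma inner_star_right (A : E →L[ℂ] E) (x y : E) : ⟪x, (star A) y⟫_ℂ = ⟪A x, y⟫_ℂ :=
  A.adjoint_inner_right x y

lemma IsSelfAdjoint.inner_map {A : E →L[ℂ] E} (hA : IsSelfAdjoint A) (x y : E) :
    ⟪A x, y⟫_ℂ = ⟪x, A y⟫_ℂ := by
  conv_lhs => rw [← hA.star_eq]
  exact inner_star_left A x y

/-- Since |A| = √|A| √|A|, the trace norm is a squared Hilbert–Schmidt norm, and estimates for it
become instances of Cauchy–Schwarz. -/
lemma traceNorm_eq_hsSq (A : E →L[ℂ] E) : traceNorm A = hsSq (sqrtAbs A) := by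
  rw [traceNorm, hsSq]
  congr 1; ext i
  rw [← sqrtAbs_mul_self, op_mul_apply,
    ← IsSelfAdjoint.inner_map (isSelfAdjoint_sqrtAbs A), inner_self_eq_norm_sq_to_K,
    ← ofReal_norm, ← ENNReal.ofReal_pow (norm_nonneg _)]
  norm_cast

/-- Approximate polar decomposition. -/
lemma exists_polar_approx (A : E →L[ℂ] E) {ε : ℝ} (hε : 0 < ε) :
    ∃ U : E →L[ℂ] E, ‖U‖ ≤ 1 ∧ ‖A - U * CFC.abs A‖ ≤ ε ∧ ‖CFC.abs A - star U * A‖ ≤ ε := by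
  set T := CFC.abs A with hT
  have hT0 : 0 ≤ T := CFC.abs_nonneg A
  have hTs : IsSelfAdjoint T := hT0.isSelfAdjoint
  have hspec : ∀ x ∈ spectrum ℝ T, 0 ≤ x := fun x hx => spectrum_nonneg_of_nonneg hT0 hx
  have hcont : ContinuousOn (fun x : ℝ => (x + ε)⁻¹) (spectrum ℝ T) :=
    ContinuousOn.inv₀ (by fun_prop) fun x hx => by linarith [hspec x hx]
  -- W = (|A| + ε)⁻¹, and A W serves as a regularised polar factor. The two errors are exactly ε A W
  -- and ε |A| W, and both A W and |A| W are contractions; no partial isometry is needed.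
  set W := cfc (fun x : ℝ => (x + ε)⁻¹) T with hW
  have hWs : IsSelfAdjoint W := cfc_predicate _ _
  have hTW : T * W = cfc (fun x : ℝ => x * (x + ε)⁻¹) T := by
    rw [cfc_mul (fun x => x) _ T (by fun_prop) hcont, cfc_id' ℝ T]
  have hWT : W * T = T * W := by
    have := cfc_commute_cfc (fun x : ℝ => (x + ε)⁻¹) (fun x => x) T
    rw [cfc_id' ℝ T] at this
    exact this
  have hTWn : ‖T * W‖ ≤ 1 := by
    rw [hTW]
    refine norm_cfc_le zero_le_one fun x hx => ?_
    have := hspec x hx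
    rw [Real.norm_of_nonneg (by positivity), ← div_eq_mul_inv, div_le_one (by positivity)]
    linarith
  have hone : T * W + ε • W = 1 := by
    rw [hTW, hW, ← cfc_smul ε _ T hcont, ← cfc_add T _ _ (by fun_prop) (by fun_prop)]
    rw [← cfc_one ℝ T]
    refine cfc_congr fun x hx => ?_
    have := hspec x hx
    simp only [smul_eq_mul, Pi.one_apply]
    field_simp
  have hU : ‖A * W‖ ≤ 1 := by
    have hh : ∀ x, ‖(A * W) x‖ = ‖(T * W) x‖ := fun x => by
      have h1 : ⟪(A * W) x, (A * W) x⟫_ℂ = ⟪(T * W) x, (T * W) x⟫_ℂ := by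
        rw [op_mul_apply T W, IsSelfAdjoint.inner_map hTs, ← op_mul_apply T T, CFC.abs_mul_abs,
          op_mul_apply, op_mul_apply, inner_star_right]
      rw [inner_self_eq_norm_sq_to_K, inner_self_eq_norm_sq_to_K] at h1
      exact (pow_left_inj₀ (norm_nonneg _) (norm_nonneg _) two_ne_zero).1 (by exact_mod_cast h1)
    refine ContinuousLinearMap.opNorm_le_bound _ zero_le_one fun x => ?_
    rw [hh]
    exact (T * W).le_of_opNorm_le hTWn x
  refine ⟨A * W, hU, ?_, ?_⟩
  · have : A - A * W * T = ε • (A * W) := by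
      calc A - A * W * T = A * (1 - T * W) := by rw [mul_assoc, hWT, mul_sub, mul_one]
        _ = ε • (A * W) := by rw [← hone]; simp
    rw [this, norm_smul, Real.norm_of_nonneg hε.le]
    nlinarith
  · have : T - star (A * W) * A = ε • (T * W) := by
      rw [star_mul, hWs.star_eq, mul_assoc, ← CFC.abs_mul_abs, ← hT, ← mul_assoc, hWT]
      calc T - T * W * T = T * (1 - T * W) := by rw [mul_assoc, hWT, mul_sub, mul_one]
        _ = ε • (T * W) := by rw [← hone]; simp
    rw [this, norm_smul, Real.norm_of_nonneg hε.le]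
    nlinarith

lemma IsTraceClass.isHS_sqrtAbs {A : E →L[ℂ] E} (hA : IsTraceClass A) : IsHS (sqrtAbs A) := by
  rwa [IsHS, ← traceNorm_eq_hsSq]

lemma toReal_traceNorm (A : E →L[ℂ] E) : (traceNorm A).toReal = hsNorm (sqrtAbs A) ^ 2 := by
  rw [hsNorm_sq, traceNorm_eq_hsSq]

/-- Duality bound: the sections of `X* A Y` are controlled by the trace norm of `A`. -/
lemma IsTraceClass.sum_norm_inner_le {A : E →L[ℂ] E} (hA : IsTraceClass A) (X Y : E →L[ℂ] E)
    (s : Finset (BasisIndex E)) :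
    ∑ i ∈ s, ‖⟪X (basis E i), A (Y (basis E i))⟫_ℂ‖ ≤ ‖X‖ * ‖Y‖ * (traceNorm A).toReal := by
  refine le_of_forall_pos_le_add fun δ hδ => ?_
  obtain ⟨ε, hε, hεδ⟩ : ∃ ε : ℝ, 0 < ε ∧ s.card * (ε * (‖X‖ * ‖Y‖)) ≤ δ := by
    refine ⟨δ / (s.card * (‖X‖ * ‖Y‖) + 1), by positivity, ?_⟩
    rw [show s.card * (δ / (s.card * (‖X‖ * ‖Y‖) + 1) * (‖X‖ * ‖Y‖)) =
      δ * ((s.card * (‖X‖ * ‖Y‖)) / (s.card * (‖X‖ * ‖Y‖) + 1)) by ring]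
    have : (s.card * (‖X‖ * ‖Y‖)) / (s.card * (‖X‖ * ‖Y‖) + 1) ≤ 1 := by
      rw [div_le_one (by positivity)]; linarith
    nlinarith
  -- Replace A by U |A| = U S S with S = √|A| at the cost of ε ‖X‖ ‖Y‖ for each basis vector;
  -- Cauchy–Schwarz for the two factors S bounds the rest. The choice of ε keeps the total error
  -- over `s` below δ.
  obtain ⟨U, hU, hUA, -⟩ := exists_polar_approx A hε
  set S := sqrtAbs A with hS
  have hSs : IsSelfAdjoint S := isSelfAdjoint_sqrtAbs A
  have hSh : IsHS S := hA.isHS_sqrtAbs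
  have key : ∀ i, ‖⟪X (basis E i), A (Y (basis E i))⟫_ℂ‖ ≤
      ‖(S * (star U * X)) (basis E i)‖ * ‖(S * Y) (basis E i)‖ + ε * (‖X‖ * ‖Y‖) := fun i => by
    set b := basis E i
    have hX : ‖X b‖ ≤ ‖X‖ := by simpa [b, norm_basis] using X.le_opNorm b
    have hY : ‖Y b‖ ≤ ‖Y‖ := by simpa [b, norm_basis] using Y.le_opNorm b
    have hsplit : ⟪X b, A (Y b)⟫_ℂ =
        ⟪(S * (star U * X)) b, (S * Y) b⟫_ℂ + ⟪X b, (A - U * CFC.abs A) (Y b)⟫_ℂ := by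
      simp only [op_mul_apply, sub_apply]
      rw [IsSelfAdjoint.inner_map hSs, ← op_mul_apply S S, sqrtAbs_mul_self,
        inner_star_left, inner_sub_right]
      ring
    rw [hsplit]
    refine (norm_add_le _ _).trans (add_le_add (norm_inner_le_norm _ _) ?_)
    calc ‖⟪X b, (A - U * CFC.abs A) (Y b)⟫_ℂ‖ ≤ ‖X b‖ * ‖(A - U * CFC.abs A) (Y b)‖ :=
          norm_inner_le_norm _ _
      _ ≤ ‖X‖ * (ε * ‖Y‖) := by
          gcongr
          exact (ContinuousLinearMap.le_of_opNorm_le _ hUA _).trans (by gcongr)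
      _ = ε * (‖X‖ * ‖Y‖) := by ring
  calc ∑ i ∈ s, ‖⟪X (basis E i), A (Y (basis E i))⟫_ℂ‖
      ≤ ∑ i ∈ s, (‖(S * (star U * X)) (basis E i)‖ * ‖(S * Y) (basis E i)‖ +
        ε * (‖X‖ * ‖Y‖)) := Finset.sum_le_sum fun i _ => key i
    _ = ∑ i ∈ s, ‖(S * (star U * X)) (basis E i)‖ * ‖(S * Y) (basis E i)‖ +
        s.card * (ε * (‖X‖ * ‖Y‖)) := by
        rw [Finset.sum_add_distrib, Finset.sum_const, nsmul_eq_mul]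
    _ ≤ hsNorm (S * (star U * X)) * hsNorm (S * Y) + δ :=
        add_le_add (IsHS.sum_mul_le (hSh.mul_right _) (hSh.mul_right _) s) hεδ
    _ ≤ (hsNorm S * ‖X‖) * (hsNorm S * ‖Y‖) + δ := by
        have hUX : ‖star U * X‖ ≤ ‖X‖ := by
          refine (norm_mul_le _ _).trans ?_
          rw [norm_star]
          nlinarith [norm_nonneg X]
        have h1 := hSh.hsNorm_mul_right_le (star U * X)
        have h2 := hSh.hsNorm_mul_right_le Y
        have h3 := hsNorm_nonneg S
        gcongr
        · exact hsNorm_nonneg _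
        · exact h1.trans (by gcongr)
    _ = ‖X‖ * ‖Y‖ * (traceNorm A).toReal + δ := by rw [toReal_traceNorm]; ring

/-- Converse of the duality bound. -/
lemma traceNorm_le_of_forall_contraction {A : E →L[ℂ] E} {C : ℝ}
    (h : ∀ W : E →L[ℂ] E, ‖W‖ ≤ 1 → ∀ s : Finset (BasisIndex E),
      ‖∑ i ∈ s, ⟪W (basis E i), A (basis E i)⟫_ℂ‖ ≤ C) :
    traceNorm A ≤ ENNReal.ofReal C := by
  have hnn : ∀ i, 0 ≤ (⟪basis E i, CFC.abs A (basis E i)⟫_ℂ).re := fun i => by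
    rw [← sqrtAbs_mul_self, op_mul_apply,
      ← IsSelfAdjoint.inner_map (isSelfAdjoint_sqrtAbs A), inner_self_eq_norm_sq_to_K]
    norm_cast
    exact sq_nonneg _
  rw [traceNorm, ENNReal.tsum_eq_iSup_sum]
  refine iSup_le fun s => ?_
  rw [← ENNReal.ofReal_sum_of_nonneg fun i _ => hnn i]
  refine ENNReal.ofReal_le_ofReal (le_of_forall_pos_le_add fun δ hδ => ?_)
  obtain ⟨ε, hε, hεδ⟩ : ∃ ε : ℝ, 0 < ε ∧ s.card * ε ≤ δ := by
    refine ⟨δ / (s.card + 1), by positivity, ?_⟩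
    rw [← mul_div_assoc, div_le_iff₀ (by positivity)]
    nlinarith
  -- The hypothesis is tested on the approximate polar factor, for which ⟨U e, A e⟩ = ⟨e, U* A e⟩ is
  -- close to ⟨e, |A| e⟩.
  obtain ⟨U, hU, -, hUA⟩ := exists_polar_approx A hε
  have key : ∀ i, (⟪basis E i, CFC.abs A (basis E i)⟫_ℂ).re ≤
      (⟪U (basis E i), A (basis E i)⟫_ℂ).re + ε := fun i => by
    have : ⟪basis E i, CFC.abs A (basis E i)⟫_ℂ = ⟪U (basis E i), A (basis E i)⟫_ℂ +
        ⟪basis E i, (CFC.abs A - star U * A) (basis E i)⟫_ℂ := by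
      rw [sub_apply, inner_sub_right, op_mul_apply,
        inner_star_right]
      ring
    rw [this, Complex.add_re]
    gcongr
    refine (Complex.re_le_norm _).trans ((norm_inner_le_norm _ _).trans ?_)
    rw [norm_basis, one_mul]
    exact (ContinuousLinearMap.le_of_opNorm_le _ hUA _).trans_eq (by rw [norm_basis, mul_one])
  calc ∑ i ∈ s, (⟪basis E i, CFC.abs A (basis E i)⟫_ℂ).re
      ≤ ∑ i ∈ s, ((⟪U (basis E i), A (basis E i)⟫_ℂ).re + ε) := Finset.sum_le_sum fun i _ => key i
    _ = (∑ i ∈ s, ⟪U (basis E i), A (basis E i)⟫_ℂ).re + s.card * ε := by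
        rw [Finset.sum_add_distrib, Finset.sum_const, nsmul_eq_mul, Complex.re_sum]
    _ ≤ C + δ := add_le_add ((Complex.re_le_norm _).trans (h U hU s)) hεδ

/-- The trace norm as a real number (for trace class operators). -/
def trNorm (A : E →L[ℂ] E) : ℝ := (traceNorm A).toReal

lemma trNorm_nonneg (A : E →L[ℂ] E) : 0 ≤ trNorm A := ENNReal.toReal_nonneg

section Bound

variable {A : E →L[ℂ] E} {C : ℝ}
  (h : ∀ W : E →L[ℂ] E, ‖W‖ ≤ 1 → ∀ s : Finset (BasisIndex E),
    ‖∑ i ∈ s, ⟪W (basis E i), A (basis E i)⟫_ℂ‖ ≤ C)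

-- The criterion behind all closure properties of the trace class: its hypothesis is linear in A and
-- compatible with products and integrals, whereas |A| is not.
include h in
lemma isTraceClass_of_bound : IsTraceClass A :=
  ne_top_of_le_ne_top ENNReal.ofReal_ne_top (traceNorm_le_of_forall_contraction h)

include h in
lemma trNorm_le_of_bound : trNorm A ≤ C := by
  have hC : 0 ≤ C := (norm_nonneg _).trans (h 0 (by simp) ∅)
  exact ENNReal.toReal_le_of_le_ofReal hC (traceNorm_le_of_forall_contraction h)

end Bound

lemma IsTraceClass.norm_sum_inner_le {A : E →L[ℂ] E} (hA : IsTraceClass A) (X Y : E →L[ℂ] E)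
    (s : Finset (BasisIndex E)) :
    ‖∑ i ∈ s, ⟪X (basis E i), A (Y (basis E i))⟫_ℂ‖ ≤ ‖X‖ * ‖Y‖ * trNorm A :=
  (norm_sum_le _ _).trans (hA.sum_norm_inner_le X Y s)

lemma IsTraceClass.norm_sum_contraction_le {A : E →L[ℂ] E} (hA : IsTraceClass A)
    {W : E →L[ℂ] E} (hW : ‖W‖ ≤ 1) (s : Finset (BasisIndex E)) :
    ‖∑ i ∈ s, ⟪W (basis E i), A (basis E i)⟫_ℂ‖ ≤ trNorm A := by
  have h := hA.norm_sum_inner_le W (1 : E →L[ℂ] E) s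
  have h1 : ‖(1 : E →L[ℂ] E)‖ ≤ 1 := ContinuousLinearMap.norm_id_le
  refine h.trans ?_
  have h2 : ‖W‖ * ‖(1 : E →L[ℂ] E)‖ ≤ 1 := mul_le_one₀ hW (norm_nonneg _) h1
  nlinarith [trNorm_nonneg A]

/-! ### The trace class as an operator ideal. -/

section Add

variable {A B : E →L[ℂ] E} (hA : IsTraceClass A) (hB : IsTraceClass B)

include hA hB in
lemma add_bound (W : E →L[ℂ] E) (hW : ‖W‖ ≤ 1) (s : Finset (BasisIndex E)) :
    ‖∑ i ∈ s, ⟪W (basis E i), (A + B) (basis E i)⟫_ℂ‖ ≤ trNorm A + trNorm B := by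
  simp only [add_apply, inner_add_right, Finset.sum_add_distrib]
  exact (norm_add_le _ _).trans
    (add_le_add (hA.norm_sum_contraction_le hW s) (hB.norm_sum_contraction_le hW s))

include hA hB in
lemma IsTraceClass.add : IsTraceClass (A + B) := isTraceClass_of_bound (add_bound hA hB)

include hA hB in
lemma IsTraceClass.trNorm_add_le : trNorm (A + B) ≤ trNorm A + trNorm B :=
  trNorm_le_of_bound (add_bound hA hB)

include hA in
lemma mul_bound (X Y : E →L[ℂ] E) (W : E →L[ℂ] E) (hW : ‖W‖ ≤ 1)
    (s : Finset (BasisIndex E)) :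
    ‖∑ i ∈ s, ⟪W (basis E i), (X * A * Y) (basis E i)⟫_ℂ‖ ≤ ‖X‖ * trNorm A * ‖Y‖ := by
  have h := hA.norm_sum_inner_le (star X * W) Y s
  simp only [op_mul_apply, inner_star_left] at h ⊢
  refine h.trans ?_
  have h1 : ‖star X * W‖ ≤ ‖X‖ := (norm_mul_le _ _).trans (by
    rw [norm_star]; exact mul_le_of_le_one_right (norm_nonneg _) hW)
  calc ‖star X * W‖ * ‖Y‖ * trNorm A ≤ ‖X‖ * ‖Y‖ * trNorm A := by
        have := trNorm_nonneg A
        gcongr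
    _ = _ := by ring

include hA in
lemma IsTraceClass.mul_mul (X Y : E →L[ℂ] E) : IsTraceClass (X * A * Y) :=
  isTraceClass_of_bound (mul_bound hA X Y)

include hA in
lemma IsTraceClass.trNorm_mul_mul_le (X Y : E →L[ℂ] E) :
    trNorm (X * A * Y) ≤ ‖X‖ * trNorm A * ‖Y‖ :=
  trNorm_le_of_bound (mul_bound hA X Y)

include hA in
lemma IsTraceClass.mul_left (X : E →L[ℂ] E) : IsTraceClass (X * A) := by
  simpa using hA.mul_mul X 1

include hA in
lemma IsTraceClass.mul_right (Y : E →L[ℂ] E) : IsTraceClass (A * Y) := by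
  simpa using hA.mul_mul 1 Y

include hA in
lemma IsTraceClass.trNorm_mul_right_le (Y : E →L[ℂ] E) : trNorm (A * Y) ≤ trNorm A * ‖Y‖ := by
  have h := hA.trNorm_mul_mul_le 1 Y
  rw [one_mul] at h
  refine h.trans (mul_le_mul_of_nonneg_right ?_ (norm_nonneg _))
  exact mul_le_of_le_one_left (trNorm_nonneg _) ContinuousLinearMap.norm_id_le

include hA in
lemma smul_bound (c : ℂ) (W : E →L[ℂ] E) (hW : ‖W‖ ≤ 1) (s : Finset (BasisIndex E)) :
    ‖∑ i ∈ s, ⟪W (basis E i), (c • A) (basis E i)⟫_ℂ‖ ≤ ‖c‖ * trNorm A := by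
  simp only [smul_apply, inner_smul_right, ← Finset.mul_sum, norm_mul]
  gcongr
  exact hA.norm_sum_contraction_le hW s

include hA in
lemma IsTraceClass.smul (c : ℂ) : IsTraceClass (c • A) := isTraceClass_of_bound (smul_bound hA c)

include hA in
lemma IsTraceClass.trNorm_smul_le (c : ℂ) : trNorm (c • A) ≤ ‖c‖ * trNorm A :=
  trNorm_le_of_bound (smul_bound hA c)

include hA in
lemma IsTraceClass.neg : IsTraceClass (-A) := by simpa using hA.smul (-1)

include hA in
lemma IsTraceClass.trNorm_neg_le : trNorm (-A) ≤ trNorm A := by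
  simpa using hA.trNorm_smul_le (-1)

include hA hB in
lemma IsTraceClass.sub : IsTraceClass (A - B) := by
  rw [sub_eq_add_neg]; exact hA.add hB.neg

include hA in
lemma IsTraceClass.sum_norm_diag_le (s : Finset (BasisIndex E)) :
    ∑ i ∈ s, ‖⟪basis E i, A (basis E i)⟫_ℂ‖ ≤ trNorm A := by
  have h := hA.sum_norm_inner_le 1 1 s
  refine h.trans ?_
  have h1 : ‖(1 : E →L[ℂ] E)‖ ≤ 1 := ContinuousLinearMap.norm_id_le
  exact mul_le_of_le_one_left (trNorm_nonneg _) (mul_le_one₀ h1 (norm_nonneg _) h1)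

include hA in
lemma IsTraceClass.summable_norm_diag : Summable fun i => ‖⟪basis E i, A (basis E i)⟫_ℂ‖ :=
  summable_of_sum_le (fun _ => norm_nonneg _) hA.sum_norm_diag_le

include hA in
lemma IsTraceClass.hasSum_trace : HasSum (fun i => ⟪basis E i, A (basis E i)⟫_ℂ) (trace A) :=
  hA.summable_norm_diag.of_norm.hasSum

include hA in
lemma IsTraceClass.norm_trace_le : ‖trace A‖ ≤ trNorm A :=
  le_of_tendsto hA.hasSum_trace.norm
    (Eventually.of_forall fun s => (norm_sum_le _ _).trans (hA.sum_norm_diag_le s))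

include hA hB in
lemma IsTraceClass.trace_add : trace (A + B) = trace A + trace B := by
  refine HasSum.tsum_eq ?_
  simpa only [add_apply, inner_add_right] using hA.hasSum_trace.add hB.hasSum_trace

lemma trace_smul (c : ℂ) (A : E →L[ℂ] E) : trace (c • A) = c * trace A := by
  simp only [trace, smul_apply, inner_smul_right, tsum_mul_left]

lemma trace_star (A : E →L[ℂ] E) : trace (star A) = starRingEnd ℂ (trace A) := by
  rw [trace, trace, Complex.conj_tsum]
  simp only [inner_star_right, inner_conj_symm]

-- The duality bound is applied to the rank one operators X and Y that carry one basis vector to A v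
-- and to v: it yields ‖A v‖² ≤ ‖A v‖ ‖v‖ ‖A‖₁.
include hA in
lemma IsTraceClass.norm_le_trNorm : ‖A‖ ≤ trNorm A := by
  refine ContinuousLinearMap.opNorm_le_bound _ (trNorm_nonneg A) fun v => ?_
  rcases isEmpty_or_nonempty (BasisIndex E) with he | ⟨⟨i⟩⟩
  · have : v = 0 := by
      have := tsum_enorm_inner_sq v
      rw [tsum_empty] at this
      simpa using this.symm
    simp [this]
  set b := basis E i with hb
  have hbb : ⟪b, b⟫_ℂ = 1 := by
    rw [inner_self_eq_norm_sq_to_K, hb, norm_basis]; simp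
  have hn : ∀ u : E, ‖(innerSL ℂ b).smulRight u‖ ≤ ‖u‖ := fun u => by
    rw [ContinuousLinearMap.norm_smulRight_apply, innerSL_apply_norm, hb, norm_basis, one_mul]
  have h := hA.norm_sum_inner_le ((innerSL ℂ b).smulRight (A v)) ((innerSL ℂ b).smulRight v) {i}
  simp only [Finset.sum_singleton, ContinuousLinearMap.smulRight_apply, innerSL_apply_apply] at h
  rw [← hb, hbb, one_smul, one_smul, inner_self_eq_norm_sq_to_K] at h
  have h2 : ‖A v‖ ^ 2 ≤ ‖A v‖ * ‖v‖ * trNorm A := by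
    refine le_trans (by simp) (h.trans ?_)
    have := trNorm_nonneg A
    gcongr
    · exact hn _
    · exact hn _
  rcases (norm_nonneg (A v)).eq_or_lt with h0 | h0
  · rw [← h0]; exact mul_nonneg (trNorm_nonneg _) (norm_nonneg _)
  · nlinarith

-- The duality bound with X = A and Y = 1, combined with the domination of the operator norm by the
-- trace norm.
include hA in
lemma IsTraceClass.sum_norm_sq_le (s : Finset (BasisIndex E)) :
    ∑ i ∈ s, ‖A (basis E i)‖ ^ 2 ≤ trNorm A ^ 2 := by
  have h := hA.sum_norm_inner_le A 1 s
  have h1 : ‖(1 : E →L[ℂ] E)‖ ≤ 1 := ContinuousLinearMap.norm_id_le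
  have h2 : ∀ i, ‖⟪A (basis E i), A ((1 : E →L[ℂ] E) (basis E i))⟫_ℂ‖ = ‖A (basis E i)‖ ^ 2 :=
    fun i => by
      rw [one_apply_eq_self, inner_self_eq_norm_sq_to_K]; simp
  simp only [h2] at h
  refine h.trans ?_
  have h3 := hA.norm_le_trNorm
  have h4 := trNorm_nonneg A
  change _ * trNorm A ≤ _
  have : ‖A‖ * ‖(1 : E →L[ℂ] E)‖ ≤ trNorm A * 1 := mul_le_mul h3 h1 (norm_nonneg _) h4
  nlinarith

include hA in
lemma IsTraceClass.isHS : IsHS A := isHS_of_sum_le hA.sum_norm_sq_le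

include hA in
lemma IsTraceClass.hsNorm_le : hsNorm A ≤ trNorm A := by
  refine (pow_le_pow_iff_left₀ (hsNorm_nonneg A) (trNorm_nonneg A) two_ne_zero).1 ?_
  exact le_of_tendsto hA.isHS.hasSum_norm_sq (Eventually.of_forall hA.sum_norm_sq_le)

end Add

/-! ### Products of two Hilbert–Schmidt operators. -/

section HSProduct

variable {A B : E →L[ℂ] E} (hA : IsHS A) (hB : IsHS B)

include hA hB in
lemma hs_mul_bound (W : E →L[ℂ] E) (hW : ‖W‖ ≤ 1) (s : Finset (BasisIndex E)) :
    ‖∑ i ∈ s, ⟪W (basis E i), (A * B) (basis E i)⟫_ℂ‖ ≤ hsNorm A * hsNorm B := by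
  have hAs : IsHS (star A * W) := hA.adjoint.mul_right W
  calc ‖∑ i ∈ s, ⟪W (basis E i), (A * B) (basis E i)⟫_ℂ‖
      ≤ ∑ i ∈ s, ‖(star A * W) (basis E i)‖ * ‖B (basis E i)‖ := by
        refine (norm_sum_le _ _).trans (Finset.sum_le_sum fun i _ => ?_)
        rw [op_mul_apply, ← inner_star_left, ← op_mul_apply]
        exact norm_inner_le_norm _ _
    _ ≤ hsNorm (star A * W) * hsNorm B := hAs.sum_mul_le hB s
    _ ≤ hsNorm A * hsNorm B := by
        refine mul_le_mul_of_nonneg_right ?_ (hsNorm_nonneg _)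
        refine (hA.adjoint.hsNorm_mul_right_le W).trans ?_
        rw [hsNorm_adjoint]
        exact mul_le_of_le_one_right (hsNorm_nonneg _) hW

include hA hB in
lemma IsHS.mul : IsTraceClass (A * B) := isTraceClass_of_bound (hs_mul_bound hA hB)

include hA hB in
lemma IsHS.trNorm_mul_le : trNorm (A * B) ≤ hsNorm A * hsNorm B :=
  trNorm_le_of_bound (hs_mul_bound hA hB)

include hA in
lemma IsHS.summable_norm_inner_sq :
    Summable fun p : BasisIndex E × BasisIndex E => ‖⟪basis E p.2, A (basis E p.1)⟫_ℂ‖ ^ 2 := by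
  have h : ∑' p : BasisIndex E × BasisIndex E, ‖⟪basis E p.2, A (basis E p.1)⟫_ℂ‖ₑ ^ 2 ≠ ∞ := by
    rw [ENNReal.tsum_prod', ← hsSq_eq_tsum_tsum]
    exact hA
  simpa using ENNReal.summable_toReal h

-- Both traces are the same double series summed in two orders. With two Hilbert–Schmidt factors the
-- series converges absolutely, which justifies the exchange.
include hA hB in
lemma IsHS.trace_mul_comm : trace (A * B) = trace (B * A) := by
  have hexp : ∀ C D : E →L[ℂ] E, trace (C * D) =
      ∑' i, ∑' j, ⟪basis E i, C (basis E j)⟫_ℂ * ⟪basis E j, D (basis E i)⟫_ℂ := fun C D => by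
    rw [trace]
    congr 1; ext i
    rw [op_mul_apply, ← inner_star_left, ← (basis E).tsum_inner_mul_inner]
    simp only [inner_star_left]
  set F : BasisIndex E → BasisIndex E → ℂ := fun i j =>
    ⟪basis E i, A (basis E j)⟫_ℂ * ⟪basis E j, B (basis E i)⟫_ℂ with hF
  have hs : Summable (Function.uncurry F) := by
    have h1 := (hA.summable_norm_inner_sq.comp_injective (Equiv.prodComm _ _).injective).add
      hB.summable_norm_inner_sq
    refine Summable.of_norm_bounded h1 fun p => ?_
    change ‖⟪basis E p.1, A (basis E p.2)⟫_ℂ * ⟪basis E p.2, B (basis E p.1)⟫_ℂ‖ ≤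
      ‖⟪basis E p.1, A (basis E p.2)⟫_ℂ‖ ^ 2 + ‖⟪basis E p.2, B (basis E p.1)⟫_ℂ‖ ^ 2
    rw [norm_mul]
    generalize ‖⟪basis E p.1, A (basis E p.2)⟫_ℂ‖ = a
    generalize ‖⟪basis E p.2, B (basis E p.1)⟫_ℂ‖ = b
    nlinarith [sq_nonneg (a - b), sq_nonneg a, sq_nonneg b]
  rw [hexp A B, hexp B A]
  refine (Summable.tsum_comm (f := F) hs).symm.trans ?_
  refine tsum_congr fun j => tsum_congr fun i => ?_
  rw [hF, mul_comm]

end HSProduct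

/-! ### Determinant inequalities for matrices, independent of the dimension. -/

section MatrixDet

variable {n : Type*} [Fintype n] [DecidableEq n]

/-- The squared Frobenius norm of a matrix. -/
def frobSq {n : Type*} [Fintype n] (M : Matrix n n ℂ) : ℝ := ∑ i, ∑ j, ‖M i j‖ ^ 2

omit [DecidableEq n] in
lemma frobSq_smul (c : ℂ) (M : Matrix n n ℂ) : frobSq (c • M) = ‖c‖ ^ 2 * frobSq M := by
  simp only [frobSq, Matrix.smul_apply, smul_eq_mul, norm_mul, mul_pow, Finset.mul_sum]

omit [DecidableEq n] in
lemma frobSq_add_le (M N : Matrix n n ℂ) : frobSq (M + N) ≤ 2 * frobSq M + 2 * frobSq N := by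
  simp only [frobSq, Finset.mul_sum, ← Finset.sum_add_distrib]
  refine Finset.sum_le_sum fun i _ => Finset.sum_le_sum fun j _ => ?_
  have := norm_add_le (M i j) (N i j)
  rw [Matrix.add_apply]
  nlinarith [norm_nonneg (M i j + N i j), sq_nonneg (‖M i j‖ - ‖N i j‖)]

-- The number |det(1 + M)|² is the product of the eigenvalues λ ≥ 0 of (1 + M)*(1 + M). Each
-- satisfies λ ≤ exp(λ - 1), and the sum of all λ - 1 is 2 Re tr M plus the squared Frobenius norm.
-- Only quantities that the trace norm controls uniformly over all finite sections enter.
open scoped ComplexOrder in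
lemma norm_det_one_add_le (M : Matrix n n ℂ) :
    ‖(1 + M).det‖ ≤ Real.exp (‖M.trace‖ + frobSq M / 2) := by
  set X := 1 + M with hX
  have hP := Matrix.posSemidef_conjTranspose_mul_self X
  have hdet : ‖X.det‖ ^ 2 = ∏ i, hP.isHermitian.eigenvalues i := by
    have h := hP.isHermitian.det_eq_prod_eigenvalues
    rw [Matrix.det_mul, Matrix.det_conjTranspose, Complex.star_def,
      ← Complex.normSq_eq_conj_mul_self, Complex.normSq_eq_norm_sq] at h
    refine Complex.ofReal_injective (h.trans ?_)
    push_cast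
    rfl
  have htr : ∑ i, hP.isHermitian.eigenvalues i = Fintype.card n + 2 * M.trace.re + frobSq M := by
    have h := congrArg Complex.re hP.isHermitian.trace_eq_sum_eigenvalues
    rw [Complex.re_sum] at h
    simp only [Complex.coe_algebraMap, Complex.ofReal_re] at h
    have h3 : (X.conjTranspose * X).trace =
        (Fintype.card n : ℂ) + (star M.trace + M.trace) + ((frobSq M : ℝ) : ℂ) := by
      have : (M.conjTranspose * M).trace = ((frobSq M : ℝ) : ℂ) := by
        simp only [Matrix.trace, Matrix.diag_apply, Matrix.mul_apply, Matrix.conjTranspose_apply,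
          frobSq]
        push_cast
        rw [Finset.sum_comm]
        refine Finset.sum_congr rfl fun i _ => Finset.sum_congr rfl fun j _ => ?_
        rw [Complex.star_def, ← Complex.normSq_eq_conj_mul_self, Complex.normSq_eq_norm_sq]
        norm_cast
      rw [hX, Matrix.conjTranspose_add, Matrix.conjTranspose_one,
        show (1 + M.conjTranspose) * (1 + M) = 1 + M + M.conjTranspose + M.conjTranspose * M by
          noncomm_ring, Matrix.trace_add, Matrix.trace_add, Matrix.trace_add, this,
        Matrix.trace_conjTranspose, Matrix.trace_one]
      ring
    rw [h3] at h
    simp only [Complex.add_re, Complex.natCast_re, Complex.star_def, Complex.conj_re,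
      Complex.ofReal_re] at h
    rw [show M.trace.re + M.trace.re = 2 * M.trace.re by ring] at h
    rw [h]
  have h2 : ‖X.det‖ ^ 2 ≤ Real.exp (‖M.trace‖ + frobSq M / 2) ^ 2 := by
    rw [hdet, ← Real.exp_nat_mul]
    calc ∏ i, hP.isHermitian.eigenvalues i
        ≤ ∏ i, Real.exp (hP.isHermitian.eigenvalues i - 1) :=
          Finset.prod_le_prod (fun i _ => hP.eigenvalues_nonneg i) fun i _ => by
            linarith [Real.add_one_le_exp (hP.isHermitian.eigenvalues i - 1)]
      _ = Real.exp (2 * M.trace.re + frobSq M) := by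
          rw [← Real.exp_sum, Finset.sum_sub_distrib, htr]
          simp [add_assoc]
      _ ≤ _ := by
          refine Real.exp_le_exp.2 ?_
          push_cast
          linarith [Complex.re_le_norm M.trace]
  exact (pow_le_pow_iff_left₀ (norm_nonneg _) (Real.exp_pos _).le two_ne_zero).1 h2

lemma differentiable_det_add_smul (M N : Matrix n n ℂ) :
    Differentiable ℂ fun ζ : ℂ => (M + ζ • N).det := by
  simp only [Matrix.det_apply, Matrix.add_apply, Matrix.smul_apply, smul_eq_mul]
  fun_prop

/-- Local Lipschitz bound for the determinant in terms of trace and Frobenius norm. -/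
lemma norm_det_sub_det_le {M N : Matrix n n ℂ} {c τ : ℝ} (hM : ‖M.trace‖ ≤ c)
    (hM2 : frobSq M ≤ c ^ 2) (hτ : 0 < τ) (hτ1 : τ < 1) (hN : ‖N.trace‖ ≤ τ)
    (hN2 : frobSq N ≤ τ ^ 2) :
    ‖(1 + M + N).det - (1 + M).det‖ ≤ 2 * Real.exp (c + c ^ 2 + 2) * τ := by
  -- Schwarz lemma for ζ ↦ det(1 + M + ζN) on the disc of radius 1/τ, where ζN still has trace and
  -- Frobenius norm at most 1; the value needed is the one at ζ = 1.
  set g : ℂ → ℂ := fun ζ => (1 + M + ζ • N).det with hg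
  have hb : ∀ ζ ∈ Metric.ball (0 : ℂ) τ⁻¹, ‖g ζ‖ ≤ Real.exp (c + c ^ 2 + 2) := fun ζ hζ => by
    rw [mem_ball_zero_iff] at hζ
    have hζτ : ‖ζ‖ * τ ≤ 1 := by
      rw [← inv_mul_cancel₀ hτ.ne']; gcongr
    have hz := norm_nonneg ζ
    simp only [hg]
    rw [add_assoc]
    refine (norm_det_one_add_le _).trans (Real.exp_le_exp.2 ?_)
    have h1 : ‖(M + ζ • N).trace‖ ≤ c + 1 := by
      rw [Matrix.trace_add, Matrix.trace_smul]
      refine (norm_add_le _ _).trans (add_le_add hM ?_)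
      rw [norm_smul]
      exact (mul_le_mul_of_nonneg_left hN hz).trans hζτ
    have h2 : frobSq (M + ζ • N) ≤ 2 * c ^ 2 + 2 := by
      refine (frobSq_add_le _ _).trans ?_
      rw [frobSq_smul]
      have : ‖ζ‖ ^ 2 * frobSq N ≤ 1 := calc
        ‖ζ‖ ^ 2 * frobSq N ≤ ‖ζ‖ ^ 2 * τ ^ 2 := by gcongr
        _ = (‖ζ‖ * τ) ^ 2 := by ring
        _ ≤ 1 := pow_le_one₀ (by positivity) hζτ
      linarith
    linarith
  have hd : DifferentiableOn ℂ g (Metric.ball 0 τ⁻¹) :=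
    (differentiable_det_add_smul (1 + M) N).differentiableOn
  have hmaps : MapsTo g (Metric.ball 0 τ⁻¹)
      (Metric.closedBall (g 0) (2 * Real.exp (c + c ^ 2 + 2))) := fun ζ hζ => by
    rw [mem_closedBall_iff_norm]
    refine (norm_sub_le _ _).trans ?_
    linarith [hb ζ hζ, hb 0 (by simpa using hτ)]
  have h1 : (1 : ℂ) ∈ Metric.ball (0 : ℂ) τ⁻¹ := by
    rw [mem_ball_zero_iff, norm_one]; exact (one_lt_inv₀ hτ).2 hτ1
  have := Complex.dist_le_div_mul_dist_of_mapsTo_ball hd hmaps h1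
  simpa [hg, dist_eq_norm, div_eq_mul_inv] using this

/-- Second order bound for the determinant near the identity. -/
lemma norm_det_one_add_sub_le {M : Matrix n n ℂ} {τ : ℝ} (hτ : 0 < τ) (hτ1 : τ < 1)
    (hM : ‖M.trace‖ ≤ τ) (hM2 : frobSq M ≤ τ ^ 2) :
    ‖(1 + M).det - 1 - M.trace‖ ≤ (Real.exp 2 + 2) * τ ^ 2 := by
  -- With the linear term removed, h - h(0) vanishes to second order at 0, and the higher order
  -- Schwarz lemma on the disc of radius 1/τ produces the factor τ².
  set h : ℂ → ℂ := fun ζ => (1 + ζ • M).det - M.trace * ζ with hh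
  have h0 : h 0 = 1 := by simp [hh]
  have hd : DifferentiableOn ℂ h (Metric.ball 0 τ⁻¹) :=
    ((differentiable_det_add_smul 1 M).sub (by fun_prop)).differentiableOn
  have hmaps : MapsTo h (Metric.ball 0 τ⁻¹) (Metric.closedBall (h 0) (Real.exp 2 + 2)) := by
    intro ζ hζ
    rw [mem_ball_zero_iff] at hζ
    have hζτ : ‖ζ‖ * τ ≤ 1 := by
      rw [← inv_mul_cancel₀ hτ.ne']; gcongr
    have hz := norm_nonneg ζ
    have h1 : ‖(ζ • M).trace‖ ≤ 1 := by
      rw [Matrix.trace_smul, norm_smul]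
      exact (mul_le_mul_of_nonneg_left hM hz).trans hζτ
    have h2 : frobSq (ζ • M) ≤ 1 := by
      rw [frobSq_smul]
      calc ‖ζ‖ ^ 2 * frobSq M ≤ ‖ζ‖ ^ 2 * τ ^ 2 := by gcongr
        _ = (‖ζ‖ * τ) ^ 2 := by ring
        _ ≤ 1 := pow_le_one₀ (by positivity) hζτ
    have h3 : ‖(1 + ζ • M).det‖ ≤ Real.exp 2 :=
      (norm_det_one_add_le _).trans (Real.exp_le_exp.2 (by linarith))
    rw [Matrix.trace_smul, smul_eq_mul, mul_comm] at h1
    rw [mem_closedBall_iff_norm, h0]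
    calc ‖(1 + ζ • M).det - M.trace * ζ - 1‖
        ≤ ‖(1 + ζ • M).det - M.trace * ζ‖ + ‖(1 : ℂ)‖ := norm_sub_le _ _
      _ ≤ (‖(1 + ζ • M).det‖ + ‖M.trace * ζ‖) + 1 := by
          rw [norm_one]; gcongr; exact norm_sub_le _ _
      _ ≤ _ := by linarith
  have ho : (fun ζ => h ζ - h 0) =o[𝓝 0] fun ζ => ‖ζ - 0‖ ^ 1 := by
    have : ∀ ζ, h ζ - h 0 =
        (((1 + (Polynomial.X : Polynomial ℂ) • M.map Polynomial.C).det.divX.divX).eval ζ * ζ) *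
          ζ := fun ζ => by
      rw [h0, hh]
      simp only
      rw [Matrix.det_one_add_smul]
      ring
    simp only [this, sub_zero, pow_one]
    refine Asymptotics.IsLittleO.norm_right ?_
    have ht : Tendsto (fun ζ : ℂ =>
        ((1 + (Polynomial.X : Polynomial ℂ) • M.map Polynomial.C).det.divX.divX).eval ζ * ζ)
        (𝓝 0) (𝓝 0) := by
      have : Continuous (fun ζ : ℂ =>
        ((1 + (Polynomial.X : Polynomial ℂ) • M.map Polynomial.C).det.divX.divX).eval ζ * ζ) := by
        fun_prop
      simpa using this.tendsto 0
    simpa using ((Asymptotics.isLittleO_one_iff ℂ).2 ht).mul_isBigO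
      (Asymptotics.isBigO_refl (fun ζ : ℂ => ζ) (𝓝 0))
  have h1 : (1 : ℂ) ∈ Metric.ball (0 : ℂ) τ⁻¹ := by
    rw [mem_ball_zero_iff, norm_one]; exact (one_lt_inv₀ hτ).2 hτ1
  have := Complex.dist_le_mul_div_pow_of_mapsTo_ball_of_isLittleO (n := 1) hd hmaps ho h1
  rw [h0, dist_eq_norm] at this
  simpa [hh, sub_right_comm] using this

end MatrixDet

/-! ### The Fredholm determinant -/

/-- The matrix of `A` on the span of finitely many basis vectors. -/
def finSection (A : E →L[ℂ] E) (s : Finset (BasisIndex E)) : Matrix s s ℂ :=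
  Matrix.of fun i j : s => ⟪basis E i, A (basis E j)⟫_ℂ

open Classical in
/-- The determinant of a finite section of `1 + A`. -/
def detSection (A : E →L[ℂ] E) (s : Finset (BasisIndex E)) : ℂ := (1 + finSection A s).det

lemma sum_norm_inner_sq_le (s : Finset (BasisIndex E)) (x : E) :
    ∑ i ∈ s, ‖⟪basis E i, x⟫_ℂ‖ ^ 2 ≤ ‖x‖ ^ 2 :=
  (basis E).orthonormal.sum_inner_products_le x

lemma frobSq_finSection_le {A : E →L[ℂ] E} (hA : IsHS A) (s : Finset (BasisIndex E)) :
    frobSq (finSection A s) ≤ hsNorm A ^ 2 := by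
  rw [frobSq, Finset.sum_comm]
  calc ∑ j : s, ∑ i : s, ‖finSection A s i j‖ ^ 2
      = ∑ j ∈ s, ∑ i ∈ s, ‖⟪basis E i, A (basis E j)⟫_ℂ‖ ^ 2 := by
        rw [← Finset.sum_coe_sort s fun j => ∑ i ∈ s, ‖⟪basis E i, A (basis E j)⟫_ℂ‖ ^ 2]
        refine Finset.sum_congr rfl fun j _ => ?_
        exact Finset.sum_coe_sort s fun i => ‖⟪basis E i, A (basis E j)⟫_ℂ‖ ^ 2
    _ ≤ ∑ j ∈ s, ‖A (basis E j)‖ ^ 2 := Finset.sum_le_sum fun j _ => sum_norm_inner_sq_le s _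
    _ ≤ hsNorm A ^ 2 := sum_le_hasSum s (fun i _ => by positivity) hA.hasSum_norm_sq

lemma trace_finSection (A : E →L[ℂ] E) (s : Finset (BasisIndex E)) :
    (finSection A s).trace = ∑ i ∈ s, ⟪basis E i, A (basis E i)⟫_ℂ :=
  Finset.sum_coe_sort s fun i => ⟪basis E i, A (basis E i)⟫_ℂ

lemma IsTraceClass.norm_trace_finSection_le {A : E →L[ℂ] E} (hA : IsTraceClass A)
    (s : Finset (BasisIndex E)) : ‖(finSection A s).trace‖ ≤ trNorm A := by
  rw [trace_finSection]
  exact (norm_sum_le _ _).trans (hA.sum_norm_diag_le s)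

lemma IsTraceClass.frobSq_finSection_le {A : E →L[ℂ] E} (hA : IsTraceClass A)
    (s : Finset (BasisIndex E)) : frobSq (finSection A s) ≤ trNorm A ^ 2 :=
  (EnergyDifference.frobSq_finSection_le hA.isHS s).trans
    (pow_le_pow_left₀ (hsNorm_nonneg _) hA.hsNorm_le 2)

open Classical in
/-- The section of `A` over `s`, embedded into the matrices over a larger index set. -/
def paddedSection (A : E →L[ℂ] E) (s t : Finset (BasisIndex E)) : Matrix t t ℂ :=
  Matrix.of fun i j : t => if (i : BasisIndex E) ∈ s ∧ (j : BasisIndex E) ∈ s then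
    ⟪basis E i, A (basis E j)⟫_ℂ else 0

-- The padded matrix has an identity block outside `s` and no off-diagonal blocks. Sections over
-- different index sets can thus be compared as matrices of one size.
open Classical in
lemma detSection_eq_det_padded (A : E →L[ℂ] E) {s t : Finset (BasisIndex E)} (hst : s ⊆ t) :
    detSection A s = (1 + paddedSection A s t).det := by
  set p : t → Prop := fun i => (i : BasisIndex E) ∈ s with hp
  rw [Matrix.twoBlockTriangular_det _ p]
  · have h2 : Matrix.toSquareBlockProp (1 + paddedSection A s t) (fun i => ¬ p i) = 1 := by
      ext i j
      have hi : ¬ ((i : t) : BasisIndex E) ∈ s := i.2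
      simp only [Matrix.toSquareBlockProp_def, paddedSection, hi, Matrix.of_apply,
        Matrix.add_apply, false_and, if_false, add_zero, Matrix.one_apply, Subtype.coe_inj]
    rw [h2, Matrix.det_one, mul_one, detSection]
    let e : {i : t // p i} ≃ s :=
      { toFun := fun i => ⟨i.1.1, i.2⟩
        invFun := fun i => ⟨⟨i.1, hst i.2⟩, i.2⟩
        left_inv := fun i => rfl
        right_inv := fun i => rfl }
    rw [← Matrix.det_submatrix_equiv_self e]
    congr 1
    ext i j
    have hi : ((i : t) : BasisIndex E) ∈ s := i.2
    have hj : ((j : t) : BasisIndex E) ∈ s := j.2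
    simp only [Matrix.toSquareBlockProp_def, paddedSection, finSection, hi, hj, Matrix.of_apply,
      Matrix.add_apply, Matrix.submatrix_apply, and_self, if_true, Matrix.one_apply, e.injective.eq_iff,
      Subtype.coe_inj]
    rfl
  · intro i hi j hj
    have hij : i ≠ j := fun h => hi (h ▸ hj)
    have hi' : ¬ ((i : t) : BasisIndex E) ∈ s := hi
    simp [paddedSection, hi', hij]

lemma sum_coe_ite_le {ι : Type*} [DecidableEq ι] (s t : Finset ι) (f : ι → ℝ) :
    ∑ i : t, (if (i : ι) ∈ s then 0 else f i) = ∑ i ∈ t \ s, f i := by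
  rw [Finset.sum_coe_sort t fun i => if i ∈ s then 0 else f i, Finset.sum_ite, Finset.sum_const_zero,
    zero_add]
  congr 1
  ext i; simp

-- For s ⊆ t the two sections, brought to the same size, differ by a matrix N whose nonzero entries
-- have an index outside `s`. Its trace and Frobenius norm are therefore controlled by a tail of the
-- summable family `u`: rows outside `s` are bounded by ‖A* e_i‖², columns by ‖A e_j‖². The
-- Lipschitz bound for determinants does the rest.
open Classical in
lemma IsTraceClass.cauchySeq_detSection {A : E →L[ℂ] E} (hA : IsTraceClass A) :
    CauchySeq (detSection A) := by
  set c := trNorm A with hc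
  have hHS := hA.isHS
  set u : BasisIndex E → ℝ := fun i => ‖⟪basis E i, A (basis E i)⟫_ℂ‖ +
    (‖(star A) (basis E i)‖ ^ 2 + ‖A (basis E i)‖ ^ 2) with hu
  have hus : Summable u := hA.summable_norm_diag.add
    (hHS.adjoint.hasSum_norm_sq.summable.add hHS.hasSum_norm_sq.summable)
  have hu1 : ∀ i, 0 ≤ u i := fun i => by positivity
  refine Metric.cauchySeq_iff'.2 fun ε hε => ?_
  obtain ⟨τ, hτ, hτ1, hτε⟩ : ∃ τ : ℝ, 0 < τ ∧ τ < 1 ∧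
      2 * Real.exp (c + c ^ 2 + 2) * τ < ε := by
    refine ⟨min (1 / 2) (ε / (4 * Real.exp (c + c ^ 2 + 2))), by positivity,
      (min_le_left _ _).trans_lt (by norm_num), ?_⟩
    calc 2 * Real.exp (c + c ^ 2 + 2) * min (1 / 2) (ε / (4 * Real.exp (c + c ^ 2 + 2)))
        ≤ 2 * Real.exp (c + c ^ 2 + 2) * (ε / (4 * Real.exp (c + c ^ 2 + 2))) := by
          gcongr; exact min_le_right _ _
      _ = ε / 2 := by field_simp; norm_num
      _ < ε := by linarith
  obtain ⟨s, hs⟩ := summable_iff_vanishing_norm.1 hus (τ ^ 2) (by positivity)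
  refine ⟨s, fun t hst => ?_⟩
  have hst' : s ⊆ t := hst
  have htail : ∑ i ∈ t \ s, u i ≤ τ ^ 2 := by
    have := hs (t \ s) Finset.sdiff_disjoint
    exact ((Real.le_norm_self _).trans this.le)
  rw [dist_eq_norm, detSection_eq_det_padded A hst']
  refine lt_of_le_of_lt ?_ hτε
  set N : Matrix t t ℂ := finSection A t - paddedSection A s t with hN
  have hdet : detSection A t = (1 + paddedSection A s t + N).det := by
    rw [detSection, hN]; congr 1; abel
  have hentry : ∀ i j : t, ‖N i j‖ ^ 2 ≤
      (if (i : BasisIndex E) ∈ s then 0 else ‖⟪basis E i, A (basis E j)⟫_ℂ‖ ^ 2) +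
      (if (j : BasisIndex E) ∈ s then 0 else ‖⟪basis E i, A (basis E j)⟫_ℂ‖ ^ 2) := fun i j => by
    by_cases hi : (i : BasisIndex E) ∈ s <;> by_cases hj : (j : BasisIndex E) ∈ s <;>
      simp [hN, finSection, paddedSection, hi, hj]
  rw [hdet]
  refine norm_det_sub_det_le ?_ ?_ hτ hτ1 ?_ ?_
  · have : (paddedSection A s t).trace = ∑ i ∈ s, ⟪basis E i, A (basis E i)⟫_ℂ := by
      simp only [Matrix.trace, Matrix.diag_apply, paddedSection, Matrix.of_apply, and_self]
      rw [Finset.sum_coe_sort t fun i => if i ∈ s then ⟪basis E i, A (basis E i)⟫_ℂ else 0,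
        ← Finset.sum_filter, Finset.filter_mem_eq_inter, Finset.inter_eq_right.2 hst']
    rw [this]
    exact (norm_sum_le _ _).trans (hA.sum_norm_diag_le s)
  · refine le_trans ?_ (hA.frobSq_finSection_le t)
    refine Finset.sum_le_sum fun i _ => Finset.sum_le_sum fun j _ => ?_
    simp only [paddedSection, finSection, Matrix.of_apply]
    split_ifs <;> simp
  · have : ‖N.trace‖ ≤ ∑ i : t, (if (i : BasisIndex E) ∈ s then 0 else u i) := by
      refine (norm_sum_le _ _).trans (Finset.sum_le_sum fun i _ => ?_)
      by_cases hi : (i : BasisIndex E) ∈ s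
      · simp [hN, finSection, paddedSection, hi]
      · simp only [hN, finSection, paddedSection, hi, Matrix.diag_apply, Matrix.sub_apply,
          Matrix.of_apply, if_false, false_and, sub_zero, hu]
        linarith [sq_nonneg ‖(star A) (basis E i)‖, sq_nonneg ‖A (basis E i)‖]
    rw [sum_coe_ite_le] at this
    nlinarith
  · calc frobSq N ≤ ∑ i : t, (if (i : BasisIndex E) ∈ s then 0 else ‖(star A) (basis E i)‖ ^ 2) +
          ∑ j : t, (if (j : BasisIndex E) ∈ s then 0 else ‖A (basis E j)‖ ^ 2) := by
          refine (Finset.sum_le_sum fun i _ => Finset.sum_le_sum fun j _ => hentry i j).trans ?_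
          simp only [Finset.sum_add_distrib]
          refine add_le_add (Finset.sum_le_sum fun i _ => ?_) ?_
          · split_ifs
            · simp
            · have h1 : ∀ j : t, ‖⟪basis E i, A (basis E j)⟫_ℂ‖ ^ 2 =
                  ‖⟪basis E j, (star A) (basis E i)⟫_ℂ‖ ^ 2 := fun j => by
                rw [inner_star_right, norm_inner_symm]
              simp only [h1]
              rw [Finset.sum_coe_sort t fun j => ‖⟪basis E j, (star A) (basis E i)⟫_ℂ‖ ^ 2]
              exact sum_norm_inner_sq_le t _
          · rw [Finset.sum_comm]
            refine Finset.sum_le_sum fun j _ => ?_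
            split_ifs
            · simp
            · rw [Finset.sum_coe_sort t fun i => ‖⟪basis E i, A (basis E j)⟫_ℂ‖ ^ 2]
              exact sum_norm_inner_sq_le t _
      _ ≤ ∑ i ∈ t \ s, u i := by
          rw [sum_coe_ite_le s t fun i => ‖(star A) (basis E i)‖ ^ 2,
            sum_coe_ite_le s t fun i => ‖A (basis E i)‖ ^ 2, ← Finset.sum_add_distrib]
          refine Finset.sum_le_sum fun i _ => ?_
          simp only [hu]
          linarith [norm_nonneg ⟪basis E i, A (basis E i)⟫_ℂ]
      _ ≤ τ ^ 2 := htail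

lemma IsTraceClass.tendsto_detSection {A : E →L[ℂ] E} (hA : IsTraceClass A) :
    Tendsto (detSection A) atTop (𝓝 (fredholmDet A)) :=
  CauchySeq.tendsto_limUnder hA.cauchySeq_detSection

open Classical in
lemma IsTraceClass.norm_fredholmDet_sub_le {A : E →L[ℂ] E} (hA : IsTraceClass A) {τ : ℝ}
    (hτ : 0 < τ) (hτ1 : τ < 1) (hAτ : trNorm A ≤ τ) :
    ‖fredholmDet A - 1 - trace A‖ ≤ (Real.exp 2 + 2) * τ ^ 2 := by
  have h1 : Tendsto (fun s => ‖detSection A s - 1 - (finSection A s).trace‖) atTop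
      (𝓝 ‖fredholmDet A - 1 - trace A‖) := by
    simp only [trace_finSection]
    exact ((hA.tendsto_detSection.sub_const 1).sub hA.hasSum_trace).norm
  refine le_of_tendsto h1 (Eventually.of_forall fun s => ?_)
  refine norm_det_one_add_sub_le hτ hτ1 ((hA.norm_trace_finSection_le s).trans hAτ) ?_
  exact (hA.frobSq_finSection_le s).trans (pow_le_pow_left₀ (trNorm_nonneg _) hAτ 2)

/-- The orthogonal projection along the span of finitely many basis vectors. -/
def coProj (s : Finset (BasisIndex E)) : E →L[ℂ] E :=
  1 - ∑ k ∈ s, (innerSL ℂ (basis E k)).smulRight (basis E k)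

lemma coProj_apply (s : Finset (BasisIndex E)) (x : E) :
    coProj s x = x - ∑ k ∈ s, ⟪basis E k, x⟫_ℂ • basis E k := by
  simp [coProj, sub_apply, sum_apply]

lemma inner_coProj (s : Finset (BasisIndex E)) (x y : E) :
    ⟪coProj s x, y⟫_ℂ = ⟪x, coProj s y⟫_ℂ := by
  simp only [coProj_apply, inner_sub_left, inner_sub_right, sum_inner, inner_sum, inner_smul_left,
    inner_smul_right, inner_conj_symm]
  congr 1
  exact Finset.sum_congr rfl fun k _ => mul_comm _ _

lemma star_coProj (s : Finset (BasisIndex E)) : star (coProj (E := E) s) = coProj s := by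
  ext x
  refine ext_inner_left ℂ fun y => ?_
  rw [inner_star_right, inner_coProj]

open Classical in
lemma coProj_basis (s : Finset (BasisIndex E)) (k : BasisIndex E) :
    coProj s (basis E k) = if k ∈ s then 0 else basis E k := by
  rw [coProj_apply]
  simp only [orthonormal_iff_ite.1 (basis E).orthonormal, ite_smul, one_smul, zero_smul]
  rw [Finset.sum_ite_eq']
  split_ifs <;> simp

-- After passing to the adjoint, the projection deletes the columns of B* with index in `s`; what
-- remains is the tail of a convergent series.
open Classical in
lemma IsHS.tendsto_hsNorm_coProj_mul {B : E →L[ℂ] E} (hB : IsHS B) :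
    Tendsto (fun s => hsNorm (coProj s * B)) atTop (𝓝 0) := by
  have h1 : ∀ s, hsNorm (coProj s * B) ^ 2 =
      hsNorm (star B) ^ 2 - ∑ k ∈ s, ‖(star B) (basis E k)‖ ^ 2 := fun s => by
    rw [← hsNorm_adjoint (coProj s * B), star_mul, star_coProj]
    refine (hB.adjoint.mul_right (coProj s)).hasSum_norm_sq.unique ?_
    have h2 := hB.adjoint.hasSum_norm_sq.sub (hasSum_sum_of_ne_finset_zero (s := s)
      (f := fun k => if k ∈ s then ‖(star B) (basis E k)‖ ^ 2 else 0) fun k hk => by simp [hk])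
    have h5 : ∑ k ∈ s, (if k ∈ s then ‖(star B) (basis E k)‖ ^ 2 else 0) =
        ∑ k ∈ s, ‖(star B) (basis E k)‖ ^ 2 := Finset.sum_congr rfl fun k hk => by simp [hk]
    rw [h5] at h2
    refine h2.congr_fun fun k => ?_
    rw [op_mul_apply, coProj_basis]
    split_ifs <;> simp
  have h3 : Tendsto (fun s => hsNorm (coProj s * B) ^ 2) atTop (𝓝 0) := by
    simp only [h1]
    have h2 : Tendsto _ _ _ := hB.adjoint.hasSum_norm_sq
    have h3 := h2.const_sub (hsNorm (star B) ^ 2)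
    rwa [sub_self] at h3
  have h4 := h3.sqrt
  simpa [Real.sqrt_sq (hsNorm_nonneg _)] using h4

-- Compressions are not multiplicative. With P the projection onto the span of `s`, the product of
-- the sections of A and B differs from the section of A B by the section of -A (1 - P) B, and this
-- error is small because (1 - P) B tends to 0 in Hilbert–Schmidt norm. The Lipschitz bound carries
-- the smallness over to the determinants.
open Classical in
lemma IsTraceClass.fredholmDet_mul {A B : E →L[ℂ] E} (hA : IsTraceClass A)
    (hB : IsTraceClass B) :
    fredholmDet (A + B + A * B) = fredholmDet A * fredholmDet B := by
  set C := A + B + A * B with hC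
  have hCt : IsTraceClass C := (hA.add hB).add (hA.mul_right B)
  have hlim := hCt.tendsto_detSection.sub (hA.tendsto_detSection.mul hB.tendsto_detSection)
  rw [← sub_eq_zero]
  refine tendsto_nhds_unique hlim ?_
  set c := trNorm C
  have hq := (hB.isHS.tendsto_hsNorm_coProj_mul).const_mul (hsNorm (star A))
  rw [mul_zero] at hq
  have key : ∀ τ : ℝ, 0 < τ → τ < 1 → ∀ᶠ s in atTop,
      ‖detSection C s - detSection A s * detSection B s‖ ≤
        2 * Real.exp (c + c ^ 2 + 2) * τ := fun τ hτ hτ1 => by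
    filter_upwards [hq.eventually_le_const hτ] with s hs
    set N : Matrix s s ℂ := finSection A s * finSection B s - finSection (A * B) s with hN
    have hprod : detSection A s * detSection B s = (1 + finSection C s + N).det := by
      rw [detSection, detSection, ← Matrix.det_mul]
      congr 1
      have : finSection C s = finSection A s + finSection B s + finSection (A * B) s := by
        ext i j
        simp [finSection, hC]
      rw [this, hN]
      noncomm_ring
    have hentry : ∀ i j : s, ‖N i j‖ ≤ ‖(star A) (basis E i)‖ * ‖(coProj s * B) (basis E j)‖ :=
      fun i j => by
        have : N i j = -⟪(star A) (basis E i), (coProj s * B) (basis E j)⟫_ℂ := by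
          simp only [hN, Matrix.sub_apply, Matrix.mul_apply, finSection, Matrix.of_apply,
            op_mul_apply, coProj_apply, inner_star_left, inner_sub_right,
            inner_sum, inner_smul_right]
          rw [Finset.sum_coe_sort s fun k => ⟪basis E i, A (basis E k)⟫_ℂ *
            ⟪basis E k, B (basis E j)⟫_ℂ, neg_sub]
          congr 1
          exact Finset.sum_congr rfl fun k _ => mul_comm _ _
        rw [this, norm_neg]
        exact norm_inner_le_norm _ _
    have hAs := hA.isHS.adjoint
    have hQ : IsHS (coProj s * B) := hB.isHS.mul_left _
    rw [norm_sub_rev, hprod]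
    refine norm_det_sub_det_le (hCt.norm_trace_finSection_le s) (hCt.frobSq_finSection_le s)
      hτ hτ1 ?_ ?_
    · refine (norm_sum_le _ _).trans ((Finset.sum_le_sum fun i _ => hentry i i).trans ?_)
      rw [Finset.sum_coe_sort s fun i => ‖(star A) (basis E i)‖ * ‖(coProj s * B) (basis E i)‖]
      exact (hAs.sum_mul_le hQ s).trans hs
    · calc frobSq N ≤ ∑ i : s, ∑ j : s,
            ‖(star A) (basis E i)‖ ^ 2 * ‖(coProj s * B) (basis E j)‖ ^ 2 := by
            refine Finset.sum_le_sum fun i _ => Finset.sum_le_sum fun j _ => ?_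
            rw [← mul_pow]
            exact pow_le_pow_left₀ (norm_nonneg _) (hentry i j) 2
        _ = (∑ i ∈ s, ‖(star A) (basis E i)‖ ^ 2) *
            ∑ j ∈ s, ‖(coProj s * B) (basis E j)‖ ^ 2 := by
            rw [← Finset.sum_mul_sum, Finset.sum_coe_sort s fun i => ‖(star A) (basis E i)‖ ^ 2,
              Finset.sum_coe_sort s fun i => ‖(coProj s * B) (basis E i)‖ ^ 2]
        _ ≤ hsNorm (star A) ^ 2 * hsNorm (coProj s * B) ^ 2 :=
            mul_le_mul (sum_le_hasSum s (fun _ _ => by positivity) hAs.hasSum_norm_sq)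
              (sum_le_hasSum s (fun _ _ => by positivity) hQ.hasSum_norm_sq)
              (Finset.sum_nonneg fun _ _ => by positivity) (by positivity)
        _ ≤ τ ^ 2 := by
            rw [← mul_pow]
            exact pow_le_pow_left₀ (mul_nonneg (hsNorm_nonneg _) (hsNorm_nonneg _)) hs 2
  have hK : 0 < 2 * Real.exp (c + c ^ 2 + 2) := by positivity
  rw [tendsto_zero_iff_norm_tendsto_zero]
  refine tendsto_order.2 ⟨fun a ha => Eventually.of_forall fun s => ha.trans_le (norm_nonneg _),
    fun ε hε => ?_⟩
  have hτ1 : min (1 / 2) (ε / 2 / (2 * Real.exp (c + c ^ 2 + 2))) < 1 :=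
    (min_le_left _ _).trans_lt (by norm_num)
  filter_upwards [key _ (by positivity) hτ1] with s hs
  refine hs.trans_lt ?_
  calc _ ≤ 2 * Real.exp (c + c ^ 2 + 2) * (ε / 2 / (2 * Real.exp (c + c ^ 2 + 2))) := by
        gcongr; exact min_le_right _ _
    _ = ε / 2 := by field_simp
    _ < ε := by linarith

lemma inner_self_eq_ofReal (x : E) : ⟪x, x⟫_ℂ = ((‖x‖ ^ 2 : ℝ) : ℂ) := by
  rw [inner_self_eq_norm_sq_to_K]; norm_cast

/-! ### Resolvents of self-adjoint operators -/

section Resolvent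

variable {H : E →ₗ.[ℂ] E}

lemma IsResolventAt.eq {z : ℂ} {R R' : E →L[ℂ] E} (h : IsResolventAt H z R)
    (h' : IsResolventAt H z R') : R = R' := by
  ext x
  obtain ⟨hx, hx2⟩ := h'.1 x
  have := h.2 ⟨R' x, hx⟩
  simp only [hx2] at this
  exact this

lemma IsResolventAt.opResolvent_eq {z : ℂ} {R : E →L[ℂ] E} (h : IsResolventAt H z R) :
    opResolvent H z = R := by
  have h' : ∃ R, IsResolventAt H z R := ⟨R, h⟩
  rw [opResolvent, dif_pos h']
  exact h'.choose_spec.eq h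

lemma isResolventAt_opResolvent {z : ℂ} (hz : z ∉ opSpectrum H) :
    IsResolventAt H z (opResolvent H z) := by
  rw [opSpectrum, mem_ofPred_eq, not_not] at hz
  obtain ⟨R, hR⟩ := hz
  rwa [hR.opResolvent_eq]

lemma IsResolventAt.notMem {z : ℂ} {R : E →L[ℂ] E} (h : IsResolventAt H z R) :
    z ∉ opSpectrum H := fun hn => hn ⟨R, h⟩

/-- The first resolvent identity. -/
lemma opResolvent_sub {z w : ℂ} (hz : z ∉ opSpectrum H) (hw : w ∉ opSpectrum H) :
    opResolvent H z - opResolvent H w = (w - z) • (opResolvent H z * opResolvent H w) := by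
  ext x
  obtain ⟨hx, hx2⟩ := (isResolventAt_opResolvent hw).1 x
  have h := (isResolventAt_opResolvent hz).2 ⟨opResolvent H w x, hx⟩
  have h2 : z • opResolvent H w x - H ⟨opResolvent H w x, hx⟩ =
      (z - w) • opResolvent H w x + x := by
    linear_combination (norm := module) hx2
  simp only [h2, map_add, map_smul] at h
  simp only [sub_apply, smul_apply, op_mul_apply]
  linear_combination (norm := module) h

lemma opResolvent_commute {z w : ℂ} (hz : z ∉ opSpectrum H) (hw : w ∉ opSpectrum H) :
    opResolvent H z * opResolvent H w = opResolvent H w * opResolvent H z := by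
  rcases eq_or_ne z w with rfl | hne
  · rfl
  have h1 := opResolvent_sub hz hw
  have h2 := opResolvent_sub hw hz
  rw [← neg_sub, h2, ← neg_smul, neg_sub] at h1
  exact (smul_right_injective _ (sub_ne_zero.2 hne.symm) h1).symm

/-- Neumann series: w - H = (1 + (w - z) R(z)) (z - H) on the domain, and the first factor is
invertible. -/
lemma notMem_opSpectrum_of_norm_lt {z w : ℂ} (hz : z ∉ opSpectrum H)
    (hw : ‖w - z‖ * ‖opResolvent H z‖ < 1) : w ∉ opSpectrum H := by
  set R := opResolvent H z with hR
  have hRz := isResolventAt_opResolvent hz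
  have hn : ‖-((w - z) • R)‖ < 1 := by rwa [norm_neg, norm_smul]
  set U := Units.oneSub _ hn with hU
  have hUv : (U : E →L[ℂ] E) = 1 + (w - z) • R := by simp [hU]
  have hcomm : Commute R (↑U⁻¹ : E →L[ℂ] E) := by
    refine Commute.units_inv_right ?_
    rw [hUv]
    exact (Commute.one_right R).add_right ((Commute.refl R).smul_right _)
  refine IsResolventAt.notMem (R := R * ↑U⁻¹) ⟨fun x => ?_, fun y => ?_⟩
  · obtain ⟨h1, h2⟩ := hRz.1 ((↑U⁻¹ : E →L[ℂ] E) x)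
    refine ⟨h1, ?_⟩
    have h3 : (1 + (w - z) • R) ((↑U⁻¹ : E →L[ℂ] E) x) = x := by
      rw [← hUv, ← op_mul_apply, Units.mul_inv]; rfl
    conv_rhs => rw [← h3]
    change w • R ((↑U⁻¹ : E →L[ℂ] E) x) - H ⟨R ((↑U⁻¹ : E →L[ℂ] E) x), h1⟩ =
      (↑U⁻¹ : E →L[ℂ] E) x + (w - z) • R ((↑U⁻¹ : E →L[ℂ] E) x)
    linear_combination (norm := module) h2
  · rw [hcomm.eq, op_mul_apply]
    have h1 : R (w • (y : E) - H y) = (1 + (w - z) • R) y := by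
      have h2 := hRz.2 y
      rw [show w • (y : E) - H y = (z • (y : E) - H y) + (w - z) • (y : E) by module, map_add,
        h2, map_smul]
      simp
    rw [h1, ← hUv, ← op_mul_apply, Units.inv_mul]
    rfl

lemma isOpen_compl_opSpectrum : IsOpen (opSpectrum H)ᶜ := by
  rw [Metric.isOpen_iff]
  intro z hz
  refine ⟨(‖opResolvent H z‖ + 1)⁻¹, by positivity, fun w hw => ?_⟩
  refine notMem_opSpectrum_of_norm_lt hz ?_
  rw [mem_ball_iff_norm] at hw
  calc ‖w - z‖ * ‖opResolvent H z‖ ≤ (‖opResolvent H z‖ + 1)⁻¹ * ‖opResolvent H z‖ := by gcongr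
    _ < 1 := by
      rw [inv_mul_lt_iff₀ (by positivity)]; linarith

lemma norm_opResolvent_sub_le {z w : ℂ} (hz : z ∉ opSpectrum H) (hw : w ∉ opSpectrum H)
    (h : ‖w - z‖ * ‖opResolvent H z‖ ≤ 1 / 2) :
    ‖opResolvent H w - opResolvent H z‖ ≤ 2 * ‖opResolvent H z‖ ^ 2 * ‖w - z‖ := by
  have h1 := opResolvent_sub hw hz
  have h2 : ‖opResolvent H w - opResolvent H z‖ ≤
      ‖w - z‖ * (‖opResolvent H w‖ * ‖opResolvent H z‖) := by
    rw [h1, norm_smul, norm_sub_rev]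
    gcongr
    exact norm_mul_le _ _
  have h3 : ‖opResolvent H w‖ ≤ ‖opResolvent H w - opResolvent H z‖ + ‖opResolvent H z‖ := by
    simpa using norm_add_le (opResolvent H w - opResolvent H z) (opResolvent H z)
  have h4 : ‖opResolvent H w‖ ≤ 2 * ‖opResolvent H z‖ := by
    nlinarith [norm_nonneg (opResolvent H w)]
  refine h2.trans ?_
  calc ‖w - z‖ * (‖opResolvent H w‖ * ‖opResolvent H z‖)
      ≤ ‖w - z‖ * (2 * ‖opResolvent H z‖ * ‖opResolvent H z‖) := by gcongr
    _ = _ := by ring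

lemma continuousAt_opResolvent {z : ℂ} (hz : z ∉ opSpectrum H) :
    ContinuousAt (opResolvent H) z := by
  have h1 : Tendsto (fun w : ℂ => ‖w - z‖) (𝓝 z) (𝓝 0) := by
    have : Continuous fun w : ℂ => ‖w - z‖ := by fun_prop
    simpa using this.tendsto z
  have h2 : Tendsto (fun w : ℂ => ‖w - z‖ * ‖opResolvent H z‖) (𝓝 z) (𝓝 0) := by
    simpa using h1.mul_const ‖opResolvent H z‖
  have h3 : Tendsto (fun w : ℂ => 2 * ‖opResolvent H z‖ ^ 2 * ‖w - z‖) (𝓝 z) (𝓝 0) := by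
    simpa using h1.const_mul (2 * ‖opResolvent H z‖ ^ 2)
  refine tendsto_iff_norm_sub_tendsto_zero.2 (squeeze_zero' (Eventually.of_forall fun _ =>
    norm_nonneg _) ?_ h3)
  filter_upwards [h2.eventually_le_const (show (0 : ℝ) < 1 / 2 by norm_num),
    isOpen_compl_opSpectrum.mem_nhds hz] with w hw hw2
  exact norm_opResolvent_sub_le hz hw2 hw

lemma hasDerivAt_opResolvent {z : ℂ} (hz : z ∉ opSpectrum H) :
    HasDerivAt (opResolvent H) (-(opResolvent H z * opResolvent H z)) z := by
  rw [hasDerivAt_iff_tendsto_slope]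
  have h1 : Tendsto (fun w => -(opResolvent H w * opResolvent H z)) (𝓝[≠] z)
      (𝓝 (-(opResolvent H z * opResolvent H z))) :=
    (((continuousAt_opResolvent hz).mono_left nhdsWithin_le_nhds).mul_const _).neg
  refine h1.congr' ?_
  filter_upwards [nhdsWithin_le_nhds (isOpen_compl_opSpectrum.mem_nhds hz),
    self_mem_nhdsWithin] with w hw hne
  rw [slope_def_module, opResolvent_sub hw hz, smul_smul]
  have hne' : w - z ≠ 0 := sub_ne_zero.2 hne
  rw [show (w - z)⁻¹ * (z - w) = -1 by field_simp; ring, neg_one_smul]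

/-! ### Consequences of self-adjointness. -/

section SelfAdjoint

variable (hH : IsSelfAdjoint H)

include hH in
lemma inner_symm_of_isSelfAdjoint (x y : H.domain) : ⟪H x, (y : E)⟫_ℂ = ⟪(x : E), H y⟫_ℂ := by
  have h := LinearPMap.adjoint_isFormalAdjoint hH.dense_domain
  rw [LinearPMap.isSelfAdjoint_def.1 hH] at h
  exact h x y

include hH in
lemma mem_domain_of_inner_eq {y w : E} (h : ∀ x : H.domain, ⟪w, (x : E)⟫_ℂ = ⟪y, H x⟫_ℂ) :
    ∃ hy : y ∈ H.domain, H ⟨y, hy⟩ = w := by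
  have hsa := LinearPMap.isSelfAdjoint_def.1 hH
  have hy := LinearPMap.mem_adjoint_domain_of_exists (T := H) y ⟨w, h⟩
  have hv := LinearPMap.adjoint_apply_eq hH.dense_domain ⟨y, hy⟩ h
  have key : ∀ (A B : E →ₗ.[ℂ] E), A = B → ∀ hy : y ∈ A.domain, A ⟨y, hy⟩ = w →
      ∃ hy : y ∈ B.domain, B ⟨y, hy⟩ = w := by
    rintro A _ rfl hy h; exact ⟨hy, h⟩
  exact key _ _ hsa hy hv

include hH in
/-- A point where `z - H` and `conj z - H` are bounded below belongs to the resolvent set. -/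
lemma notMem_opSpectrum_of_bounded_below {z : ℂ} {c : ℝ} (hc : 0 < c)
    (h : ∀ x : H.domain, c * ‖(x : E)‖ ≤ ‖z • (x : E) - H x‖)
    (h' : ∀ x : H.domain, c * ‖(x : E)‖ ≤ ‖(starRingEnd ℂ z) • (x : E) - H x‖) :
    z ∉ opSpectrum H := by
  set T : H.domain →ₗ[ℂ] E := z • H.domain.subtype - H.toFun with hT
  have hTa : ∀ x : H.domain, T x = z • (x : E) - H x := fun x => rfl
  have hinj : Function.Injective T := by
    rw [← LinearMap.ker_eq_bot, LinearMap.ker_eq_bot']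
    intro x hx
    have := h x
    rw [← hTa, hx, norm_zero] at this
    have h0 : ‖(x : E)‖ = 0 := le_antisymm (by nlinarith) (norm_nonneg _)
    exact Subtype.ext (norm_eq_zero.1 h0)
  -- The lower bound turns Cauchy sequences in the range into Cauchy sequences of preimages; the
  -- graph of H is closed, since H is self-adjoint.
  have hclosed : IsClosed (LinearMap.range T : Set E) := by
    refine IsSeqClosed.isClosed fun u y hu huy => ?_
    choose x hx using hu
    have hcs : CauchySeq fun n => (x n : E) := by
      have hcu := huy.cauchySeq
      rw [Metric.cauchySeq_iff] at hcu ⊢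
      intro ε hε
      obtain ⟨N, hN⟩ := hcu (c * ε) (by positivity)
      refine ⟨N, fun m hm n hn => ?_⟩
      have h1 := hN m hm n hn
      rw [dist_eq_norm, ← hx, ← hx, ← map_sub, hTa] at h1
      have h2 := (h (x m - x n)).trans_lt h1
      rw [dist_eq_norm]
      exact lt_of_mul_lt_mul_left h2 hc.le
    obtain ⟨x0, hx0⟩ := cauchySeq_tendsto_of_complete hcs
    have hHx : Tendsto (fun n => H (x n)) atTop (𝓝 (z • x0 - y)) := by
      have : ∀ n, H (x n) = z • (x n : E) - u n := fun n => by rw [← hx, hTa]; abel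
      simp only [this]
      exact (hx0.const_smul z).sub huy
    have hg : (x0, z • x0 - y) ∈ H.graph := by
      refine (IsSelfAdjoint.isClosed hH).mem_of_tendsto (hx0.prodMk_nhds hHx)
        (Eventually.of_forall fun n => ?_)
      exact H.mem_graph (x n)
    obtain ⟨v, hv1, hv2⟩ := (LinearPMap.mem_graph_iff H).1 hg
    refine ⟨v, ?_⟩
    rw [hTa, hv2, hv1]
    simp
  -- A vector y orthogonal to the range lies in the domain of H* = H and satisfies H y = conj(z) y;
  -- the lower bound at conj(z) forces y = 0.
  have hrange : LinearMap.range T = ⊤ := by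
    have : CompleteSpace (LinearMap.range T) := hclosed.completeSpace_coe
    rw [← Submodule.orthogonal_eq_bot_iff, Submodule.eq_bot_iff]
    intro y hy
    have h1 : ∀ x : H.domain, ⟪(starRingEnd ℂ z) • y, (x : E)⟫_ℂ = ⟪y, H x⟫_ℂ := fun x => by
      have := Submodule.inner_left_of_mem_orthogonal (LinearMap.mem_range_self T x) hy
      rw [hTa, inner_sub_right, inner_smul_right, sub_eq_zero] at this
      rw [inner_smul_left, Complex.conj_conj, this]
    obtain ⟨hyd, hy2⟩ := mem_domain_of_inner_eq hH h1
    have := h' ⟨y, hyd⟩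
    rw [hy2, sub_self, norm_zero] at this
    have h0 : ‖y‖ = 0 := le_antisymm (by simpa using (by nlinarith : ‖y‖ ≤ 0)) (norm_nonneg _)
    exact norm_eq_zero.1 h0
  set e := LinearEquiv.ofBijective T ⟨hinj, LinearMap.range_eq_top.1 hrange⟩ with he
  have hbd : ∀ x, ‖(H.domain.subtype ∘ₗ e.symm.toLinearMap) x‖ ≤ c⁻¹ * ‖x‖ := fun x => by
    have := h (e.symm x)
    rw [← hTa] at this
    have h2 : T (e.symm x) = x := e.apply_symm_apply x
    rw [h2] at this
    rw [le_inv_mul_iff₀ hc]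
    exact this
  refine IsResolventAt.notMem
    (R := (H.domain.subtype ∘ₗ e.symm.toLinearMap).mkContinuous c⁻¹ hbd) ⟨fun x => ?_, fun y => ?_⟩
  · exact ⟨(e.symm x).2, e.apply_symm_apply x⟩
  · have : e.symm (T y) = y := e.symm_apply_apply y
    change ((e.symm (T y) : H.domain) : E) = y
    rw [this]

include hH in
lemma inner_self_im_eq_zero (x : H.domain) : (⟪(x : E), H x⟫_ℂ).im = 0 := by
  have h := inner_symm_of_isSelfAdjoint hH x x
  rw [← inner_conj_symm] at h
  exact Complex.conj_eq_iff_im.1 h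

include hH in
lemma abs_im_mul_norm_le (z : ℂ) (x : H.domain) :
    |z.im| * ‖(x : E)‖ ≤ ‖z • (x : E) - H x‖ := by
  have h1 : (⟪(x : E), z • (x : E) - H x⟫_ℂ).im = z.im * ‖(x : E)‖ ^ 2 := by
    rw [inner_sub_right, inner_smul_right, Complex.sub_im, inner_self_im_eq_zero hH,
      inner_self_eq_ofReal, Complex.mul_im, Complex.ofReal_im, Complex.ofReal_re]
    ring
  have h2 : |z.im| * ‖(x : E)‖ ^ 2 ≤ ‖(x : E)‖ * ‖z • (x : E) - H x‖ := by
    rw [← abs_of_nonneg (sq_nonneg ‖(x : E)‖), ← abs_mul, ← h1]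
    exact (Complex.abs_im_le_norm _).trans (norm_inner_le_norm _ _)
  rcases (norm_nonneg (x : E)).eq_or_lt with h0 | h0
  · rw [← h0]; simp
  · nlinarith

include hH in
lemma notMem_opSpectrum_of_im_ne_zero {z : ℂ} (hz : z.im ≠ 0) : z ∉ opSpectrum H := by
  refine notMem_opSpectrum_of_bounded_below hH (abs_pos.2 hz) (abs_im_mul_norm_le hH z) ?_
  intro x
  have := abs_im_mul_norm_le hH (starRingEnd ℂ z) x
  rwa [Complex.conj_im, abs_neg] at this

include hH in
lemma notMem_opSpectrum_of_lt {m t : ℝ}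
    (hm : ∀ x : H.domain, m * ‖(x : E)‖ ^ 2 ≤ (⟪(x : E), H x⟫_ℂ).re) (ht : t < m) :
    (t : ℂ) ∉ opSpectrum H := by
  have key : ∀ x : H.domain, (m - t) * ‖(x : E)‖ ≤ ‖(t : ℂ) • (x : E) - H x‖ := fun x => by
    have h1 : (⟪(x : E), H x - (t : ℂ) • (x : E)⟫_ℂ).re =
        (⟪(x : E), H x⟫_ℂ).re - t * ‖(x : E)‖ ^ 2 := by
      rw [inner_sub_right, inner_smul_right, Complex.sub_re, inner_self_eq_ofReal,
        ← Complex.ofReal_mul, Complex.ofReal_re]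
    have h2 : (m - t) * ‖(x : E)‖ ^ 2 ≤ ‖(x : E)‖ * ‖(t : ℂ) • (x : E) - H x‖ := by
      have h3 := (Complex.re_le_norm _).trans (norm_inner_le_norm (𝕜 := ℂ) (x : E)
        (H x - (t : ℂ) • (x : E)))
      rw [h1, norm_sub_rev] at h3
      linarith [hm x]
    rcases (norm_nonneg (x : E)).eq_or_lt with h0 | h0
    · rw [← h0]; simp
    · nlinarith
  exact notMem_opSpectrum_of_bounded_below hH (sub_pos.2 ht) key (by simpa using key)

include hH in
lemma norm_opResolvent_le {z : ℂ} (hz : z.im ≠ 0) : ‖opResolvent H z‖ ≤ |z.im|⁻¹ := by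
  refine ContinuousLinearMap.opNorm_le_bound _ (by positivity) fun x => ?_
  obtain ⟨hx, hx2⟩ := (isResolventAt_opResolvent (notMem_opSpectrum_of_im_ne_zero hH hz)).1 x
  have := abs_im_mul_norm_le hH z ⟨opResolvent H z x, hx⟩
  rw [hx2] at this
  rw [le_inv_mul_iff₀ (abs_pos.2 hz)]
  exact this

include hH in
lemma conj_notMem_opSpectrum {z : ℂ} (hz : z ∉ opSpectrum H) :
    starRingEnd ℂ z ∉ opSpectrum H := by
  rcases eq_or_ne z.im 0 with h | h
  · rwa [Complex.conj_eq_iff_im.2 h]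
  · exact notMem_opSpectrum_of_im_ne_zero hH (by simpa using h)

include hH in
lemma star_opResolvent {z : ℂ} (hz : z ∉ opSpectrum H) :
    star (opResolvent H z) = opResolvent H (starRingEnd ℂ z) := by
  ext y
  refine ext_inner_left ℂ fun x => ?_
  rw [inner_star_right]
  obtain ⟨hx, hx2⟩ := (isResolventAt_opResolvent hz).1 x
  obtain ⟨hy, hy2⟩ := (isResolventAt_opResolvent (conj_notMem_opSpectrum hH hz)).1 y
  set u := opResolvent H z x
  set v := opResolvent H (starRingEnd ℂ z) y
  rw [← hx2, ← hy2, inner_sub_left, inner_sub_right, inner_smul_left, inner_smul_right]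
  have := inner_symm_of_isSelfAdjoint hH ⟨u, hx⟩ ⟨v, hy⟩
  simp only at this
  rw [this]

-- The only issue is the domain of the adjoint. If y belongs to it with image w, then w - V y
-- represents x ↦ ⟨y, H x⟩, so that y lies in dom H* = dom H.
include hH in
lemma isSelfAdjoint_perturbed {V : E →L[ℂ] E} (hV : IsSelfAdjoint V) :
    IsSelfAdjoint (perturbed H V) := by
  have hdom : (perturbed H V).domain = H.domain := rfl
  have happ : ∀ x : (perturbed H V).domain, perturbed H V x = V x + H ⟨x, x.2⟩ := fun x => rfl
  have hdense : Dense ((perturbed H V).domain : Set E) := hH.dense_domain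
  rw [LinearPMap.isSelfAdjoint_def]
  have hle : perturbed H V ≤ (perturbed H V).adjoint := by
    refine LinearPMap.IsFormalAdjoint.le_adjoint hdense fun x y => ?_
    rw [happ, happ, inner_add_left, inner_add_right, IsSelfAdjoint.inner_map hV]
    congr 1
    exact inner_symm_of_isSelfAdjoint hH ⟨x, x.2⟩ ⟨y, y.2⟩
  refine (LinearPMap.eq_of_le_of_domain_eq hle (le_antisymm hle.1 fun y hy => ?_)).symm
  set w := (perturbed H V).adjoint ⟨y, hy⟩ with hw
  have h1 : ∀ x : H.domain, ⟪w - V y, (x : E)⟫_ℂ = ⟪y, H x⟫_ℂ := fun x => by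
    have h2 := LinearPMap.adjoint_isFormalAdjoint hdense ⟨y, hy⟩ x
    rw [inner_sub_left]
    have h3 : ⟪w, (x : E)⟫_ℂ = ⟪y, V x + H x⟫_ℂ := h2
    rw [h3, inner_add_right, IsSelfAdjoint.inner_map hV]
    ring
  exact (mem_domain_of_inner_eq hH h1).1

end SelfAdjoint

end Resolvent

/-! ### The second resolvent identity and change of the spectral parameter. -/

section SecondResolvent

variable {H : E →ₗ.[ℂ] E} {V : E →L[ℂ] E} {z : ℂ} (hz : z ∉ opSpectrum H)
  (hzV : z ∉ opSpectrum (perturbed H V))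

include hz hzV in
lemma resolventDiff_eq : resolventDiff H V z =
    opResolvent H z * V * opResolvent (perturbed H V) z := by
  rw [resolventDiff, sub_eq_iff_eq_add]
  ext x
  obtain ⟨hx, hx2⟩ := (isResolventAt_opResolvent hzV).1 x
  set y := opResolvent (perturbed H V) z x with hy
  have h := (isResolventAt_opResolvent hz).2 ⟨y, hx⟩
  have h3 : z • y - H ⟨y, hx⟩ = x + V y := by
    rw [← hx2]
    change _ = z • y - (V y + H ⟨y, hx⟩) + V y
    abel
  simp only [h3, map_add] at h
  simp only [add_apply, op_mul_apply]
  rw [← hy]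
  conv_lhs => rw [← h]
  abel

include hz hzV in
lemma resolventDiff_eq' : resolventDiff H V z =
    opResolvent (perturbed H V) z * V * opResolvent H z := by
  rw [resolventDiff, sub_eq_iff_eq_add]
  ext x
  obtain ⟨hx, hx2⟩ := (isResolventAt_opResolvent hz).1 x
  set y := opResolvent H z x with hy
  have h := (isResolventAt_opResolvent hzV).2 ⟨y, hx⟩
  have h3 : z • y - perturbed H V ⟨y, hx⟩ = x - V y := by
    rw [← hx2]
    change z • y - (V y + H ⟨y, hx⟩) = _
    abel
  simp only [h3, map_sub] at h
  simp only [add_apply, op_mul_apply]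
  rw [← hy]
  rw [← sub_eq_iff_eq_add', h]

/-- The left factor carries R_V(w) to R_V(z), the right one carries R(w) to R(z), and the two cross
terms (w - z) R_V(z) R(z) cancel. Trace norm bounds at one point thereby pass to other points, at a
cost governed by |w - z| times the resolvent norms at z. -/
lemma resolventDiff_transfer {w : ℂ} (hz : z ∉ opSpectrum H)
    (hzV : z ∉ opSpectrum (perturbed H V)) (hw : w ∉ opSpectrum H)
    (hwV : w ∉ opSpectrum (perturbed H V)) :
    resolventDiff H V z = (1 + (w - z) • opResolvent (perturbed H V) z) * resolventDiff H V w *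
      (1 + (w - z) • opResolvent H z) := by
  have h1 : (1 + (w - z) • opResolvent (perturbed H V) z) * opResolvent (perturbed H V) w =
      opResolvent (perturbed H V) z := by
    rw [add_mul, one_mul, smul_mul_assoc, ← opResolvent_sub hzV hwV]; abel
  have h2 : opResolvent H w * (1 + (w - z) • opResolvent H z) = opResolvent H z := by
    rw [mul_add, mul_one, mul_smul_comm, opResolvent_commute hw hz, ← opResolvent_sub hz hw]; abel
  rw [resolventDiff, resolventDiff, mul_sub, sub_mul, h1, mul_assoc _ (opResolvent H w), h2,
    mul_add, mul_one, add_mul, one_mul, mul_smul_comm, smul_mul_assoc]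
  abel

end SecondResolvent

/-! ### Uniqueness of the Stieltjes transform -/

section Stieltjes

open BoundedContinuousFunction

/-- The Poisson mean of a bounded continuous function. -/
def poissonMean (φ : ℝ →ᵇ ℝ) (y t : ℝ) : ℝ := ∫ u : ℝ, φ (t + y * u) * (1 + u ^ 2)⁻¹

lemma norm_poisson_integrand_le (φ : ℝ →ᵇ ℝ) (y t u : ℝ) :
    ‖φ (t + y * u) * (1 + u ^ 2)⁻¹‖ ≤ ‖φ‖ * (1 + u ^ 2)⁻¹ := by
  rw [norm_mul, Real.norm_of_nonneg (by positivity : 0 ≤ (1 + u ^ 2)⁻¹)]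
  gcongr
  exact φ.norm_coe_le_norm _

lemma continuous_poisson_integrand (φ : ℝ →ᵇ ℝ) :
    Continuous fun p : ℝ × ℝ × ℝ => φ (p.2.1 + p.1 * p.2.2) * (1 + p.2.2 ^ 2)⁻¹ :=
  (φ.continuous.comp (by fun_prop)).mul (Continuous.inv₀ (by fun_prop) fun p => by positivity)

lemma continuous_poissonMean (φ : ℝ →ᵇ ℝ) :
    Continuous fun p : ℝ × ℝ => poissonMean φ p.1 p.2 := by
  refine continuous_of_dominated (bound := fun u => ‖φ‖ * (1 + u ^ 2)⁻¹) (fun p => ?_)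
    (fun p => ae_of_all _ fun u => norm_poisson_integrand_le φ p.1 p.2 u)
    (integrable_inv_one_add_sq.const_mul _) (ae_of_all _ fun u => ?_)
  · exact ((continuous_poisson_integrand φ).comp
      (by fun_prop : Continuous fun u : ℝ => (p.1, p.2, u))).aestronglyMeasurable
  · exact (continuous_poisson_integrand φ).comp
      (by fun_prop : Continuous fun p : ℝ × ℝ => (p.1, p.2, u))

lemma norm_poissonMean_le (φ : ℝ →ᵇ ℝ) (y t : ℝ) : ‖poissonMean φ y t‖ ≤ ‖φ‖ * Real.pi := by
  refine (norm_integral_le_of_norm_le (integrable_inv_one_add_sq.const_mul ‖φ‖)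
    (ae_of_all _ fun u => norm_poisson_integrand_le φ y t u)).trans_eq ?_
  rw [integral_const_mul, integral_univ_inv_one_add_sq]

lemma poissonMean_zero (φ : ℝ →ᵇ ℝ) (t : ℝ) : poissonMean φ 0 t = φ t * Real.pi := by
  simp [poissonMean, integral_const_mul, integral_univ_inv_one_add_sq]

lemma tendsto_integral_poissonMean (φ : ℝ →ᵇ ℝ) (μ : Measure ℝ) [IsFiniteMeasure μ] :
    Tendsto (fun y => ∫ t, poissonMean φ y t ∂μ) (𝓝[>] 0) (𝓝 (∫ t, φ t * Real.pi ∂μ)) := by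
  refine tendsto_integral_filter_of_dominated_convergence (fun _ => ‖φ‖ * Real.pi)
    (Eventually.of_forall fun y => ?_)
    (Eventually.of_forall fun y => ae_of_all _ fun t => norm_poissonMean_le φ y t)
    (integrable_const _) (ae_of_all _ fun t => ?_)
  · exact ((continuous_poissonMean φ).comp
      (by fun_prop : Continuous fun t : ℝ => (y, t))).aestronglyMeasurable
  · rw [← poissonMean_zero]
    exact (((continuous_poissonMean φ).comp
      (by fun_prop : Continuous fun y : ℝ => (y, t))).tendsto 0).mono_left nhdsWithin_le_nhds

lemma poisson_kernel_eq {y : ℝ} (hy : 0 < y) (x t : ℝ) :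
    y⁻¹ * (1 + ((x - t) / y) ^ 2)⁻¹ = -((((x : ℂ) + y * Complex.I) - (t : ℂ))⁻¹).im := by
  have hd : 0 < (x - t) * (x - t) + y * y := by nlinarith [mul_self_nonneg (x - t), mul_pos hy hy]
  have h1 : Complex.normSq (((x : ℂ) + y * Complex.I) - (t : ℂ)) =
      (x - t) * (x - t) + y * y := by
    simp [Complex.normSq_apply]
  have h2 : (((x : ℂ) + y * Complex.I) - (t : ℂ)).im = y := by simp
  rw [Complex.inv_im, h1, h2, neg_div, neg_neg]
  have h3 : 1 + ((x - t) / y) ^ 2 = ((x - t) * (x - t) + y * y) / y ^ 2 := by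
    field_simp; ring
  rw [h3, inv_div]
  field_simp

lemma poissonMean_eq (φ : ℝ →ᵇ ℝ) {y : ℝ} (hy : 0 < y) (t : ℝ) :
    poissonMean φ y t = ∫ x : ℝ, φ x * (y⁻¹ * (1 + ((x - t) / y) ^ 2)⁻¹) := by
  have h1 := Measure.integral_comp_mul_left
    (fun v : ℝ => φ (t + v) * (1 + (v / y) ^ 2)⁻¹) y
  have h2 : ∀ u : ℝ, y * u / y = u := fun u => by field_simp
  simp only [h2] at h1
  rw [poissonMean, h1, abs_of_pos (inv_pos.2 hy), smul_eq_mul, ← integral_const_mul,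
    ← integral_add_left_eq_self (fun x : ℝ => φ x * (y⁻¹ * (1 + ((x - t) / y) ^ 2)⁻¹)) t]
  congr 1; ext v
  rw [add_sub_cancel_left]
  ring

/-- Fubini moves the Poisson kernel from the test function to the measure, where it appears as minus
the imaginary part of the Stieltjes transform at x + iy. -/
lemma integral_poissonMean_eq (φ : ℝ →ᵇ ℝ) {y : ℝ} (hy : 0 < y) (μ : Measure ℝ)
    [IsFiniteMeasure μ] :
    ∫ t, poissonMean φ y t ∂μ =
      ∫ x : ℝ, φ x * -(∫ t : ℝ, (((x : ℂ) + y * Complex.I) - (t : ℂ))⁻¹ ∂μ).im := by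
  have hcont : Continuous fun p : ℝ × ℝ =>
      φ p.2 * (y⁻¹ * (1 + ((p.2 - p.1) / y) ^ 2)⁻¹) :=
    (φ.continuous.comp continuous_snd).mul (continuous_const.mul
      (Continuous.inv₀ (by fun_prop) fun p => by positivity))
  have hker : ∀ t : ℝ, Integrable fun x : ℝ => y⁻¹ * (1 + ((x - t) / y) ^ 2)⁻¹ := fun t =>
    (((integrable_inv_one_add_sq.comp_div hy.ne').comp_sub_right t).const_mul _)
  have hkint : ∀ t : ℝ, ∫ x : ℝ, y⁻¹ * (1 + ((x - t) / y) ^ 2)⁻¹ = Real.pi := fun t => by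
    have := poissonMean_eq (BoundedContinuousFunction.const ℝ 1) hy t
    simp only [BoundedContinuousFunction.const_apply, one_mul, poissonMean] at this
    rw [← this, integral_univ_inv_one_add_sq]
  have hle : ∀ t x : ℝ, ‖φ x * (y⁻¹ * (1 + ((x - t) / y) ^ 2)⁻¹)‖ ≤
      ‖φ‖ * (y⁻¹ * (1 + ((x - t) / y) ^ 2)⁻¹) := fun t x => by
    rw [norm_mul, Real.norm_of_nonneg (by positivity : 0 ≤ y⁻¹ * (1 + ((x - t) / y) ^ 2)⁻¹)]
    gcongr
    exact φ.norm_coe_le_norm _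
  have hInt : Integrable (fun p : ℝ × ℝ => φ p.2 * (y⁻¹ * (1 + ((p.2 - p.1) / y) ^ 2)⁻¹))
      (μ.prod volume) := by
    rw [integrable_prod_iff hcont.aestronglyMeasurable]
    constructor
    · refine ae_of_all _ fun t => ((hker t).const_mul ‖φ‖).mono'
        (hcont.comp (by fun_prop : Continuous fun x : ℝ => (t, x))).aestronglyMeasurable
        (ae_of_all _ fun x => hle t x)
    · refine Integrable.of_bound
        (hcont.aestronglyMeasurable.norm.integral_prod_right') (‖φ‖ * Real.pi)
        (ae_of_all _ fun t => ?_)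
      rw [← hkint t, ← integral_const_mul]
      refine (norm_integral_le_of_norm_le ((hker t).const_mul ‖φ‖) (ae_of_all _ fun x => ?_))
      rw [norm_norm]
      exact hle t x
  simp only [poissonMean_eq φ hy]
  rw [integral_integral_swap hInt]
  congr 1; ext x
  rw [integral_const_mul]
  congr 1
  simp only [poisson_kernel_eq hy]
  rw [integral_neg]
  congr 1
  have hi : Integrable (fun t : ℝ => (((x : ℂ) + y * Complex.I) - (t : ℂ))⁻¹) μ := by
    refine Integrable.of_bound (Measurable.aestronglyMeasurable (by fun_prop)) y⁻¹
      (ae_of_all _ fun t => ?_)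
    rw [norm_inv]
    refine inv_anti₀ hy (le_trans ?_ (Complex.abs_im_le_norm _))
    simp [abs_of_pos hy]
  exact integral_im hi

/-- A finite measure on the line is determined by its Stieltjes transform off the real axis. -/
theorem measure_eq_of_stieltjes_eq {μ ν : Measure ℝ} [IsFiniteMeasure μ] [IsFiniteMeasure ν]
    (h : ∀ z : ℂ, z.im ≠ 0 → ∫ t : ℝ, (z - (t : ℂ))⁻¹ ∂μ = ∫ t : ℝ, (z - (t : ℂ))⁻¹ ∂ν) :
    μ = ν := by
  refine ext_of_forall_integral_eq_of_IsFiniteMeasure fun φ => ?_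
  -- For y > 0 the Poisson means depend on the measure only through its Stieltjes transform; as y →
  -- +0 they recover π times the integral of φ.
  have h1 : ∀ᶠ y in 𝓝[>] (0 : ℝ),
      ∫ t, poissonMean φ y t ∂μ = ∫ t, poissonMean φ y t ∂ν := by
    filter_upwards [self_mem_nhdsWithin] with y hy
    have hy' : 0 < y := hy
    rw [integral_poissonMean_eq φ hy', integral_poissonMean_eq φ hy']
    congr 1; ext x
    rw [h _ (by simp [hy'.ne'])]
  have h2 := tendsto_nhds_unique ((tendsto_integral_poissonMean φ μ).congr' h1)
    (tendsto_integral_poissonMean φ ν)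
  rw [integral_mul_const, integral_mul_const] at h2
  exact mul_right_cancel₀ Real.pi_ne_zero h2

end Stieltjes

/-! ### Measures of a continuous functional calculus -/

section Calculus

variable {X : Type*} [TopologicalSpace X] [T2Space X] [CompactSpace X] [MeasurableSpace X]
  [BorelSpace X] (Φ : C(X, ℂ) →⋆ₐ[ℂ] (E →L[ℂ] E))

/-- A real continuous function, viewed as a complex one. -/
def ofRealMap {X : Type*} [TopologicalSpace X] (g : C(X, ℝ)) : C(X, ℂ) :=
  ⟨fun b => (g b : ℂ), by fun_prop⟩

omit [T2Space X] [CompactSpace X] [MeasurableSpace X] [BorelSpace X] in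
lemma inner_star_mul_self (h : C(X, ℂ)) (x : E) :
    ⟪x, Φ (star h * h) x⟫_ℂ = ((‖Φ h x‖ ^ 2 : ℝ) : ℂ) := by
  rw [map_mul, map_star, op_mul_apply, inner_star_right, inner_self_eq_ofReal]

-- The Riesz–Markov–Kakutani theorem for the functional g ↦ ⟨x, Φ(g) x⟩ on real functions. It is
-- positive because a nonnegative g is the square of √g, whose value equals ‖Φ(√g) x‖²; complex
-- functions follow by linearity.
open CompactlySupported in
lemma exists_calcMeasure (x : E) : ∃ μ : Measure X, IsFiniteMeasure μ ∧
    ∀ h : C(X, ℂ), ⟪x, Φ h x⟫_ℂ = ∫ b, h b ∂μ := by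
  let Λ₀ : C_c(X, ℝ) →ₗ[ℝ] ℝ :=
    { toFun := fun g => (⟪x, Φ (ofRealMap (g : C(X, ℝ))) x⟫_ℂ).re
      map_add' := fun g g' => by
        have : ofRealMap ((g + g' : C_c(X, ℝ)) : C(X, ℝ)) =
            ofRealMap (g : C(X, ℝ)) + ofRealMap (g' : C(X, ℝ)) := by
          ext b; simp [ofRealMap]
        rw [this, map_add, add_apply, inner_add_right, Complex.add_re]
      map_smul' := fun c g => by
        have : ofRealMap ((c • g : C_c(X, ℝ)) : C(X, ℝ)) =
            (c : ℂ) • ofRealMap (g : C(X, ℝ)) := by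
          ext b; simp [ofRealMap]
        rw [this, map_smul, smul_apply, inner_smul_right, Complex.re_ofReal_mul]
        rfl }
  have hpos : ∀ g : C_c(X, ℝ), 0 ≤ g → 0 ≤ Λ₀ g := fun g hg => by
    have h1 : ofRealMap (g : C(X, ℝ)) = star (ofRealMap ⟨fun b => √(g b), by fun_prop⟩) *
        ofRealMap ⟨fun b => √(g b), by fun_prop⟩ := by
      ext b
      have : (0 : ℝ) ≤ g b := hg b
      simp only [ofRealMap, ContinuousMap.coe_mk, ContinuousMap.mul_apply, ContinuousMap.star_apply,
        Complex.star_def, Complex.conj_ofReal]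
      rw [← Complex.ofReal_mul, Real.mul_self_sqrt this]
    change 0 ≤ (⟪x, Φ (ofRealMap (g : C(X, ℝ))) x⟫_ℂ).re
    rw [h1, inner_star_mul_self, Complex.ofReal_re]
    positivity
  let Λ : C_c(X, ℝ) →ₚ[ℝ] ℝ := PositiveLinearMap.mk₀ Λ₀ hpos
  refine ⟨RealRMK.rieszMeasure Λ, inferInstance, fun h => ?_⟩
  have hreal : ∀ g : C(X, ℝ), ⟪x, Φ (ofRealMap g) x⟫_ℂ =
      ((∫ b, g b ∂(RealRMK.rieszMeasure Λ) : ℝ) : ℂ) := fun g => by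
    have h1 := RealRMK.integral_rieszMeasure Λ
      (CompactlySupportedContinuousMap.continuousMapEquiv g)
    have h2 : (⟪x, Φ (ofRealMap g) x⟫_ℂ).re = ∫ b, g b ∂(RealRMK.rieszMeasure Λ) := h1.symm
    rw [← h2]
    have him : (⟪x, Φ (ofRealMap g) x⟫_ℂ).im = 0 := by
      have hsa : star (Φ (ofRealMap g)) = Φ (ofRealMap g) := by
        rw [← map_star]
        congr 1
        ext b; simp [ofRealMap]
      refine Complex.conj_eq_iff_im.1 ?_
      rw [inner_conj_symm, ← inner_star_right, hsa]
    exact Complex.ext rfl him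
  set gr : C(X, ℝ) := ⟨fun b => (h b).re, by fun_prop⟩
  set gi : C(X, ℝ) := ⟨fun b => (h b).im, by fun_prop⟩
  have hdec : h = ofRealMap gr + Complex.I • ofRealMap gi := by
    ext b
    simp only [ofRealMap, gr, gi, ContinuousMap.add_apply, ContinuousMap.smul_apply,
      ContinuousMap.coe_mk, smul_eq_mul]
    rw [mul_comm, Complex.re_add_im]
  have hInt : Integrable (fun b => h b) (RealRMK.rieszMeasure Λ) :=
    h.continuous.integrable_of_hasCompactSupport (HasCompactSupport.of_compactSpace _)
  conv_lhs => rw [hdec]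
  rw [map_add, map_smul, add_apply, smul_apply, inner_add_right, inner_smul_right, hreal, hreal]
  have := integral_re_add_im hInt
  rw [← this]
  simp only [gr, gi, ContinuousMap.coe_mk, mul_comm Complex.I]
  rfl

/-- The measure `h ↦ (x, Φ(h) x)`. -/
def calcMeasure (x : E) : Measure X := (exists_calcMeasure Φ x).choose

instance (x : E) : IsFiniteMeasure (calcMeasure Φ x) := (exists_calcMeasure Φ x).choose_spec.1

lemma inner_calc_eq_integral (x : E) (h : C(X, ℂ)) :
    ⟪x, Φ h x⟫_ℂ = ∫ b, h b ∂(calcMeasure Φ x) := (exists_calcMeasure Φ x).choose_spec.2 h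

lemma norm_calc_sq (x : E) (h : C(X, ℂ)) :
    ‖Φ h x‖ ^ 2 = ∫ b, ‖h b‖ ^ 2 ∂(calcMeasure Φ x) := by
  refine Complex.ofReal_injective ?_
  rw [← inner_star_mul_self, inner_calc_eq_integral, ← integral_complex_ofReal]
  congr 1; ext b
  simp only [ContinuousMap.mul_apply, ContinuousMap.star_apply, Complex.star_def]
  rw [← Complex.normSq_eq_conj_mul_self, Complex.normSq_eq_norm_sq]

/-- Bounded pointwise limits of continuous functions belong to the functional calculus. -/
lemma exists_strong_limit {g : ℕ → C(X, ℂ)} {G : X → ℂ} {C : ℝ} (hC : ∀ n b, ‖g n b‖ ≤ C)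
    (hg : ∀ b, Tendsto (fun n => g n b) atTop (𝓝 (G b))) :
    ∃ T : E →L[ℂ] E, (∀ x, Tendsto (fun n => Φ (g n) x) atTop (𝓝 (T x))) ∧
      ∀ x, ⟪x, T x⟫_ℂ = ∫ b, G b ∂(calcMeasure Φ x) := by
  have hGm : Measurable G := measurable_of_tendsto_metrizable (fun n => (g n).continuous.measurable)
    (tendsto_pi_nhds.2 hg)
  have hGC : ∀ b, ‖G b‖ ≤ C := fun b =>
    le_of_tendsto (hg b).norm (Eventually.of_forall fun n => hC n b)
  -- By `norm_calc_sq` the distance of Φ(g_n) x and Φ(g_m) x is the L² distance of g_n and g_m with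
  -- respect to the measure of x; dominated convergence gives L² convergence to G.
  have hcs : ∀ x, CauchySeq fun n => Φ (g n) x := fun x => by
    set μ := calcMeasure Φ x
    have h0 : Tendsto (fun n => ∫ b, ‖g n b - G b‖ ^ 2 ∂μ) atTop (𝓝 0) := by
      have := tendsto_integral_of_dominated_convergence (μ := μ)
        (F := fun n b => ‖g n b - G b‖ ^ 2) (f := fun _ => 0) (fun _ => (C + C) ^ 2)
        (fun n => (((g n).continuous.measurable.sub hGm).norm.pow_const 2).aestronglyMeasurable)
        (integrable_const _) (fun n => ae_of_all _ fun b => ?_) (ae_of_all _ fun b => ?_)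
      · simpa using this
      · rw [Real.norm_of_nonneg (by positivity)]
        exact pow_le_pow_left₀ (norm_nonneg _)
          ((norm_sub_le _ _).trans (add_le_add (hC n b) (hGC b))) 2
      · have h2 := ((hg b).sub_const (G b)).norm.pow 2
        simpa using h2
    have hInt : ∀ n, Integrable (fun b => ‖g n b - G b‖ ^ 2) μ := fun n => by
      refine Integrable.of_bound
        (((g n).continuous.measurable.sub hGm).norm.pow_const 2).aestronglyMeasurable ((C + C) ^ 2)
        (ae_of_all _ fun b => ?_)
      rw [Real.norm_of_nonneg (by positivity)]
      exact pow_le_pow_left₀ (norm_nonneg _)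
        ((norm_sub_le _ _).trans (add_le_add (hC n b) (hGC b))) 2
    have hle : ∀ n m, ‖Φ (g n) x - Φ (g m) x‖ ^ 2 ≤
        2 * ∫ b, ‖g n b - G b‖ ^ 2 ∂μ + 2 * ∫ b, ‖g m b - G b‖ ^ 2 ∂μ := fun n m => by
      rw [← sub_apply, ← map_sub, norm_calc_sq, ← integral_const_mul, ← integral_const_mul,
        ← integral_add ((hInt n).const_mul 2) ((hInt m).const_mul 2)]
      refine integral_mono_of_nonneg (ae_of_all _ fun b => by positivity)
        (((hInt n).const_mul 2).add ((hInt m).const_mul 2)) (ae_of_all _ fun b => ?_)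
      have h3 : ‖g n b - g m b‖ ≤ ‖g n b - G b‖ + ‖g m b - G b‖ := by
        rw [← norm_sub_rev (G b) (g m b)]
        exact norm_sub_le_norm_sub_add_norm_sub _ _ _
      simp only [ContinuousMap.sub_apply]
      nlinarith [norm_nonneg (g n b - g m b), sq_nonneg (‖g n b - G b‖ - ‖g m b - G b‖)]
    rw [Metric.cauchySeq_iff]
    intro ε hε
    obtain ⟨N, hN⟩ := eventually_atTop.1 (h0.eventually_lt_const
      (show (0 : ℝ) < ε ^ 2 / 4 by positivity))
    refine ⟨N, fun m hm n hn => ?_⟩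
    rw [dist_eq_norm]
    refine lt_of_pow_lt_pow_left₀ 2 hε.le ((hle m n).trans_lt ?_)
    linarith [hN m hm, hN n hn]
  choose T hT using fun x => cauchySeq_tendsto_of_complete (hcs x)
  refine ⟨continuousLinearMapOfTendsto (fun n => Φ (g n)) (tendsto_pi_nhds.2 hT), hT, fun x => ?_⟩
  have h1 : Tendsto (fun n => ⟪x, Φ (g n) x⟫_ℂ) atTop (𝓝 ⟪x, T x⟫_ℂ) :=
    tendsto_const_nhds.inner (hT x)
  refine tendsto_nhds_unique h1 ?_
  simp only [inner_calc_eq_integral]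
  exact tendsto_integral_of_dominated_convergence (fun _ => C)
    (fun n => (g n).continuous.aestronglyMeasurable) (integrable_const _)
    (fun n => ae_of_all _ fun b => hC n b) (ae_of_all _ hg)

end Calculus

/-! ### The spectral measure of a self-adjoint operator with a real resolvent point -/

section SpectralMeasure

variable {H : E →ₗ.[ℂ] E} (hH : IsSelfAdjoint H) {a : ℝ} (ha : (a : ℂ) ∉ opSpectrum H)

lemma one_add_smul_mul_one_add_smul {z w : ℂ} (hz : z ∉ opSpectrum H) (hw : w ∉ opSpectrum H) :
    (1 + (w - z) • opResolvent H z) * (1 + (z - w) • opResolvent H w) = 1 := by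
  have h := opResolvent_sub hz hw
  have h2 : (1 + (w - z) • opResolvent H z) * (1 + (z - w) • opResolvent H w) =
      1 + (w - z) • (opResolvent H z - opResolvent H w) -
        ((w - z) * (w - z)) • (opResolvent H z * opResolvent H w) := by
    rw [add_mul, one_mul, smul_mul_assoc, mul_add, mul_one, mul_smul_comm]
    module
  rw [h2, h]
  module

/-- The bounded operator `(H - a)⁻¹`. -/
def shiftedInverse (H : E →ₗ.[ℂ] E) (a : ℝ) : E →L[ℂ] E := -opResolvent H a

include hH ha in
lemma isSelfAdjoint_shiftedInverse : IsSelfAdjoint (shiftedInverse H a) := by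
  rw [IsSelfAdjoint, shiftedInverse, star_neg, star_opResolvent hH ha, Complex.conj_ofReal]

include ha in
lemma inv_notMem_spectrum_shiftedInverse {z : ℂ} (hz : z ∉ opSpectrum H) (hza : z ≠ a) :
    (z - a)⁻¹ ∉ spectrum ℂ (shiftedInverse H a) := by
  have hza' : z - a ≠ 0 := sub_ne_zero.2 hza
  rw [spectrum.notMem_iff]
  have h1 := one_add_smul_mul_one_add_smul ha hz
  have h2 := one_add_smul_mul_one_add_smul hz ha
  have h3 : algebraMap ℂ (E →L[ℂ] E) (z - a)⁻¹ - shiftedInverse H a =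
      (z - a)⁻¹ • (1 + (z - a) • opResolvent H a) := by
    rw [shiftedInverse, Algebra.algebraMap_eq_smul_one, smul_add, smul_smul, inv_mul_cancel₀ hza',
      one_smul, sub_neg_eq_add]
  rw [h3]
  refine IsUnit.smul (Units.mk0 _ (inv_ne_zero hza')) ⟨⟨_, _, h1, h2⟩, rfl⟩

include ha in
lemma mem_opSpectrum_of_mem_spectrum {b : ℂ} (hb : b ∈ spectrum ℂ (shiftedInverse H a))
    (hb0 : b ≠ 0) : (a : ℂ) + b⁻¹ ∈ opSpectrum H := by
  by_contra h
  refine inv_notMem_spectrum_shiftedInverse ha h (by simpa using hb0) ?_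
  simpa using hb

include hH ha in
lemma isStarNormal_shiftedInverse : IsStarNormal (shiftedInverse H a) :=
  (isSelfAdjoint_shiftedInverse hH ha).isStarNormal

include hH ha in
lemma im_eq_zero_of_mem_spectrum {b : ℂ} (hb : b ∈ spectrum ℂ (shiftedInverse H a)) :
    b.im = 0 :=
  (isSelfAdjoint_shiftedInverse hH ha).im_eq_zero_of_mem_spectrum hb

/-- The functional calculus of `(H - a)⁻¹`. -/
def shiftedCalc : C(spectrum ℂ (shiftedInverse H a), ℂ) →⋆ₐ[ℂ] (E →L[ℂ] E) :=
  cfcHom (isStarNormal_shiftedInverse hH ha)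

/-- The coordinate function on the spectrum of `(H - a)⁻¹`. -/
def specCoord (H : E →ₗ.[ℂ] E) (a : ℝ) : C(spectrum ℂ (shiftedInverse H a), ℂ) :=
  (ContinuousMap.id ℂ).restrict _

lemma shiftedCalc_coord : shiftedCalc hH ha (specCoord H a) = shiftedInverse H a :=
  cfcHom_id _

/-- The spectral variable of `H`, as a function of the one of `(H - a)⁻¹`. -/
def specMap (H : E →ₗ.[ℂ] E) (a : ℝ) (b : spectrum ℂ (shiftedInverse H a)) : ℝ :=
  a + (b : ℂ).re⁻¹

omit [CompleteSpace E] in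
lemma measurable_specMap : Measurable (specMap H a) := by
  unfold specMap
  fun_prop

include ha in
lemma shiftedInverse_injective {x : E} (hx : shiftedInverse H a x = 0) : x = 0 := by
  obtain ⟨h1, h2⟩ := (isResolventAt_opResolvent ha).1 x
  have h3 : opResolvent H a x = 0 := by simpa [shiftedInverse] using hx
  have h4 : (⟨opResolvent H a x, h1⟩ : H.domain) = 0 := Subtype.ext h3
  rw [h4, h3] at h2
  simpa using h2.symm

/-- The point 0 in the spectrum of (H - a)⁻¹ stands for infinity in the spectrum of H. The functions
1/(1 + n|b|²) decrease to the indicator function of {0}, their strong limit T satisfies (H - a)⁻¹ T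
x = 0, and injectivity of (H - a)⁻¹ gives T x = 0. Hence {0} has measure zero. -/
lemma ae_specCoord_ne_zero (x : E) :
    ∀ᵐ b ∂(calcMeasure (shiftedCalc hH ha) x), specCoord H a b ≠ 0 := by
  set Φ := shiftedCalc hH ha with hΦ
  set μ := calcMeasure Φ x with hμ
  let g : ℕ → C(spectrum ℂ (shiftedInverse H a), ℂ) := fun n =>
    ⟨fun b => ((1 + n * ‖specCoord H a b‖ ^ 2 : ℝ) : ℂ)⁻¹, by
      refine Continuous.inv₀ (by fun_prop) fun b => ?_
      have : (0 : ℝ) < 1 + n * ‖specCoord H a b‖ ^ 2 := by positivity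
      exact_mod_cast this.ne'⟩
  have hga : ∀ n b, g n b = ((1 + n * ‖specCoord H a b‖ ^ 2 : ℝ) : ℂ)⁻¹ := fun n b => rfl
  have hgn : ∀ n b, ‖g n b‖ ≤ 1 := fun n b => by
    rw [hga, norm_inv, Complex.norm_real, Real.norm_of_nonneg (by positivity)]
    refine inv_le_one_of_one_le₀ ?_
    have : (0 : ℝ) ≤ n * ‖specCoord H a b‖ ^ 2 := by positivity
    linarith
  set Z : Set (spectrum ℂ (shiftedInverse H a)) := {b | specCoord H a b = 0} with hZ
  have hZm : MeasurableSet Z := (isClosed_singleton.preimage (specCoord H a).continuous).measurableSet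
  have hlim0 : ∀ b, specCoord H a b ≠ 0 → Tendsto (fun n => g n b) atTop (𝓝 0) := fun b hb => by
    simp only [hga]
    have h1 : Tendsto (fun n : ℕ => (1 + n * ‖specCoord H a b‖ ^ 2 : ℝ)) atTop atTop :=
      tendsto_atTop_add_const_left _ _
        (tendsto_natCast_atTop_atTop.atTop_mul_const (by positivity))
    have h2 := (Complex.continuous_ofReal.tendsto 0).comp (tendsto_inv_atTop_zero.comp h1)
    simpa [Function.comp_def] using h2
  have hlim : ∀ b, Tendsto (fun n => g n b) atTop (𝓝 (Z.indicator (fun _ => (1 : ℂ)) b)) :=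
    fun b => by
      by_cases hb : specCoord H a b = 0
      · have : ∀ n, g n b = 1 := fun n => by rw [hga, hb]; simp
        rw [indicator_of_mem (show b ∈ Z from hb)]
        simp only [this]
        exact tendsto_const_nhds
      · rw [indicator_of_notMem (show b ∉ Z from hb)]
        exact hlim0 b hb
  obtain ⟨T, hT1, hT2⟩ := exists_strong_limit Φ hgn hlim
  have hBT : shiftedInverse H a (T x) = 0 := by
    have h1 : Tendsto (fun n => Φ (specCoord H a * g n) x) atTop
        (𝓝 (shiftedInverse H a (T x))) := by
      have := ((shiftedInverse H a).continuous.tendsto _).comp (hT1 x)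
      refine this.congr fun n => ?_
      rw [map_mul, hΦ, shiftedCalc_coord, op_mul_apply]
      rfl
    have h2 : Tendsto (fun n => ‖Φ (specCoord H a * g n) x‖ ^ 2) atTop (𝓝 0) := by
      simp only [norm_calc_sq]
      have := tendsto_integral_of_dominated_convergence (μ := μ)
        (F := fun n b => ‖(specCoord H a * g n) b‖ ^ 2) (f := fun _ => 0)
        (fun _ => ‖specCoord H a‖ ^ 2)
        (fun n => Continuous.aestronglyMeasurable (by fun_prop))
        (integrable_const _) (fun n => ae_of_all _ fun b => ?_) (ae_of_all _ fun b => ?_)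
      · simpa using this
      · rw [Real.norm_of_nonneg (by positivity)]
        refine pow_le_pow_left₀ (norm_nonneg _) ?_ 2
        rw [ContinuousMap.mul_apply, norm_mul]
        exact (mul_le_of_le_one_right (norm_nonneg _) (hgn n b)).trans
          ((specCoord H a).norm_coe_le_norm b)
      · by_cases hb : specCoord H a b = 0
        · simp [hb]
        · have := (((hlim0 b hb).const_mul (specCoord H a b)).norm.pow 2)
          simpa using this
    have h3 := tendsto_nhds_unique (h1.norm.pow 2) h2
    simpa using h3
  have hTx := shiftedInverse_injective ha hBT
  have h1 := hT2 x
  rw [hTx, inner_zero_right, integral_indicator_const _ hZm] at h1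
  have h2 : μ.real Z = 0 := by simpa using h1.symm
  have h3 : μ Z = 0 := (measureReal_eq_zero_iff (by finiteness)).1 h2
  exact measure_eq_zero_iff_ae_notMem.1 h3

lemma ofReal_specMap {b : spectrum ℂ (shiftedInverse H a)} (hH : IsSelfAdjoint H)
    (ha : (a : ℂ) ∉ opSpectrum H) :
    ((specMap H a b : ℝ) : ℂ) = a + (specCoord H a b)⁻¹ := by
  have h1 : specCoord H a b = (((b : ℂ).re : ℝ) : ℂ) :=
    Complex.ext (by rfl) (by rw [Complex.ofReal_im]; exact im_eq_zero_of_mem_spectrum hH ha b.2)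
  rw [h1, specMap]
  push_cast
  rfl

/-- The image of the calculus measure on the spectrum of `H`. -/
def pushedMeasure (x : E) : Measure ℝ := (calcMeasure (shiftedCalc hH ha) x).map (specMap H a)

instance (x : E) : IsFiniteMeasure (pushedMeasure hH ha x) := by
  unfold pushedMeasure; infer_instance

lemma isClosed_ofReal_preimage_opSpectrum :
    IsClosed {t : ℝ | (t : ℂ) ∈ opSpectrum H} := by
  have : IsClosed (opSpectrum H) := isOpen_compl_iff.1 isOpen_compl_opSpectrum
  exact this.preimage Complex.continuous_ofReal

lemma ae_pushedMeasure_mem (x : E) : ∀ᵐ t ∂(pushedMeasure hH ha x), ((t : ℝ) : ℂ) ∈ opSpectrum H := by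
  rw [pushedMeasure, ae_map_iff measurable_specMap.aemeasurable
    isClosed_ofReal_preimage_opSpectrum.measurableSet]
  filter_upwards [ae_specCoord_ne_zero hH ha x] with b hb
  rw [ofReal_specMap hH ha]
  exact mem_opSpectrum_of_mem_spectrum ha b.2 hb

include ha in
lemma resolvent_denom_ne_zero {z : ℂ} (hz : z ∉ opSpectrum H)
    (b : spectrum ℂ (shiftedInverse H a)) : (z - a) * specCoord H a b - 1 ≠ 0 := by
  intro h
  have h1 : (z - a) * specCoord H a b = 1 := sub_eq_zero.1 h
  have hza : z - a ≠ 0 := left_ne_zero_of_mul_eq_one h1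
  have h2 : specCoord H a b = (z - a)⁻¹ := eq_inv_of_mul_eq_one_right h1
  exact inv_notMem_spectrum_shiftedInverse ha hz (sub_ne_zero.1 hza) (h2 ▸ b.2)

/-- The resolvent of `H` as a function of `(H - a)⁻¹`. -/
def resolventFun {z : ℂ} (hz : z ∉ opSpectrum H) : C(spectrum ℂ (shiftedInverse H a), ℂ) :=
  ⟨fun b => specCoord H a b / ((z - a) * specCoord H a b - 1),
    Continuous.div (by fun_prop) (by fun_prop) (resolvent_denom_ne_zero ha hz)⟩

/-- The function r satisfies r ((z - a) b - 1) = b, and R(z) satisfies the same equation with b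
replaced by (H - a)⁻¹. The factor in parentheses is invertible as an operator, so the two solutions
agree. -/
lemma shiftedCalc_resolventFun {z : ℂ} (hz : z ∉ opSpectrum H) :
    shiftedCalc hH ha (resolventFun ha hz) = opResolvent H z := by
  set Φ := shiftedCalc hH ha with hΦ
  have h1 : resolventFun ha hz * ((z - a) • specCoord H a - 1) = specCoord H a := by
    ext b
    simp only [resolventFun, ContinuousMap.mul_apply, ContinuousMap.coe_mk, ContinuousMap.sub_apply,
      ContinuousMap.smul_apply, ContinuousMap.one_apply, smul_eq_mul]
    exact div_mul_cancel₀ _ (resolvent_denom_ne_zero ha hz b)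
  have h2 := congrArg Φ h1
  rw [map_mul, map_sub, map_smul, map_one, hΦ, shiftedCalc_coord, ← hΦ] at h2
  have h3 : (z - a) • shiftedInverse H a - 1 = -(1 + (z - a) • opResolvent H a) := by
    rw [shiftedInverse]; module
  have h4 : opResolvent H z * ((z - a) • shiftedInverse H a - 1) = shiftedInverse H a := by
    have := opResolvent_sub hz ha
    rw [mul_sub, mul_one, mul_smul_comm, shiftedInverse, mul_neg, smul_neg]
    rw [← neg_smul, neg_sub, ← this]
    abel
  have h5 : ((z - a) • shiftedInverse H a - 1) * -(1 + (a - z) • opResolvent H z) = 1 := by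
    rw [h3, neg_mul_neg]
    exact one_add_smul_mul_one_add_smul ha hz
  rw [← mul_one (Φ _), ← h5, ← mul_assoc, h2, ← h4, mul_assoc, h5, mul_one]

lemma inner_opResolvent_eq_pushed {z : ℂ} (hz : z ∉ opSpectrum H) (x : E) :
    ⟪x, opResolvent H z x⟫_ℂ = ∫ t : ℝ, (z - (t : ℂ))⁻¹ ∂(pushedMeasure hH ha x) := by
  rw [← shiftedCalc_resolventFun hH ha hz, inner_calc_eq_integral, pushedMeasure,
    integral_map measurable_specMap.aemeasurable
      (Measurable.aestronglyMeasurable (by fun_prop))]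
  refine integral_congr_ae ?_
  filter_upwards [ae_specCoord_ne_zero hH ha x] with b hb
  rw [ofReal_specMap hH ha]
  have h1 := resolvent_denom_ne_zero ha hz b
  simp only [resolventFun, ContinuousMap.coe_mk]
  rw [show z - (a + (specCoord H a b)⁻¹) = ((z - a) * specCoord H a b - 1) / specCoord H a b by
    field_simp; ring, inv_div]

/-- The measure selected in the definition is known only through its Stieltjes transform off the
real axis; uniqueness identifies it with the constructed one, whose support is visible. -/
lemma spectralMeasure_eq_pushed (x : E) : spectralMeasure H x = pushedMeasure hH ha x := by
  have hex : IsSpectralMeasureAt H x (pushedMeasure hH ha x) :=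
    ⟨inferInstance, fun z hz =>
      inner_opResolvent_eq_pushed hH ha (notMem_opSpectrum_of_im_ne_zero hH hz) x⟩
  have h' : ∃ μ, IsSpectralMeasureAt H x μ := ⟨_, hex⟩
  rw [spectralMeasure, dif_pos h']
  obtain ⟨hf, hs⟩ := h'.choose_spec
  exact measure_eq_of_stieltjes_eq fun z hz => by rw [← hs z hz, hex.2 z hz]

include hH ha in
lemma isFiniteMeasure_spectralMeasure (x : E) : IsFiniteMeasure (spectralMeasure H x) := by
  rw [spectralMeasure_eq_pushed hH ha]; infer_instance

include hH ha in
lemma ae_spectralMeasure_mem (x : E) :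
    ∀ᵐ t ∂(spectralMeasure H x), ((t : ℝ) : ℂ) ∈ opSpectrum H := by
  rw [spectralMeasure_eq_pushed hH ha]; exact ae_pushedMeasure_mem hH ha x

include hH ha in
lemma inner_opResolvent_eq {z : ℂ} (hz : z ∉ opSpectrum H) (x : E) :
    ⟪x, opResolvent H z x⟫_ℂ = ∫ t : ℝ, (z - (t : ℂ))⁻¹ ∂(spectralMeasure H x) := by
  rw [spectralMeasure_eq_pushed hH ha]; exact inner_opResolvent_eq_pushed hH ha hz x

end SpectralMeasure

/-! ### Borel functional calculus of a semibounded operator -/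

section BorelCalculus

variable {H : E →ₗ.[ℂ] E}

/-- A continuous approximation of the indicator function of `[β, ∞)`. -/
def ramp (β : ℝ) (n : ℕ) (b : ℝ) : ℝ := max 0 (min 1 (1 + n * (b - β)))

lemma continuous_ramp (β : ℝ) (n : ℕ) : Continuous (ramp β n) := by
  unfold ramp; fun_prop

lemma norm_ramp_le (β : ℝ) (n : ℕ) (b : ℝ) : ‖ramp β n b‖ ≤ 1 := by
  rw [ramp, Real.norm_of_nonneg (le_max_left _ _)]
  exact max_le zero_le_one (min_le_left _ _)

lemma ramp_of_le {β b : ℝ} (h : β ≤ b) (n : ℕ) : ramp β n b = 1 := by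
  have : (0 : ℝ) ≤ n * (b - β) := mul_nonneg (Nat.cast_nonneg _) (sub_nonneg.2 h)
  rw [ramp, min_eq_left (by linarith), max_eq_right zero_le_one]

lemma eventually_ramp_of_lt {β b : ℝ} (h : b < β) : ∀ᶠ n in atTop, ramp β n b = 0 := by
  obtain ⟨N, hN⟩ := exists_nat_gt (β - b)⁻¹
  filter_upwards [eventually_ge_atTop N] with n hn
  have h1 : 0 < β - b := sub_pos.2 h
  have h2 : (β - b)⁻¹ < n := hN.trans_le (by exact_mod_cast hn)
  have h3 : 1 < n * (β - b) := by
    rw [inv_lt_iff_one_lt_mul₀ h1] at h2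
    linarith
  rw [ramp, max_eq_left]
  exact (min_le_right _ _).trans (by linarith)

/-- Existence of `(f χ_{(-∞, ν]})(H)` for `H` bounded from below and continuous `f`. -/
theorem exists_isBorelCalculus_cut (hH : IsSelfAdjoint H) {a ν : ℝ}
    (hbelow : ∀ w ∈ opSpectrum H, a < w.re) (haν : a < ν) {f : ℝ → ℂ} (hf : Continuous f) :
    ∃ T, IsBorelCalculus H ((Iic ν).indicator f) T := by
  have ha : (a : ℂ) ∉ opSpectrum H := fun h => lt_irrefl a (by simpa using hbelow _ h)
  -- For b = 1/(t - a) > 0 the condition t ≤ ν reads b ≥ β. Freezing b below β/2 makes F bounded and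
  -- continuous across b = 0 and alters only values that the indicator of [β, ∞) discards.
  set β : ℝ := (ν - a)⁻¹ with hβ
  have hνa : 0 < ν - a := sub_pos.2 haν
  have hβ0 : 0 < β := inv_pos.2 hνa
  set F : ℝ → ℂ := fun b => f (a + (max b (β / 2))⁻¹) with hF
  have hFc : Continuous F := by
    refine hf.comp (continuous_const.add (Continuous.inv₀ (by fun_prop) fun b => ?_))
    exact (lt_max_of_lt_right (by positivity)).ne'
  obtain ⟨C, hC⟩ := (isCompact_Icc (a := a) (b := a + (β / 2)⁻¹)).exists_bound_of_continuousOn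
    hf.continuousOn
  have hFC : ∀ b, ‖F b‖ ≤ C := fun b => by
    refine hC _ ⟨?_, ?_⟩
    · have : 0 < max b (β / 2) := lt_max_of_lt_right (by positivity)
      have := inv_pos.2 this
      linarith
    · gcongr
      exact le_max_right _ _
  let g : ℕ → C(spectrum ℂ (shiftedInverse H a), ℂ) := fun n =>
    ⟨fun b => F (b : ℂ).re * (ramp β n (b : ℂ).re : ℝ), by
      have := continuous_ramp β n
      fun_prop⟩
  have hga : ∀ n b, g n b = F (b : ℂ).re * (ramp β n (b : ℂ).re : ℝ) := fun n b => rfl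
  set G : spectrum ℂ (shiftedInverse H a) → ℂ := fun b =>
    (Ici β).indicator F (b : ℂ).re with hG
  have hgC : ∀ n b, ‖g n b‖ ≤ C := fun n b => by
    rw [hga, norm_mul, Complex.norm_real]
    exact (mul_le_of_le_one_right (norm_nonneg _) (norm_ramp_le _ _ _)).trans (hFC _)
  have hgG : ∀ b, Tendsto (fun n => g n b) atTop (𝓝 (G b)) := fun b => by
    rcases le_or_gt β (b : ℂ).re with h | h
    · simp only [hga, hG, ramp_of_le h]
      rw [indicator_of_mem (mem_Ici.2 h)]
      simp
    · simp only [hG]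
      rw [indicator_of_notMem (by simpa using h)]
      refine tendsto_const_nhds.congr' ?_
      filter_upwards [eventually_ramp_of_lt h] with n hn
      rw [hga, hn]; simp
  obtain ⟨T, -, hT⟩ := exists_strong_limit (shiftedCalc hH ha) hgC hgG
  refine ⟨T, fun x => ?_⟩
  have hmeas : Measurable ((Iic ν).indicator f) := hf.measurable.indicator measurableSet_Iic
  have hae : ∀ᵐ b ∂(calcMeasure (shiftedCalc hH ha) x),
      (Iic ν).indicator f (specMap H a b) = G b := by
    filter_upwards [ae_specCoord_ne_zero hH ha x] with b hb
    have hmem : ((specMap H a b : ℝ) : ℂ) ∈ opSpectrum H := by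
      rw [ofReal_specMap hH ha]; exact mem_opSpectrum_of_mem_spectrum ha b.2 hb
    have h1 : 0 < (b : ℂ).re := by
      have := hbelow _ hmem
      rw [Complex.ofReal_re, specMap] at this
      exact inv_pos.1 (by linarith)
    have h2 : specMap H a b ≤ ν ↔ β ≤ (b : ℂ).re := by
      rw [specMap, hβ, inv_le_comm₀ hνa h1, le_sub_iff_add_le']
    simp only [hG]
    by_cases h : specMap H a b ≤ ν
    · rw [indicator_of_mem (mem_Iic.2 h), indicator_of_mem (mem_Ici.2 (h2.1 h))]
      have h3 : max (b : ℂ).re (β / 2) = (b : ℂ).re := max_eq_left (by linarith [h2.1 h])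
      simp only [hF, h3]
      rfl
    · rw [indicator_of_notMem (by simpa using h),
        indicator_of_notMem (by rw [mem_Ici, ← h2]; exact h)]
  have := isFiniteMeasure_spectralMeasure hH ha x
  constructor
  · refine Integrable.of_bound hmeas.aestronglyMeasurable C ?_
    rw [spectralMeasure_eq_pushed hH ha, pushedMeasure, ae_map_iff measurable_specMap.aemeasurable
      (measurableSet_le hmeas.norm measurable_const)]
    filter_upwards [hae] with b hb
    rw [hb]
    refine le_of_tendsto (hgG b).norm (Eventually.of_forall fun n => hgC n b)
  · rw [hT, spectralMeasure_eq_pushed hH ha, pushedMeasure,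
      integral_map measurable_specMap.aemeasurable hmeas.aestronglyMeasurable]
    exact (integral_congr_ae hae).symm

omit [CompleteSpace E] in
lemma isBorelCalculus_borelCalculus {g : ℝ → ℂ} (h : ∃ T, IsBorelCalculus H g T) :
    IsBorelCalculus H g (borelCalculus H g) := by
  rw [borelCalculus, dif_pos h]
  exact h.choose_spec

open Classical in
/-- The Borel calculus depends only on the values of the function on the spectrum. -/
lemma borelCalculus_congr {g g' : ℝ → ℂ}
    (h : ∀ x, g =ᵐ[spectralMeasure H x] g') : borelCalculus H g = borelCalculus H g' := by
  have : IsBorelCalculus H g = IsBorelCalculus H g' := by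
    ext T
    refine forall_congr' fun x => and_congr (integrable_congr (h x)) ?_
    rw [integral_congr_ae (h x)]
  have key : ∀ P Q : (E →L[ℂ] E) → Prop, P = Q →
      (if h : ∃ T, P T then h.choose else 0) = if h : ∃ T, Q T then h.choose else 0 := by
    rintro P _ rfl; rfl
  exact key _ _ this

end BorelCalculus

/-! ### The perturbation determinant -/

/-- The standing hypotheses, in the form in which they are used. -/
structure PerturbationData (H : E →ₗ.[ℂ] E) (V J : E →L[ℂ] E) : Prop where
  selfAdjoint : IsSelfAdjoint H
  selfAdjointV : IsSelfAdjoint V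
  sign : IsRollnikSign V J
  exists_below : ∃ a : ℝ, IsBelowSpectra H V a
  exists_traceClass : ∃ w : ℂ, w.im ≠ 0 ∧ IsHS (sqrtAbs V * opResolvent H w) ∧
    IsTraceClass (birmanSchwinger H V J w)

section Joint

variable {H : E →ₗ.[ℂ] E} {V : E →L[ℂ] E} {z : ℂ}

lemma notMem_left (hz : z ∉ jointSpectrum H V) : z ∉ opSpectrum H := fun h => hz (Or.inl h)

lemma notMem_right (hz : z ∉ jointSpectrum H V) : z ∉ opSpectrum (perturbed H V) :=
  fun h => hz (Or.inr h)

lemma isOpen_compl_jointSpectrum : IsOpen (jointSpectrum H V)ᶜ := by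
  rw [jointSpectrum, compl_union]
  exact isOpen_compl_opSpectrum.inter isOpen_compl_opSpectrum

end Joint

namespace PerturbationData

variable {H : E →ₗ.[ℂ] E} {V J : E →L[ℂ] E} (h : PerturbationData H V J)

include h

lemma selfAdjoint' : IsSelfAdjoint (perturbed H V) :=
  isSelfAdjoint_perturbed h.selfAdjoint h.selfAdjointV

lemma notMem_of_im_ne_zero {z : ℂ} (hz : z.im ≠ 0) : z ∉ jointSpectrum H V := fun hm =>
  hm.elim (notMem_opSpectrum_of_im_ne_zero h.selfAdjoint hz)
    (notMem_opSpectrum_of_im_ne_zero h.selfAdjoint' hz)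

lemma isHS_left {z : ℂ} (hz : z ∉ opSpectrum H) : IsHS (sqrtAbs V * opResolvent H z) := by
  obtain ⟨w, hw, hHS, -⟩ := h.exists_traceClass
  have hw' := notMem_opSpectrum_of_im_ne_zero h.selfAdjoint hw
  have : sqrtAbs V * opResolvent H z =
      sqrtAbs V * opResolvent H w * (1 + (w - z) • opResolvent H z) := by
    have h1 := opResolvent_sub hz hw'
    rw [mul_assoc, mul_add, mul_one, mul_smul_comm, opResolvent_commute hw' hz, ← h1]
    congr 1
    abel
  rw [this]
  exact hHS.mul_right _

lemma isHS_right {z : ℂ} (hz : z ∉ opSpectrum H) : IsHS (opResolvent H z * sqrtAbs V) := by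
  have h1 := (h.isHS_left (conj_notMem_opSpectrum h.selfAdjoint hz)).adjoint
  rwa [star_mul, (isSelfAdjoint_sqrtAbs V).star_eq, star_opResolvent h.selfAdjoint
    (conj_notMem_opSpectrum h.selfAdjoint hz), Complex.conj_conj] at h1

/-- By the resolvent identity K(z) - K(w) is a multiple of √|V| R(z) · R(w) √|V| · J, and the first
two blocks are Hilbert–Schmidt. One point w therefore suffices. -/
lemma isTraceClass_birmanSchwinger {z : ℂ} (hz : z ∉ opSpectrum H) :
    IsTraceClass (birmanSchwinger H V J z) := by
  obtain ⟨w, hw, -, hK⟩ := h.exists_traceClass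
  have hw' := notMem_opSpectrum_of_im_ne_zero h.selfAdjoint hw
  have : birmanSchwinger H V J z = birmanSchwinger H V J w +
      (w - z) • ((sqrtAbs V * opResolvent H z) * (opResolvent H w * sqrtAbs V) * J) := by
    have h1 : opResolvent H z = opResolvent H w +
        (w - z) • (opResolvent H z * opResolvent H w) := by
      rw [← opResolvent_sub hz hw']; abel
    rw [birmanSchwinger]
    conv_lhs => rw [h1]
    rw [birmanSchwinger]
    simp only [mul_add, add_mul, mul_smul_comm, smul_mul_assoc, mul_assoc]
  rw [this]
  exact hK.add ((((h.isHS_left hz).mul (h.isHS_right hw')).mul_right J).smul _)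

omit h in
/-- The inverse of `1 - K(z)`. -/
def bsInverse (H : E →ₗ.[ℂ] E) (V J : E →L[ℂ] E) (z : ℂ) : E →L[ℂ] E :=
  1 + sqrtAbs V * opResolvent (perturbed H V) z * sqrtAbs V * J

/-- This is the second resolvent identity with V = √|V| J √|V|, sandwiched between √|V| and √|V| J.
-/
lemma one_sub_mul_bsInverse {z : ℂ} (hz : z ∉ jointSpectrum H V) :
    (1 - birmanSchwinger H V J z) * bsInverse H V J z = 1 := by
  have h1 := resolventDiff_eq (notMem_left hz) (notMem_right hz)
  set S := sqrtAbs V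
  set R := opResolvent H z
  set R' := opResolvent (perturbed H V) z
  have h2 : R * (S * J * S) * R' = R' - R := by rw [← h.sign.factorization, ← h1]; rfl
  calc (1 - S * R * S * J) * (1 + S * R' * S * J)
      = 1 + S * (R' - R - R * (S * J * S) * R') * S * J := by noncomm_ring
    _ = 1 := by rw [h2]; simp

lemma sqrtAbs_mul_resolvent_perturbed {z : ℂ} (hz : z ∉ jointSpectrum H V) :
    sqrtAbs V * opResolvent (perturbed H V) z =
      bsInverse H V J z * (sqrtAbs V * opResolvent H z) := by
  have h1 := resolventDiff_eq' (notMem_left hz) (notMem_right hz)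
  rw [bsInverse]
  set S := sqrtAbs V
  set R := opResolvent H z
  set R' := opResolvent (perturbed H V) z
  have h2 : R' * (S * J * S) * R = R' - R := by rw [← h.sign.factorization, ← h1]; rfl
  calc S * R' = S * (R + (R' - R)) := by congr 1; abel
    _ = S * (R + R' * (S * J * S) * R) := by rw [h2]
    _ = (1 + S * R' * S * J) * (S * R) := by noncomm_ring

/-- The difference is exhibited as a product of two Hilbert–Schmidt operators. It is therefore of
trace class off the joint spectrum, and the two factors can be exchanged under the trace in the
derivative of Δ. -/
lemma resolventDiff_eq_mul {z : ℂ} (hz : z ∉ jointSpectrum H V) :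
    resolventDiff H V z = (opResolvent H z * sqrtAbs V * J) *
      (bsInverse H V J z * (sqrtAbs V * opResolvent H z)) := by
  rw [resolventDiff_eq (notMem_left hz) (notMem_right hz), ← h.sqrtAbs_mul_resolvent_perturbed hz]
  set S := sqrtAbs V
  set R := opResolvent H z
  set R' := opResolvent (perturbed H V) z
  calc R * V * R' = R * (S * J * S) * R' := by rw [← h.sign.factorization]
    _ = R * S * J * (S * R') := by simp only [mul_assoc]

lemma isTraceClass_resolventDiff {z : ℂ} (hz : z ∉ jointSpectrum H V) :
    IsTraceClass (resolventDiff H V z) := by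
  rw [h.resolventDiff_eq_mul hz]
  exact ((h.isHS_right (notMem_left hz)).mul_right J).mul ((h.isHS_left (notMem_left hz)).mul_left _)

omit h in
open Classical in
lemma fredholmDet_zero : fredholmDet (0 : E →L[ℂ] E) = 1 := by
  have h0 : IsTraceClass (0 : E →L[ℂ] E) :=
    isTraceClass_of_bound (C := 0) fun W _ s => by simp
  refine tendsto_nhds_unique h0.tendsto_detSection ?_
  have : ∀ s, detSection (0 : E →L[ℂ] E) s = 1 := fun s => by
    have : finSection (0 : E →L[ℂ] E) s = 0 := by ext i j; simp [finSection]
    rw [detSection, this, add_zero, Matrix.det_one]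
  exact tendsto_const_nhds.congr fun s => (this s).symm

/-- The inverse of 1 - K(z) is the identity plus a trace class operator, and multiplicativity makes
its determinant the reciprocal of Δ(z). -/
lemma perturbationDet_ne_zero {z : ℂ} (hz : z ∉ jointSpectrum H V) :
    perturbationDet H V J z ≠ 0 := by
  have hK := h.isTraceClass_birmanSchwinger (notMem_left hz)
  have hM : IsTraceClass (bsInverse H V J z - 1) := by
    have : bsInverse H V J z - 1 = bsInverse H V J z * birmanSchwinger H V J z := by
      have h1 := h.sqrtAbs_mul_resolvent_perturbed hz
      calc bsInverse H V J z - 1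
          = sqrtAbs V * opResolvent (perturbed H V) z * sqrtAbs V * J := by rw [bsInverse]; abel
        _ = _ := by rw [h1, birmanSchwinger]; noncomm_ring
    rw [this]
    exact hK.mul_left _
  have h1 := hK.neg.fredholmDet_mul hM
  have h2 : -birmanSchwinger H V J z + (bsInverse H V J z - 1) +
      -birmanSchwinger H V J z * (bsInverse H V J z - 1) = 0 := by
    have h3 := h.one_sub_mul_bsInverse hz
    calc _ = (1 - birmanSchwinger H V J z) * bsInverse H V J z - 1 := by noncomm_ring
      _ = 0 := by rw [h3, sub_self]
  rw [h2, fredholmDet_zero] at h1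
  exact left_ne_zero_of_mul (h1 ▸ one_ne_zero)

omit h in
/-- Derivative at the base point of `det (1 + (z - z₀) X (1 + (z₀ - z) R(z)) Y)`. -/
lemma hasDerivAt_fredholmDet {X Y : E →L[ℂ] E} (hX : IsHS X) (hY : IsHS Y) {R : ℂ → E →L[ℂ] E}
    {z₀ : ℂ} (hR : ContinuousAt R z₀) :
    HasDerivAt (fun z => fredholmDet ((z - z₀) • (X * (1 + (z₀ - z) • R z) * Y)))
      (trace (X * Y)) z₀ := by
  set c := hsNorm X * hsNorm Y with hc
  have hc0 : 0 ≤ c := mul_nonneg (hsNorm_nonneg _) (hsNorm_nonneg _)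
  obtain ⟨ρ, hρ⟩ : ∃ ρ : ℝ, ∀ᶠ z in 𝓝 z₀, ‖R z‖ ≤ ρ :=
    ⟨‖R z₀‖ + 1, hR.norm.eventually_le_const (by simp)⟩
  have hρ0 : 0 ≤ ρ := by
    obtain ⟨z, hz⟩ := hρ.exists
    exact (norm_nonneg _).trans hz
  have hdist : Tendsto (fun z : ℂ => ‖z - z₀‖) (𝓝 z₀) (𝓝 0) := by
    have : Continuous fun w : ℂ => ‖w - z₀‖ := by fun_prop
    simpa using this.tendsto z₀
  -- For |z - z₀| < 1 the trace norm of the operator multiplying z - z₀ is at most c₁; the extra 1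
  -- keeps c₁ positive. The second order determinant bound is used with τ = |z - z₀| c₁, so the
  -- remainder is quadratic in z - z₀.
  set c₁ := c * (1 + ρ) + 1 with hc₁
  have hc₁0 : 0 < c₁ := by positivity
  have hsmall : ∀ᶠ z in 𝓝 z₀, ‖z - z₀‖ < min 1 (c₁⁻¹) :=
    hdist.eventually_lt_const (by positivity)
  rw [hasDerivAt_iff_isLittleO]
  refine Asymptotics.IsBigO.trans_isLittleO (g := fun z => ‖z - z₀‖ ^ 2)
    (Asymptotics.IsBigO.of_bound ((Real.exp 2 + 2) * c₁ ^ 2 + ρ * c) ?_) ?_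
  · filter_upwards [hρ, hsmall] with z hz hzs
    have hz1 : ‖z - z₀‖ < 1 := hzs.trans_le (min_le_left _ _)
    have hzc : ‖z - z₀‖ * c₁ < 1 := by
      have := hzs.trans_le (min_le_right _ _)
      calc ‖z - z₀‖ * c₁ < c₁⁻¹ * c₁ := by gcongr
        _ = 1 := inv_mul_cancel₀ hc₁0.ne'
    set A := X * (1 + (z₀ - z) • R z) * Y with hA
    have hXR := hX.mul_right (R z)
    have hsplit : A = X * Y + (z₀ - z) • ((X * R z) * Y) := by
      rw [hA, mul_add, mul_one, add_mul, mul_smul_comm, smul_mul_assoc]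
    have hXY := hX.mul hY
    have hXRY := hXR.mul hY
    have hAt : IsTraceClass A := by rw [hsplit]; exact hXY.add (hXRY.smul _)
    have hn1 : trNorm ((X * R z) * Y) ≤ ρ * c := by
      refine (hXR.trNorm_mul_le hY).trans ?_
      calc hsNorm (X * R z) * hsNorm Y ≤ (hsNorm X * ‖R z‖) * hsNorm Y :=
            mul_le_mul_of_nonneg_right (hX.hsNorm_mul_right_le _) (hsNorm_nonneg _)
        _ = ‖R z‖ * c := by rw [hc]; ring
        _ ≤ ρ * c := by gcongr
    have hAn : trNorm A ≤ c₁ := by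
      rw [hsplit]
      refine (hXY.trNorm_add_le (hXRY.smul _)).trans ?_
      have h2 := (hXRY.trNorm_smul_le (z₀ - z))
      rw [norm_sub_rev] at h2
      have h3 : ‖z - z₀‖ * trNorm ((X * R z) * Y) ≤ 1 * (ρ * c) :=
        mul_le_mul hz1.le hn1 (trNorm_nonneg _) zero_le_one
      have h4 := hX.trNorm_mul_le hY
      rw [hc₁]
      linarith
    rw [Real.norm_of_nonneg (by positivity : 0 ≤ ‖z - z₀‖ ^ 2)]
    rcases eq_or_ne z z₀ with rfl | hne
    · simp
    have hzpos : 0 < ‖z - z₀‖ := norm_pos_iff.2 (sub_ne_zero.2 hne)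
    have h5 := (hAt.smul (z - z₀)).norm_fredholmDet_sub_le (τ := ‖z - z₀‖ * c₁) (by positivity) hzc
      ((hAt.trNorm_smul_le _).trans (by gcongr))
    have h6 : trace A = trace (X * Y) + (z₀ - z) * trace ((X * R z) * Y) := by
      rw [hsplit, hXY.trace_add (hXRY.smul _), trace_smul]
    have h7 : ‖trace ((X * R z) * Y)‖ ≤ ρ * c := hXRY.norm_trace_le.trans hn1
    rw [trace_smul, h6] at h5
    simp only [sub_self, zero_smul, fredholmDet_zero, smul_eq_mul]
    calc ‖fredholmDet ((z - z₀) • A) - 1 - (z - z₀) * trace (X * Y)‖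
        = ‖(fredholmDet ((z - z₀) • A) - 1 -
            (z - z₀) * (trace (X * Y) + (z₀ - z) * trace ((X * R z) * Y))) +
            (z - z₀) * ((z₀ - z) * trace ((X * R z) * Y))‖ := by congr 1; ring
      _ ≤ (Real.exp 2 + 2) * (‖z - z₀‖ * c₁) ^ 2 + ‖z - z₀‖ * (‖z - z₀‖ * (ρ * c)) := by
          refine (norm_add_le _ _).trans (add_le_add h5 ?_)
          rw [norm_mul, norm_mul, norm_sub_rev z₀ z]
          gcongr
      _ = _ := by ring
  · refine Asymptotics.IsLittleO.of_norm_right ?_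
    have := (Asymptotics.isLittleO_one_iff ℝ).2 hdist
    simpa [sq] using this.mul_isBigO (Asymptotics.isBigO_refl (fun z => ‖z - z₀‖) (𝓝 z₀))

/-- Factor 1 - K(z) = (1 - K(z₀))(1 + B(z)) with B(z) = (1 - K(z₀))⁻¹ (K(z₀) - K(z)).
Multiplicativity leaves det(1 + B) to be differentiated at z₀, where B vanishes. Its linear
coefficient is X Y with X = (1 - K(z₀))⁻¹ √|V| R(z₀) and Y = R(z₀) √|V| J, and tr(X Y) = tr(Y X) =
tr(R_V(z₀) - R(z₀)). -/
lemma hasDerivAt_perturbationDet {z₀ : ℂ} (hz₀ : z₀ ∉ jointSpectrum H V) :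
    HasDerivAt (perturbationDet H V J)
      (perturbationDet H V J z₀ * trace (resolventDiff H V z₀)) z₀ := by
  have hz₀l := notMem_left hz₀
  set S := sqrtAbs V with hS
  set M := bsInverse H V J z₀ with hM
  set X := M * (S * opResolvent H z₀) with hX
  set Y := opResolvent H z₀ * S * J with hY
  have hXh : IsHS X := (h.isHS_left hz₀l).mul_left _
  have hYh : IsHS Y := (h.isHS_right hz₀l).mul_right _
  have hd := (hasDerivAt_fredholmDet hXh hYh (continuousAt_opResolvent hz₀l)).const_mul
    (perturbationDet H V J z₀)
  have htr : trace (X * Y) = trace (resolventDiff H V z₀) := by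
    rw [hXh.trace_mul_comm hYh, h.resolventDiff_eq_mul hz₀]
  rw [htr] at hd
  refine hd.congr_of_eventuallyEq ?_
  filter_upwards [isOpen_compl_jointSpectrum.mem_nhds hz₀] with z hz
  have hzl := notMem_left hz
  have hAt := (h.isTraceClass_birmanSchwinger hz₀l).neg
  have hres : (1 + (z₀ - z) • opResolvent H z) * opResolvent H z₀ = opResolvent H z := by
    rw [add_mul, one_mul, smul_mul_assoc, ← opResolvent_sub hzl hz₀l]; abel
  set B := (z - z₀) • (X * (1 + (z₀ - z) • opResolvent H z) * Y) with hB
  have hBt : IsTraceClass B := ((hXh.mul_right _).mul hYh).smul _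
  have hB2 : B = M * (birmanSchwinger H V J z₀ - birmanSchwinger H V J z) := by
    have h1 : X * (1 + (z₀ - z) • opResolvent H z) * Y =
        M * (S * (opResolvent H z₀ * opResolvent H z) * S * J) := by
      calc M * (S * opResolvent H z₀) * (1 + (z₀ - z) • opResolvent H z) *
            (opResolvent H z₀ * S * J)
          = M * (S * (opResolvent H z₀ * ((1 + (z₀ - z) • opResolvent H z) *
              opResolvent H z₀)) * S * J) := by simp only [mul_assoc]
        _ = _ := by rw [hres]
    rw [hB, h1, birmanSchwinger, birmanSchwinger, ← hS]
    have h2 := opResolvent_sub hz₀l hzl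
    calc (z - z₀) • (M * (S * (opResolvent H z₀ * opResolvent H z) * S * J))
        = M * (S * ((z - z₀) • (opResolvent H z₀ * opResolvent H z)) * S * J) := by
          simp only [mul_smul_comm, smul_mul_assoc]
      _ = _ := by rw [← h2]; noncomm_ring
  rw [perturbationDet, perturbationDet, ← hAt.fredholmDet_mul hBt]
  congr 1
  have h3 := h.one_sub_mul_bsInverse hz₀
  calc -birmanSchwinger H V J z
      = -birmanSchwinger H V J z₀ + 1 * (birmanSchwinger H V J z₀ - birmanSchwinger H V J z) := by
        rw [one_mul]; abel
    _ = -birmanSchwinger H V J z₀ + B + -birmanSchwinger H V J z₀ * B := by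
        rw [← h3, hB2]; noncomm_ring

lemma star_resolventDiff {z : ℂ} (hz : z ∉ jointSpectrum H V) :
    star (resolventDiff H V z) = resolventDiff H V (starRingEnd ℂ z) := by
  rw [resolventDiff, star_sub, star_opResolvent h.selfAdjoint (notMem_left hz),
    star_opResolvent h.selfAdjoint' (notMem_right hz), resolventDiff]

lemma trace_resolventDiff_conj {z : ℂ} (hz : z ∉ jointSpectrum H V) :
    trace (resolventDiff H V (starRingEnd ℂ z)) =
      starRingEnd ℂ (trace (resolventDiff H V z)) := by
  rw [← h.star_resolventDiff hz, trace_star]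

end PerturbationData

/-! ### The perturbation determinant near `-∞` -/

lemma IsBelowSpectra.notMem {H : E →ₗ.[ℂ] E} {V : E →L[ℂ] E} {a : ℝ} (ha : IsBelowSpectra H V a)
    {x : ℝ} (hx : x ≤ a) : (x : ℂ) ∉ jointSpectrum H V := fun hm => by
  have := ha _ hm
  rw [Complex.ofReal_re] at this
  linarith

lemma IsBelowSpectra.mono {H : E →ₗ.[ℂ] E} {V : E →L[ℂ] E} {a : ℝ} (ha : IsBelowSpectra H V a)
    {x : ℝ} (hx : x ≤ a) : IsBelowSpectra H V x := fun w hw => hx.trans_lt (ha w hw)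

lemma le_re_of_mem_opSpectrum {H : E →ₗ.[ℂ] E} (hH : IsSelfAdjoint H) {m : ℝ}
    (hm : ∀ x : H.domain, m * ‖(x : E)‖ ^ 2 ≤ (⟪(x : E), H x⟫_ℂ).re) {w : ℂ}
    (hw : w ∈ opSpectrum H) : m ≤ w.re := by
  by_contra! hlt
  have h1 : w.im = 0 := by
    by_contra h
    exact notMem_opSpectrum_of_im_ne_zero hH h hw
  have h2 : w = (w.re : ℂ) := Complex.ext rfl (by simp [h1])
  rw [h2] at hw
  exact notMem_opSpectrum_of_lt hH hm hlt hw

lemma exists_isBelowSpectra {H : E →ₗ.[ℂ] E} {V : E →L[ℂ] E} (hH : IsSelfAdjoint H)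
    (hV : IsSelfAdjoint V) (hHb : SemiboundedBelow H) (hVb : SemiboundedBelow (perturbed H V)) :
    ∃ a : ℝ, IsBelowSpectra H V a := by
  obtain ⟨m, hm⟩ := hHb
  obtain ⟨m', hm'⟩ := hVb
  refine ⟨min m m' - 1, fun w hw => ?_⟩
  rcases hw with hw | hw
  · have := le_re_of_mem_opSpectrum hH hm hw
    linarith [min_le_left m m']
  · have := le_re_of_mem_opSpectrum (isSelfAdjoint_perturbed hH hV) hm' hw
    linarith [min_le_right m m']

lemma IsTraceClass.isHS_of_star_mul_self {Y : E →L[ℂ] E} (h : IsTraceClass (star Y * Y)) :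
    IsHS Y := by
  refine isHS_of_sum_le (C := trNorm (star Y * Y)) fun s => ?_
  refine le_trans (le_of_eq ?_) (h.sum_norm_diag_le s)
  refine Finset.sum_congr rfl fun i _ => ?_
  rw [op_mul_apply, inner_star_right, inner_self_eq_ofReal, Complex.norm_real,
    Real.norm_of_nonneg (by positivity)]

/-- The hypothesis on K at the single point w = ν + i is enough. Multiplying by J removes the sign,
so S R(w) S and its adjoint are of trace class, where S = √|V|. By the resolvent identity their
difference is a nonzero multiple of (R(w) S)* (R(w) S), hence R(w) S is Hilbert–Schmidt. Taking
adjoints gives S R(conj w), and one more resolvent identity gives S R(w). -/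
lemma perturbationData_of_traceClassAbove {H : E →ₗ.[ℂ] E} {V J : E →L[ℂ] E}
    (hH : IsSelfAdjoint H) (hV : IsSelfAdjoint V) (hJ : IsRollnikSign V J)
    (hHb : SemiboundedBelow H) (hVb : SemiboundedBelow (perturbed H V)) {ν : ℝ}
    (h : TraceClassAbove H V J ν) : PerturbationData H V J := by
  refine ⟨hH, hV, hJ, exists_isBelowSpectra hH hV hHb hVb, ?_⟩
  set w : ℂ := ν + (1 : ℝ) * Complex.I with hw
  have him : w.im = 1 := by simp [hw]
  have hwim : w.im ≠ 0 := by rw [him]; exact one_ne_zero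
  have hK := h.birmanSchwinger_mem 1 one_pos
  rw [← hw] at hK
  have hwn := notMem_opSpectrum_of_im_ne_zero hH hwim
  have hwc := conj_notMem_opSpectrum hH hwn
  set S := sqrtAbs V with hS
  have hSs : star S = S := (isSelfAdjoint_sqrtAbs V).star_eq
  set R := opResolvent H w with hR
  set R' := opResolvent H (starRingEnd ℂ w) with hR'
  have hRs : star R = R' := star_opResolvent hH hwn
  have hM : IsTraceClass (S * R * S) := by
    have h1 := hK.mul_right J
    rwa [birmanSchwinger, mul_assoc _ J J, hJ.sq_eq_one, mul_one] at h1
  have hM' : IsTraceClass (S * R' * S) := by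
    have h1 : S * R' * S = star (S * R * S) := by
      simp only [star_mul, hSs, hRs, mul_assoc]
    rw [h1]
    refine isTraceClass_of_bound (C := trNorm (S * R * S)) fun W hW s => ?_
    have h2 := hM.sum_norm_inner_le 1 W s
    refine (norm_sum_le _ _).trans ((le_of_eq ?_).trans (h2.trans ?_))
    · refine Finset.sum_congr rfl fun i _ => ?_
      rw [inner_star_right, norm_inner_symm]
      rfl
    · have h3 : ‖(1 : E →L[ℂ] E)‖ ≤ 1 := ContinuousLinearMap.norm_id_le
      exact mul_le_of_le_one_left (trNorm_nonneg _) (mul_le_one₀ h3 (norm_nonneg _) hW)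
  have hne : starRingEnd ℂ w - w ≠ 0 := fun h0 => by
    have := congrArg Complex.im h0
    simp [him] at this
    norm_num at this
  have hY : IsTraceClass (star (R * S) * (R * S)) := by
    have h1 : star (R * S) * (R * S) = (w - starRingEnd ℂ w)⁻¹ • (S * R' * S - S * R * S) := by
      have h2 := opResolvent_sub hwc hwn
      have h3 : S * R' * S - S * R * S = S * (R' - R) * S := by noncomm_ring
      rw [h3, h2, mul_smul_comm, smul_mul_assoc, smul_smul, inv_mul_cancel₀, one_smul, star_mul,
        hSs, hRs]
      · simp only [mul_assoc]
        rfl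
      · rw [← neg_sub]
        exact neg_ne_zero.2 hne
    rw [h1]
    exact (hM'.sub hM).smul _
  have hHS := hY.isHS_of_star_mul_self.adjoint
  rw [star_mul, hSs, hRs] at hHS
  refine ⟨w, hwim, ?_, hK⟩
  have : S * R = S * R' * (1 + (starRingEnd ℂ w - w) • R) := by
    have h1 := opResolvent_sub hwn hwc
    rw [mul_assoc, mul_add, mul_one, mul_smul_comm, opResolvent_commute hwc hwn, ← h1]
    congr 1
    abel
  rw [this]
  exact hHS.mul_right _

/-! ### Quadratic forms of the resolvent below the spectrum. -/

section Below

variable {H : E →ₗ.[ℂ] E} (hH : IsSelfAdjoint H) {a : ℝ} (ha : ∀ w ∈ opSpectrum H, a < w.re)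

include ha in
lemma notMem_of_below {x : ℝ} (hx : x ≤ a) : (x : ℂ) ∉ opSpectrum H := fun hm => by
  have := ha _ hm
  rw [Complex.ofReal_re] at this
  linarith

include hH ha in
lemma ae_lt_spectralMeasure (y : E) : ∀ᵐ t ∂(spectralMeasure H y), a < t := by
  filter_upwards [ae_spectralMeasure_mem hH (notMem_of_below ha le_rfl) y] with t ht
  simpa using ha _ ht

include hH ha in
lemma inner_opResolvent_below {x : ℝ} (hx : x ≤ a) (y : E) :
    ⟪y, opResolvent H x y⟫_ℂ = ((-∫ t, (t - x)⁻¹ ∂(spectralMeasure H y) : ℝ) : ℂ) := by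
  rw [inner_opResolvent_eq hH (notMem_of_below ha le_rfl) (notMem_of_below ha hx),
    ← integral_neg, ← integral_complex_ofReal]
  congr 1; ext t
  push_cast
  rw [← inv_neg, neg_sub]

include hH ha in
lemma integrable_inv_sub_below {x : ℝ} (hx : x < a) (y : E) :
    Integrable (fun t => (t - x)⁻¹) (spectralMeasure H y) := by
  have := isFiniteMeasure_spectralMeasure hH (notMem_of_below ha le_rfl) y
  refine Integrable.of_bound (C := (a - x)⁻¹)
    (by fun_prop : Measurable fun t : ℝ => (t - x)⁻¹).aestronglyMeasurable ?_
  filter_upwards [ae_lt_spectralMeasure hH ha y] with t ht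
  rw [Real.norm_of_nonneg (inv_nonneg.2 (by linarith))]
  exact inv_anti₀ (by linarith) (by linarith)

include hH ha in
lemma integral_inv_sub_nonneg {x : ℝ} (hx : x ≤ a) (y : E) :
    0 ≤ ∫ t, (t - x)⁻¹ ∂(spectralMeasure H y) := by
  refine integral_nonneg_of_ae ?_
  filter_upwards [ae_lt_spectralMeasure hH ha y] with t ht
  exact inv_nonneg.2 (by linarith)

include hH ha in
lemma integral_inv_sub_mono {x x' : ℝ} (hx : x ≤ x') (hx' : x' < a) (y : E) :
    ∫ t, (t - x)⁻¹ ∂(spectralMeasure H y) ≤ ∫ t, (t - x')⁻¹ ∂(spectralMeasure H y) := by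
  refine integral_mono_ae (integrable_inv_sub_below hH ha (hx.trans_lt hx') y)
    (integrable_inv_sub_below hH ha hx' y) ?_
  filter_upwards [ae_lt_spectralMeasure hH ha y] with t ht
  exact inv_anti₀ (by linarith) (by linarith)

include hH ha in
lemma tendsto_integral_inv_sub (y : E) :
    Tendsto (fun x : ℝ => ∫ t, (t - x)⁻¹ ∂(spectralMeasure H y)) atBot (𝓝 0) := by
  have := isFiniteMeasure_spectralMeasure hH (notMem_of_below ha le_rfl) y
  have h1 : Tendsto (fun x : ℝ => (a - x)⁻¹ * (spectralMeasure H y).real univ) atBot (𝓝 0) := by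
    have : Tendsto (fun x : ℝ => a - x) atBot atTop := tendsto_atTop_add_const_left _ _
      tendsto_neg_atBot_atTop
    simpa using (tendsto_inv_atTop_zero.comp this).mul_const ((spectralMeasure H y).real univ)
  refine squeeze_zero' ?_ ?_ h1
  · filter_upwards [eventually_le_atBot a] with x hx using integral_inv_sub_nonneg hH ha hx y
  · filter_upwards [eventually_lt_atBot a] with x hx
    calc ∫ t, (t - x)⁻¹ ∂(spectralMeasure H y) ≤ ∫ t, (a - x)⁻¹ ∂(spectralMeasure H y) := by
          refine integral_mono_ae (integrable_inv_sub_below hH ha hx y) (integrable_const _) ?_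
          filter_upwards [ae_lt_spectralMeasure hH ha y] with t ht
          exact inv_anti₀ (by linarith) (by linarith)
      _ = _ := by rw [integral_const, smul_eq_mul, mul_comm]

end Below

namespace PerturbationData

variable {H : E →ₗ.[ℂ] E} {V J : E →L[ℂ] E} (h : PerturbationData H V J)

include h

/-- For real x below the spectrum -S R(x) S is nonnegative, S = √|V|, so its trace norm is its
trace, the sum over the basis of ∫ (t - x)⁻¹ dμ at the vectors S e_i. Each term tends to 0 as x → -∞
and increases with x; the summable values at a - 1 dominate. -/
lemma tendsto_trNorm_birmanSchwinger :
    Tendsto (fun x : ℝ => trNorm (birmanSchwinger H V J x)) atBot (𝓝 0) := by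
  obtain ⟨a, ha⟩ := h.exists_below
  have ha' : ∀ w ∈ opSpectrum H, a < w.re := fun w hw => ha w (Or.inl hw)
  have hH := h.selfAdjoint
  set S := sqrtAbs V with hS
  set q : ℝ → E → ℝ := fun x y => ∫ t, (t - x)⁻¹ ∂(spectralMeasure H (S y)) with hq
  have hinner : ∀ x ≤ a, ∀ y, ⟪y, (-(S * opResolvent H x * S)) y⟫_ℂ = (q x y : ℂ) := by
    intro x hx y
    rw [neg_apply, op_mul_apply, op_mul_apply, inner_neg_right,
      ← IsSelfAdjoint.inner_map (isSelfAdjoint_sqrtAbs V), ← hS,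
      inner_opResolvent_below hH ha' hx, Complex.ofReal_neg, neg_neg]
  have habs : ∀ x ≤ a, CFC.abs (-(S * opResolvent H x * S)) = -(S * opResolvent H x * S) := by
    intro x hx
    refine CFC.abs_of_nonneg _ ?_
    rw [ContinuousLinearMap.nonneg_iff_isPositive, ContinuousLinearMap.isPositive_iff_complex]
    intro y
    have h1 : ⟪(-(S * opResolvent H x * S)) y, y⟫_ℂ = (q x y : ℂ) := by
      rw [← inner_conj_symm, hinner x hx y, Complex.conj_ofReal]
    rw [h1]
    exact ⟨by simp, by simpa using integral_inv_sub_nonneg hH ha' hx _⟩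
  have htn : ∀ x < a, trNorm (-(S * opResolvent H x * S)) = ∑' i, q x (basis E i) := by
    intro x hx
    rw [trNorm, traceNorm, habs x hx.le, ENNReal.tsum_toReal_eq fun i => ENNReal.ofReal_ne_top]
    congr 1; ext i
    rw [hinner x hx.le, Complex.ofReal_re,
      ENNReal.toReal_ofReal (integral_inv_sub_nonneg hH ha' hx.le _)]
  have htc : ∀ x ≤ a, IsTraceClass (-(S * opResolvent H x * S)) := by
    intro x hx
    have h1 := (h.isTraceClass_birmanSchwinger (notMem_of_below ha' hx)).mul_right J
    rw [birmanSchwinger, mul_assoc _ J J, h.sign.sq_eq_one, mul_one] at h1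
    exact h1.neg
  have hlim : Tendsto (fun x : ℝ => ∑' i, q x (basis E i)) atBot (𝓝 0) := by
    rw [← tsum_zero (α := ℝ) (β := BasisIndex E)]
    refine tendsto_tsum_of_dominated_convergence (bound := fun i => q (a - 1) (basis E i)) ?_
      (fun i => tendsto_integral_inv_sub hH ha' _) ?_
    · have h1 := (htc (a - 1) (by linarith)).summable_norm_diag
      refine h1.congr fun i => ?_
      rw [hinner _ (by linarith), Complex.norm_real, Real.norm_of_nonneg]
      exact integral_inv_sub_nonneg hH ha' (by linarith) _
    · filter_upwards [eventually_le_atBot (a - 1)] with x hx i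
      rw [Real.norm_of_nonneg (integral_inv_sub_nonneg hH ha' (by linarith) _)]
      exact integral_inv_sub_mono hH ha' hx (by linarith) _
  have hlim' := hlim.mul_const ‖-J‖
  rw [zero_mul] at hlim'
  refine squeeze_zero' (Eventually.of_forall fun x => trNorm_nonneg _) ?_ hlim'
  filter_upwards [eventually_lt_atBot a] with x hx
  rw [← htn x hx]
  have : birmanSchwinger H V J x = -(S * opResolvent H x * S) * -J := by
    rw [neg_mul_neg, birmanSchwinger]
  rw [this]
  exact (htc x hx.le).trNorm_mul_right_le _

lemma tendsto_perturbationDet :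
    Tendsto (fun x : ℝ => perturbationDet H V J x) atBot (𝓝 1) := by
  obtain ⟨a, ha⟩ := h.exists_below
  rw [Metric.tendsto_nhds]
  intro ε hε
  set c := Real.exp 2 + 2 + 1 with hc
  have hc0 : 0 < c := by positivity
  obtain ⟨τ, hτ, hτ1, hτε⟩ : ∃ τ : ℝ, 0 < τ ∧ τ < 1 ∧ c * τ < ε := by
    refine ⟨min (1 / 2) (ε / (2 * c)), by positivity,
      (min_le_left _ _).trans_lt (by norm_num), ?_⟩
    calc c * min (1 / 2) (ε / (2 * c)) ≤ c * (ε / (2 * c)) := by gcongr; exact min_le_right _ _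
      _ = ε / 2 := by field_simp
      _ < ε := by linarith
  filter_upwards [h.tendsto_trNorm_birmanSchwinger.eventually_le_const hτ,
    eventually_le_atBot a] with x hx hxa
  have hK := (h.isTraceClass_birmanSchwinger (notMem_left (ha.notMem hxa))).neg
  have hKn : trNorm (-birmanSchwinger H V J x) ≤ τ :=
    ((h.isTraceClass_birmanSchwinger (notMem_left (ha.notMem hxa))).trNorm_neg_le).trans hx
  have h1 := hK.norm_fredholmDet_sub_le hτ hτ1 hKn
  have h2 := hK.norm_trace_le.trans hKn
  rw [dist_eq_norm, perturbationDet]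
  refine lt_of_le_of_lt ?_ hτε
  set F := fredholmDet (-birmanSchwinger H V J x)
  set T := trace (-birmanSchwinger H V J x)
  calc ‖F - 1‖ = ‖(F - 1 - T) + T‖ := by rw [sub_add_cancel]
    _ ≤ (Real.exp 2 + 2) * τ ^ 2 + τ := (norm_add_le _ _).trans (add_le_add h1 h2)
    _ ≤ (Real.exp 2 + 2) * τ + τ := by
        gcongr
        nlinarith
    _ = c * τ := by rw [hc]; ring

end PerturbationData

/-! ### The logarithm of the perturbation determinant -/

namespace PerturbationData

variable {H : E →ₗ.[ℂ] E} {V J : E →L[ℂ] E} (h : PerturbationData H V J)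

include h

lemma im_eq_zero_of_mem {w : ℂ} (hw : w ∈ jointSpectrum H V) : w.im = 0 := by
  by_contra h0
  exact h.notMem_of_im_ne_zero h0 hw

lemma exists_gt_isBelowSpectra {a : ℝ} (ha : IsBelowSpectra H V a) :
    ∃ b, a < b ∧ IsBelowSpectra H V b := by
  obtain ⟨ε, hε, hball⟩ := Metric.isOpen_iff.1 (isOpen_compl_jointSpectrum (H := H) (V := V)) a
    (ha.notMem le_rfl)
  refine ⟨a + ε / 2, by linarith, fun w hw => ?_⟩
  by_contra! hle
  have h1 := ha w hw
  suffices hwb : w ∈ Metric.ball (a : ℂ) ε from hball hwb hw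
  have h2 : w - a = ((w.re - a : ℝ) : ℂ) := Complex.ext (by simp) (by simp [h.im_eq_zero_of_mem hw])
  rw [Metric.mem_ball, dist_eq_norm, h2, Complex.norm_real, Real.norm_of_nonneg (by linarith)]
  linarith

lemma isOpen_below : IsOpen {z : ℂ | IsBelowSpectra H V z.re} := by
  have h1 : IsOpen {x : ℝ | IsBelowSpectra H V x} := by
    rw [isOpen_iff_mem_nhds]
    intro x hx
    obtain ⟨b, hb, hb2⟩ := h.exists_gt_isBelowSpectra hx
    filter_upwards [Iio_mem_nhds hb] with y hy using hb2.mono (le_of_lt hy)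
  exact h1.preimage Complex.continuous_re

lemma isOpen_cutPlane : IsOpen (cutPlane H V) := by
  have h1 : IsOpen {z : ℂ | z.im ≠ 0} := isOpen_ne_fun Complex.continuous_im continuous_const
  exact h1.union h.isOpen_below

lemma notMem_of_mem_cutPlane {z : ℂ} (hz : z ∈ cutPlane H V) : z ∉ jointSpectrum H V := by
  rcases hz with hz | hz
  · exact h.notMem_of_im_ne_zero hz
  · exact fun hm => lt_irrefl _ (hz z hm)

omit h in
lemma convex_below : Convex ℝ {z : ℂ | IsBelowSpectra H V z.re} := by
  have h1 : Convex ℝ {x : ℝ | IsBelowSpectra H V x} :=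
    Set.OrdConnected.convex ⟨fun x _ y hy z hz => IsBelowSpectra.mono hy hz.2⟩
  exact h1.linear_preimage Complex.reLm

lemma isPreconnected_cutPlane : IsPreconnected (cutPlane H V) := by
  obtain ⟨a, ha⟩ := h.exists_below
  have hmem : (a : ℂ) ∈ cutPlane H V := Or.inr (by simpa using ha)
  have hstar : StarConvex ℝ (a : ℂ) (cutPlane H V) := by
    intro z hz s t hs ht hst
    rcases hz with hz | hz
    · rcases ht.eq_or_lt with rfl | ht
      · right
        simpa [show s = 1 by linarith] using ha
      · left
        simpa using ⟨ht.ne', hz⟩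
    · right
      exact convex_below (H := H) (V := V) (by simpa using ha : (a : ℂ) ∈ _) hz hs ht hst
  exact (hstar.isPathConnected hmem).isConnected.isPreconnected

lemma eq_of_hasDerivAt_cutPlane {F G φ : ℂ → ℂ} (hF : ∀ z ∈ cutPlane H V, HasDerivAt F (φ z) z)
    (hG : ∀ z ∈ cutPlane H V, HasDerivAt G (φ z) z) {z w : ℂ} (hz : z ∈ cutPlane H V)
    (hw : w ∈ cutPlane H V) : F z - G z = F w - G w := by
  have hd : ∀ z ∈ cutPlane H V, HasDerivAt (fun z => F z - G z) 0 z := fun z hz => by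
    exact ((hF z hz).sub (hG z hz)).congr_deriv (sub_self _)
  exact h.isOpen_cutPlane.is_const_of_deriv_eq_zero h.isPreconnected_cutPlane
    (fun z hz => (hd z hz).differentiableAt.differentiableWithinAt)
    (fun z hz => (hd z hz).deriv) hz hw

/-- The cut plane is simply connected, in the sense that holomorphic functions have primitives. -/
lemma exists_primitive_cutPlane {φ : ℂ → ℂ} (hφ : DifferentiableOn ℂ φ (cutPlane H V)) :
    ∃ F : ℂ → ℂ, ∀ z ∈ cutPlane H V, HasDerivAt F (φ z) z := by
  obtain ⟨a, ha⟩ := h.exists_below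
  set U : Set ℂ := {z | 0 < z.im} with hU
  set U' : Set ℂ := {z | z.im < 0} with hU'
  set B : Set ℂ := {z | IsBelowSpectra H V z.re} with hB
  have hUo : IsOpen U := isOpen_lt continuous_const Complex.continuous_im
  have hUo' : IsOpen U' := isOpen_lt Complex.continuous_im continuous_const
  have hBo : IsOpen B := h.isOpen_below
  have hUc : Convex ℝ U := convex_halfSpace_im_gt 0
  have hUc' : Convex ℝ U' := convex_halfSpace_im_lt 0
  have hBc : Convex ℝ B := convex_below
  obtain ⟨F₁, h₁⟩ := hUc.exists_forall_hasDerivWithinAt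
    (hφ.mono fun z (hz : 0 < z.im) => Or.inl hz.ne')
  obtain ⟨F₂, h₂⟩ := hUc'.exists_forall_hasDerivWithinAt
    (hφ.mono fun z (hz : z.im < 0) => Or.inl hz.ne)
  obtain ⟨F₀, h₀⟩ := hBc.exists_forall_hasDerivWithinAt (hφ.mono fun z hz => Or.inr hz)
  -- The primitives on the two open half-planes and on the half-plane below the spectra are glued
  -- along the overlaps. These are convex, so the primitives differ there by constants.
  have key : ∀ (W : Set ℂ) (F : ℂ → ℂ), IsOpen W → Convex ℝ W →
      (∀ z ∈ W, HasDerivWithinAt F (φ z) W z) →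
      ∃ c : ℂ, ∀ z ∈ W ∩ B, F₀ z = F z + c := by
    intro W F hWo hWc hF
    have hd : ∀ z ∈ W ∩ B, HasDerivAt (fun z => F₀ z - F z) 0 z := fun z hz => by
      exact (((h₀ z hz.2).hasDerivAt (hBo.mem_nhds hz.2)).sub
        ((hF z hz.1).hasDerivAt (hWo.mem_nhds hz.1))).congr_deriv (sub_self _)
    obtain ⟨c, hc⟩ := (hWo.inter hBo).exists_is_const_of_deriv_eq_zero
      (hWc.inter hBc).isPreconnected
      (fun z hz => (hd z hz).differentiableAt.differentiableWithinAt)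
      (fun z hz => (hd z hz).deriv)
    exact ⟨c, fun z hz => by rw [← hc z hz]; ring⟩
  obtain ⟨c₁, hc₁⟩ := key U F₁ hUo hUc h₁
  obtain ⟨c₂, hc₂⟩ := key U' F₂ hUo' hUc' h₂
  refine ⟨fun z => if 0 < z.im then F₁ z + c₁ else if z.im < 0 then F₂ z + c₂ else F₀ z, ?_⟩
  intro z hz
  rcases lt_trichotomy z.im 0 with him | him | him
  · refine (((h₂ z him).hasDerivAt (hUo'.mem_nhds him)).add_const c₂).congr_of_eventuallyEq ?_
    filter_upwards [hUo'.mem_nhds him] with w (hw : w.im < 0)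
    rw [if_neg hw.not_gt, if_pos hw]
  · have hzB : z ∈ B := hz.resolve_left (by simpa using him)
    refine ((h₀ z hzB).hasDerivAt (hBo.mem_nhds hzB)).congr_of_eventuallyEq ?_
    filter_upwards [hBo.mem_nhds hzB] with w hw
    split_ifs with h1 h2
    · exact (hc₁ w ⟨h1, hw⟩).symm
    · exact (hc₂ w ⟨h2, hw⟩).symm
    · rfl
  · refine (((h₁ z him).hasDerivAt (hUo.mem_nhds him)).add_const c₁).congr_of_eventuallyEq ?_
    filter_upwards [hUo.mem_nhds him] with w (hw : 0 < w.im)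
    rw [if_pos hw]

/-- The function is the logarithmic derivative Δ'/Δ, so its holomorphy follows from that of Δ and no
differentiation under the trace is required. -/
lemma differentiableOn_trace_resolventDiff :
    DifferentiableOn ℂ (fun z => trace (resolventDiff H V z)) (jointSpectrum H V)ᶜ := by
  have h1 : DifferentiableOn ℂ (perturbationDet H V J) (jointSpectrum H V)ᶜ := fun z hz =>
    (h.hasDerivAt_perturbationDet hz).differentiableAt.differentiableWithinAt
  refine ((h1.deriv isOpen_compl_jointSpectrum).div h1
    fun z hz => h.perturbationDet_ne_zero hz).congr fun z hz => ?_
  rw [Pi.div_apply, (h.hasDerivAt_perturbationDet hz).deriv, mul_div_cancel_left₀ _ (h.perturbationDet_ne_zero hz)]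

/-- L is a primitive of tr(R_V - R), normalised to be the principal logarithm of Δ near -∞, where Δ
is close to 1. Then exp(-L) Δ has derivative zero and equals 1 far to the left, hence everywhere on
the cut plane. Conjugating argument and value of L preserves both its derivative and its limit at
-∞, which gives the symmetry. -/
lemma exists_logDet : ∃ L : ℂ → ℂ, IsLogDet H V J L ∧
    (∀ z ∈ cutPlane H V, HasDerivAt L (trace (resolventDiff H V z)) z) ∧
    ∀ z ∈ cutPlane H V, L (starRingEnd ℂ z) = starRingEnd ℂ (L z) := by
  obtain ⟨F, hF⟩ := h.exists_primitive_cutPlane (h.differentiableOn_trace_resolventDiff.mono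
    fun z hz => h.notMem_of_mem_cutPlane hz)
  obtain ⟨a, ha⟩ := h.exists_below
  have hmem : ∀ x : ℝ, x ≤ a → (x : ℂ) ∈ cutPlane H V := fun x hx => Or.inr (by
    simpa using ha.mono hx)
  obtain ⟨x₀, hx₀a, hx₀⟩ : ∃ x₀ ≤ a, ∀ x : ℝ, x ≤ x₀ →
      perturbationDet H V J x ∈ Complex.slitPlane := by
    have h1 := h.tendsto_perturbationDet.eventually
      (Complex.isOpen_slitPlane.mem_nhds Complex.one_mem_slitPlane)
    obtain ⟨x₁, hx₁⟩ := eventually_atBot.1 h1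
    exact ⟨min a x₁, min_le_left _ _, fun x hx => hx₁ x (hx.trans (min_le_right _ _))⟩
  obtain ⟨c, hc⟩ : ∃ c : ℂ, ∀ x ∈ Iio x₀,
      F (x : ℝ) - Complex.log (perturbationDet H V J (x : ℝ)) = c := by
    have hd : ∀ x ∈ Iio x₀, HasDerivAt (fun x : ℝ =>
        F x - Complex.log (perturbationDet H V J x)) 0 x := fun x hx => by
      have hz := h.notMem_of_mem_cutPlane (hmem x ((le_of_lt hx).trans hx₀a))
      have h2 := ((hF x (hmem x ((le_of_lt hx).trans hx₀a))).sub
        ((h.hasDerivAt_perturbationDet hz).clog (hx₀ x (le_of_lt hx)))).comp_ofReal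
      rwa [mul_div_cancel_left₀ _ (h.perturbationDet_ne_zero hz), sub_self] at h2
    exact isOpen_Iio.exists_is_const_of_deriv_eq_zero isPreconnected_Iio
      (fun x hx => (hd x hx).differentiableAt.differentiableWithinAt) (fun x hx => (hd x hx).deriv)
  set L : ℂ → ℂ := fun z => F z - c with hL
  have hLd : ∀ z ∈ cutPlane H V, HasDerivAt L (trace (resolventDiff H V z)) z := fun z hz =>
    (hF z hz).sub_const c
  have hLx : ∀ x : ℝ, x < x₀ → L x = Complex.log (perturbationDet H V J x) := fun x hx => by
    rw [hL, ← hc x hx]; ring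
  have hL0 : Tendsto (fun x : ℝ => L x) atBot (𝓝 0) := by
    have h1 := ((continuousAt_clog Complex.one_mem_slitPlane).tendsto.comp
      h.tendsto_perturbationDet)
    rw [Complex.log_one] at h1
    refine h1.congr' ?_
    filter_upwards [eventually_lt_atBot x₀] with x hx using (hLx x hx).symm
  have hexp : ∀ z ∈ cutPlane H V, Complex.exp (L z) = perturbationDet H V J z := by
    have hd : ∀ z ∈ cutPlane H V,
        HasDerivAt (fun z => Complex.exp (-L z) * perturbationDet H V J z) 0 z := fun z hz => by
      have h1 := (hLd z hz).neg.cexp.mul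
        (h.hasDerivAt_perturbationDet (h.notMem_of_mem_cutPlane hz))
      refine h1.congr_deriv ?_
      ring
    have h2 : ∀ z ∈ cutPlane H V, Complex.exp (-L z) * perturbationDet H V J z = 1 := by
      intro z hz
      have hx : x₀ - 1 < x₀ := by linarith
      have hw := hmem (x₀ - 1) (by linarith)
      have h3 := h.isOpen_cutPlane.is_const_of_deriv_eq_zero h.isPreconnected_cutPlane
        (fun z hz => (hd z hz).differentiableAt.differentiableWithinAt)
        (fun z hz => (hd z hz).deriv) hz hw
      rw [h3, hLx _ hx, Complex.exp_neg, Complex.exp_log (h.perturbationDet_ne_zero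
        (h.notMem_of_mem_cutPlane hw)), inv_mul_cancel₀ (h.perturbationDet_ne_zero
        (h.notMem_of_mem_cutPlane hw))]
    intro z hz
    have h4 := h2 z hz
    rw [Complex.exp_neg, inv_mul_eq_one₀ (Complex.exp_ne_zero _)] at h4
    exact h4
  refine ⟨L, ⟨fun z hz => (hLd z hz).differentiableAt.differentiableWithinAt, hexp, hL0⟩, hLd, ?_⟩
  have hconj : ∀ z ∈ cutPlane H V, starRingEnd ℂ z ∈ cutPlane H V := fun z hz => by
    rcases hz with hz | hz
    · left; simpa using hz
    · right; simpa using hz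
  have hLc : ∀ z ∈ cutPlane H V, HasDerivAt (starRingEnd ℂ ∘ L ∘ starRingEnd ℂ)
      (trace (resolventDiff H V z)) z := fun z hz => by
    have h1 := (hLd _ (hconj z hz)).conj_conj
    rwa [Complex.conj_conj, h.trace_resolventDiff_conj (h.notMem_of_mem_cutPlane hz),
      Complex.conj_conj] at h1
  have hdiff : ∀ z ∈ cutPlane H V, starRingEnd ℂ (L (starRingEnd ℂ z)) = L z := by
    intro z hz
    have h1 : Tendsto (fun x : ℝ => starRingEnd ℂ (L (starRingEnd ℂ (x : ℂ))) - L x) atBot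
        (𝓝 0) := by
      simpa using ((Complex.continuous_conj.tendsto 0).comp hL0).sub hL0
    have h2 : Tendsto (fun x : ℝ => starRingEnd ℂ (L (starRingEnd ℂ (x : ℂ))) - L x) atBot
        (𝓝 (starRingEnd ℂ (L (starRingEnd ℂ z)) - L z)) := by
      refine tendsto_const_nhds.congr' ?_
      filter_upwards [eventually_le_atBot a] with x hx
      exact h.eq_of_hasDerivAt_cutPlane hLc hLd hz (hmem x hx)
    exact sub_eq_zero.1 (tendsto_nhds_unique h2 h1)
  intro z hz
  rw [← hdiff z hz, Complex.conj_conj]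

end PerturbationData

/-! ### Contour integrals through a point of the cut -/

/-- An integrable bound for `g` in a double sector with vertex `ν` around the vertical direction. -/
def SectorBound (g : ℂ → ℂ) (ν C r : ℝ) : Prop :=
  ∀ z : ℂ, z.im ≠ 0 → |z.im| < r → |z.re - ν| ≤ |z.im| → ‖g z‖ ≤ C * |z.im| ^ (-(1 / 2) : ℝ)

section Sector

variable {G g : ℂ → ℂ} {ν C r : ℝ} (hG : ∀ z : ℂ, z.im ≠ 0 → HasDerivAt G (g z) z)
  (hC : 0 ≤ C) (hr : 0 < r) (hg : SectorBound g ν C r) {σ : ℝ} (hσ : |σ| = 1)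

lemma rpow_neg_half_mul_self {y : ℝ} (hy : 0 < y) : y ^ (-(1 / 2) : ℝ) * y = √y := by
  rw [Real.sqrt_eq_rpow]
  conv_lhs => rw [← Real.rpow_one y, ← Real.rpow_mul hy.le, ← Real.rpow_add hy]
  norm_num

-- The substitution s = u² turns the bound C s^(-1/2) into the constant 2C. Along the ray G is thus
-- Lipschitz in u, hence Cauchy, and its distance from the limit is at most 2C u = 2C √s.
include hG hg hr hσ hC in
lemma exists_tendsto_vertical :
    ∃ l : ℂ, Tendsto (fun s : ℝ => G (ν + (σ * s : ℝ) * Complex.I)) (𝓝[>] 0) (𝓝 l) ∧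
      ∀ s ∈ Ioo 0 r, ‖G (ν + (σ * s : ℝ) * Complex.I) - l‖ ≤ 2 * C * √s := by
  have hσ0 : σ ≠ 0 := fun h0 => by simp [h0] at hσ
  set ρ := √r with hρ
  have hρ0 : 0 < ρ := Real.sqrt_pos.2 hr
  set p : ℝ → ℂ := fun u => ν + (σ * u ^ 2 : ℝ) * Complex.I with hp
  set φ : ℝ → ℂ := fun u => G (p u) with hφ
  have hd : ∀ u ∈ Ioo 0 ρ, HasDerivWithinAt φ (g (p u) * ((σ * (2 * u) : ℝ) * Complex.I))
      (Ioo 0 ρ) u := by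
    intro u hu
    have h1 : HasDerivAt p ((σ * (2 * u) : ℝ) * Complex.I) u := by
      have h2 : HasDerivAt (fun u : ℝ => σ * u ^ 2) (σ * (2 * u)) u := by
        simpa using ((hasDerivAt_id u).pow 2).const_mul σ
      exact (h2.ofReal_comp.mul_const Complex.I).const_add _
    have him : (p u).im ≠ 0 := by
      simpa [hp, ← Complex.ofReal_pow] using ⟨hσ0, hu.1.ne'⟩
    exact ((hG _ him).comp u h1).hasDerivWithinAt
  have hb : ∀ u ∈ Ioo 0 ρ, ‖g (p u) * ((σ * (2 * u) : ℝ) * Complex.I)‖₊ ≤ (2 * C).toNNReal := by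
    intro u hu
    rw [← NNReal.coe_le_coe, coe_nnnorm, Real.coe_toNNReal _ (by positivity)]
    have him : (p u).im = σ * u ^ 2 := by simp [hp, -Complex.ofReal_pow]
    have hre : (p u).re = ν := by simp [hp, -Complex.ofReal_pow]
    have hu0 : 0 < u := hu.1
    have habs : |(p u).im| = u ^ 2 := by
      rw [him, abs_mul, hσ, one_mul, abs_of_nonneg (by positivity)]
    have h1 := hg (p u) (by rw [him]; positivity) (by
      rw [habs, ← Real.sq_sqrt hr.le]; gcongr; exact hu.2) (by simp [hre])
    rw [habs] at h1
    have h2 : ‖((σ * (2 * u) : ℝ) * Complex.I)‖ = 2 * u := by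
      rw [norm_mul, Complex.norm_I, mul_one, Complex.norm_real, Real.norm_eq_abs, abs_mul, hσ,
        one_mul, abs_of_nonneg (by positivity)]
    have h3 : (u ^ 2) ^ (-(1 / 2) : ℝ) * u = 1 := by
      rw [← Real.rpow_natCast, ← Real.rpow_mul hu0.le]
      norm_num
      rw [Real.rpow_neg_one, inv_mul_cancel₀ hu0.ne']
    rw [norm_mul, h2]
    calc ‖g (p u)‖ * (2 * u) ≤ (C * (u ^ 2) ^ (-(1 / 2) : ℝ)) * (2 * u) := by gcongr
      _ = 2 * C * ((u ^ 2) ^ (-(1 / 2) : ℝ) * u) := by ring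
      _ = 2 * C := by rw [h3, mul_one]
  have hlip := (convex_Ioo 0 ρ).lipschitzOnWith_of_nnnorm_hasDerivWithin_le hd hb
  have hcau : Cauchy (map φ (𝓝[>] 0)) := by
    refine Cauchy.map_of_le ?_ hlip.uniformContinuousOn
      (le_principal_iff.2 (Ioo_mem_nhdsGT hρ0))
    exact cauchy_nhds.mono nhdsWithin_le_nhds
  obtain ⟨l, hl⟩ := CompleteSpace.complete hcau
  refine ⟨l, ?_, fun s hs => ?_⟩
  swap
  · have hu : √s ∈ Ioo 0 ρ := ⟨Real.sqrt_pos.2 hs.1, Real.sqrt_lt_sqrt hs.1.le hs.2⟩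
    have h5 : ‖φ √s - l‖ ≤ 2 * C * √s := by
      have h6 : Tendsto (fun u => ‖φ √s - φ u‖) (𝓝[>] 0) (𝓝 ‖φ √s - l‖) :=
        (tendsto_const_nhds.sub (show Tendsto φ (𝓝[>] 0) (𝓝 l) from hl)).norm
      refine le_of_tendsto h6 ?_
      filter_upwards [Ioo_mem_nhdsGT hu.1] with u huu
      have h7 := hlip.dist_le_mul _ hu u ⟨huu.1, huu.2.trans hu.2⟩
      rw [dist_eq_norm, Real.coe_toNNReal _ (by positivity), Real.dist_eq,
        abs_of_pos (sub_pos.2 huu.2)] at h7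
      refine h7.trans ?_
      have := huu.1
      gcongr
      linarith
    simp only [hφ, hp] at h5
    rwa [Real.sq_sqrt hs.1.le] at h5
  have hsq : Tendsto (fun s : ℝ => √s) (𝓝[>] 0) (𝓝[>] 0) := by
    refine tendsto_nhdsWithin_iff.2 ⟨?_, ?_⟩
    · have := (Real.continuous_sqrt.tendsto 0).mono_left (nhdsWithin_le_nhds (s := Ioi 0))
      rwa [Real.sqrt_zero] at this
    · filter_upwards [self_mem_nhdsWithin] with s hs using Real.sqrt_pos.2 hs
  have h4 : Tendsto (φ ∘ fun s : ℝ => √s) (𝓝[>] 0) (𝓝 l) := Tendsto.comp hl hsq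
  refine h4.congr' ?_
  filter_upwards [self_mem_nhdsWithin] with s hs
  simp only [hφ, hp, Function.comp]
  rw [Real.sq_sqrt (le_of_lt hs)]

-- Compare z with the point of the vertical line through ν at the same height. The horizontal
-- segment between them stays in the sector and has length at most |Im z|, so G changes by at most C
-- |Im z|^(1/2).
include hG hg hr hσ hC in
lemma tendsto_of_sector {ι : Type*} {l : Filter ι} {z : ι → ℂ} {G₀ : ℂ}
    (hlim : Tendsto (fun s : ℝ => G (ν + (σ * s : ℝ) * Complex.I)) (𝓝[>] 0) (𝓝 G₀))
    (hz : Tendsto z l (𝓝 (ν : ℂ)))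
    (hsec : ∀ᶠ t in l, 0 < σ * (z t).im ∧ |(z t).re - ν| ≤ |(z t).im|) :
    Tendsto (fun t => G (z t)) l (𝓝 G₀) := by
  have hσσ : σ * σ = 1 := by rw [← abs_mul_abs_self, hσ, one_mul]
  have him : Tendsto (fun t => σ * (z t).im) l (𝓝[>] 0) := by
    refine tendsto_nhdsWithin_iff.2 ⟨?_, hsec.mono fun t ht => ht.1⟩
    have := ((Complex.continuous_im.tendsto _).comp hz).const_mul σ
    simpa using this
  have h1 := hlim.comp him
  have h2 : Tendsto (fun t => C * √(σ * (z t).im)) l (𝓝 0) := by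
    have h3 := (Real.continuous_sqrt.tendsto 0).comp (him.mono_right nhdsWithin_le_nhds)
    simpa using h3.const_mul C
  have h4 : Tendsto (fun t => G (z t) - G (ν + (σ * (σ * (z t).im) : ℝ) * Complex.I)) l (𝓝 0) := by
    refine squeeze_zero_norm' ?_ h2
    have hsmall : ∀ᶠ t in l, σ * (z t).im < r :=
      (him.mono_right nhdsWithin_le_nhds).eventually_lt_const hr
    filter_upwards [hsec, hsmall] with t ht htr
    have hy : |(z t).im| = σ * (z t).im := by
      rw [← abs_of_pos ht.1, abs_mul, hσ, one_mul]
    have hy0 : 0 < |(z t).im| := by rw [hy]; exact ht.1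
    have hp : (ν + (σ * (σ * (z t).im) : ℝ) * Complex.I : ℂ) = ⟨ν, (z t).im⟩ := by
      rw [← mul_assoc, hσσ, one_mul]
      apply Complex.ext <;> simp
    set w : ℂ := ⟨ν, (z t).im⟩ with hw
    rw [hp]
    have hseg : ∀ v ∈ segment ℝ w (z t), v.im = (z t).im ∧ |v.re - ν| ≤ |(z t).im| := by
      rintro v ⟨a, b, ha, hb, hab, rfl⟩
      refine ⟨?_, ?_⟩
      · simp only [Complex.add_im, Complex.smul_im, hw, smul_eq_mul]
        rw [← add_mul, hab, one_mul]
      · simp only [Complex.add_re, Complex.smul_re, hw, smul_eq_mul]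
        have : a * ν + b * (z t).re - ν = b * ((z t).re - ν) := by
          linear_combination ν * hab
        rw [this, abs_mul, abs_of_nonneg hb]
        exact (mul_le_of_le_one_left (abs_nonneg _) (by linarith)).trans ht.2
    have h5 := (convex_segment w (z t)).norm_image_sub_le_of_norm_hasDerivWithin_le
      (f := G) (f' := g) (C := C * |(z t).im| ^ (-(1 / 2) : ℝ))
      (fun v hv => (hG v (by rw [(hseg v hv).1]; exact abs_pos.1 hy0)).hasDerivWithinAt)
      (fun v hv => by
        obtain ⟨hv1, hv2⟩ := hseg v hv
        have := hg v (by rw [hv1]; exact abs_pos.1 hy0) (by rw [hv1, hy]; exact htr)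
          (by rw [hv1]; exact hv2)
        rwa [hv1] at this)
      (left_mem_segment ℝ _ _) (right_mem_segment ℝ _ _)
    have h6 : ‖z t - w‖ ≤ |(z t).im| := by
      have : z t - w = (((z t).re - ν : ℝ) : ℂ) := by apply Complex.ext <;> simp [hw]
      rw [this, Complex.norm_real]
      exact ht.2
    calc ‖G (z t) - G w‖ ≤ C * |(z t).im| ^ (-(1 / 2) : ℝ) * ‖z t - w‖ := h5
      _ ≤ C * |(z t).im| ^ (-(1 / 2) : ℝ) * |(z t).im| := by gcongr
      _ = C * √(σ * (z t).im) := by rw [mul_assoc, rpow_neg_half_mul_self hy0, hy]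
  have h7 := h4.add h1
  simpa [Function.comp_def] using h7

end Sector

/-- At a perpendicular crossing the real part deviates from ν by o(t - t₀), while the imaginary part
moves at speed v; an error of v/2 |t - t₀| leaves the curve in the sector. This is where
perpendicularity enters. -/
lemma eventually_sector {γ : ℝ → ℂ} {s : Set ℝ} {t₀ v ν : ℝ} (hv : 0 < v) (h0 : γ t₀ = ν)
    (hd : HasDerivWithinAt γ (v * Complex.I) s t₀) :
    ∀ᶠ t in 𝓝[s] t₀, v / 2 * |t - t₀| ≤ |(γ t).im| ∧ |(γ t).re - ν| ≤ |(γ t).im| ∧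
      |(γ t).im - v * (t - t₀)| ≤ v / 2 * |t - t₀| := by
  have h1 := (hasDerivWithinAt_iff_isLittleO.1 hd).bound (half_pos hv)
  filter_upwards [h1] with t ht
  rw [h0, Real.norm_eq_abs] at ht
  have hre : (γ t - ν - (t - t₀) • (v * Complex.I : ℂ)).re = (γ t).re - ν := by simp
  have him : (γ t - ν - (t - t₀) • (v * Complex.I : ℂ)).im = (γ t).im - v * (t - t₀) := by
    simp; ring
  have h2 := (Complex.abs_re_le_norm _).trans ht
  have h3 := (Complex.abs_im_le_norm _).trans ht
  rw [hre] at h2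
  rw [him] at h3
  have h4 : v / 2 * |t - t₀| ≤ |(γ t).im| := by
    have h5 : |v * (t - t₀)| = v * |t - t₀| := by rw [abs_mul, abs_of_pos hv]
    have h6 := abs_sub_abs_le_abs_sub (v * (t - t₀)) (γ t).im
    rw [abs_sub_comm] at h6
    linarith
  exact ⟨h4, h2.trans h4, h3⟩

namespace IsFermiContour

variable {H : E →ₗ.[ℂ] E} {V : E →L[ℂ] E} {ν : ℝ} {γ : ℝ → ℂ} (hγ : IsFermiContour H V ν γ)

include hγ

lemma mem_cutPlane {t : ℝ} (ht : t ∈ Ioo (0 : ℝ) 1) : γ t ∈ cutPlane H V := by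
  obtain ⟨c, hc, h1, h2, h3, h4, h5⟩ := hγ.crossing
  rcases lt_trichotomy t c with h | h | h
  · exact Or.inl (h4 t ⟨ht.1, h⟩).ne'
  · exact Or.inr (h ▸ h3)
  · exact Or.inl (h5 t ⟨h, ht.2⟩).ne

lemma eventually_start : ∃ v : ℝ, 0 < v ∧ ∀ᶠ t in 𝓝[>] (0 : ℝ), v * t ≤ |(γ t).im| ∧
    |(γ t).re - ν| ≤ |(γ t).im| ∧ 0 < (1 : ℝ) * (γ t).im := by
  obtain ⟨v, hv, hd⟩ := hγ.perp_start
  obtain ⟨c, hc, h1, h2, h3, h4, h5⟩ := hγ.crossing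
  refine ⟨v / 2, half_pos hv, ?_⟩
  filter_upwards [(eventually_sector hv hγ.start_eq hd).filter_mono
    (nhdsWithin_mono 0 Ioi_subset_Ici_self), Ioo_mem_nhdsGT hc.1] with t ht ht2
  refine ⟨?_, ht.2.1, by rw [one_mul]; exact h4 t ht2⟩
  simpa [abs_of_pos ht2.1] using ht.1

lemma eventually_finish : ∃ v : ℝ, 0 < v ∧ ∀ᶠ t in 𝓝[<] (1 : ℝ), v * (1 - t) ≤ |(γ t).im| ∧
    |(γ t).re - ν| ≤ |(γ t).im| ∧ 0 < (-1 : ℝ) * (γ t).im := by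
  obtain ⟨v, hv, hd⟩ := hγ.perp_finish
  obtain ⟨c, hc, h1, h2, h3, h4, h5⟩ := hγ.crossing
  refine ⟨v / 2, half_pos hv, ?_⟩
  filter_upwards [(eventually_sector hv hγ.finish_eq hd).filter_mono
    (nhdsWithin_mono 1 Iio_subset_Iic_self), Ioo_mem_nhdsLT hc.2] with t ht ht2
  refine ⟨?_, ht.2.1, by linarith [h5 t ht2]⟩
  have := ht.1
  rwa [abs_of_neg (by linarith [ht2.2]), neg_sub] at this

lemma tendsto_start : Tendsto γ (𝓝[>] 0) (𝓝 (ν : ℂ)) := by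
  have h1 := (hγ.continuousOn 0 (by simp)).tendsto
  rw [hγ.start_eq] at h1
  refine h1.mono_left ?_
  rw [← nhdsWithin_Ioc_eq_nhdsGT (zero_lt_one (α := ℝ))]
  exact nhdsWithin_mono _ Ioc_subset_Icc_self

lemma tendsto_finish : Tendsto γ (𝓝[<] 1) (𝓝 (ν : ℂ)) := by
  have h1 := (hγ.continuousOn 1 (by simp)).tendsto
  rw [hγ.finish_eq] at h1
  refine h1.mono_left ?_
  rw [← nhdsWithin_Ico_eq_nhdsLT (zero_lt_one (α := ℝ))]
  exact nhdsWithin_mono _ Ico_subset_Icc_self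

/-- The values of `g` along the contour have an integrable bound. -/
lemma exists_bound {g : ℂ → ℂ} {C r : ℝ} (hC : 0 ≤ C) (hr : 0 < r)
    (hgc : ∀ K ⊆ cutPlane H V, IsCompact K → ∃ M, ∀ z ∈ K, ‖g z‖ ≤ M) (hg : SectorBound g ν C r) :
    ∃ A : ℝ, 0 ≤ A ∧ ∀ t ∈ Ioo (0 : ℝ) 1,
      ‖g (γ t)‖ ≤ A * (t ^ (-(1 / 2) : ℝ) + (1 - t) ^ (-(1 / 2) : ℝ) + 1) := by
  have hhalf : (-(1 / 2) : ℝ) ≤ 0 := by norm_num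
  have key : ∀ v y τ : ℝ, 0 < v → 0 < τ → v * τ ≤ y →
      y ^ (-(1 / 2) : ℝ) ≤ v ^ (-(1 / 2) : ℝ) * τ ^ (-(1 / 2) : ℝ) := by
    intro v y τ hv hτ hy
    rw [← Real.mul_rpow hv.le hτ.le]
    exact Real.rpow_le_rpow_of_nonpos (by positivity) hy hhalf
  obtain ⟨v, hv, hs⟩ := hγ.eventually_start
  obtain ⟨v', hv', hf⟩ := hγ.eventually_finish
  have him0 : ∀ᶠ t in 𝓝[>] (0 : ℝ), |(γ t).im| < r := by
    have := ((Complex.continuous_im.tendsto _).comp hγ.tendsto_start).abs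
    simp only [Complex.ofReal_im, abs_zero] at this
    exact this.eventually_lt_const hr
  have him1 : ∀ᶠ t in 𝓝[<] (1 : ℝ), |(γ t).im| < r := by
    have := ((Complex.continuous_im.tendsto _).comp hγ.tendsto_finish).abs
    simp only [Complex.ofReal_im, abs_zero] at this
    exact this.eventually_lt_const hr
  obtain ⟨δ, hδ, hδs⟩ := mem_nhdsGT_iff_exists_Ioo_subset.1 (hs.and him0)
  obtain ⟨δ', hδ', hδf⟩ := mem_nhdsLT_iff_exists_Ioo_subset.1 (hf.and him1)
  have hδ0 : 0 < δ := hδ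
  have hδ1 : δ' < 1 := hδ'
  obtain ⟨M, hM⟩ : ∃ M, ∀ t ∈ Icc (δ / 2) ((1 + δ') / 2) ∩ Icc 0 1, ‖g (γ t)‖ ≤ M := by
    obtain ⟨M, hM⟩ := hgc (γ '' (Icc (δ / 2) ((1 + δ') / 2) ∩ Icc 0 1)) (by
      rintro _ ⟨t, ht, rfl⟩
      exact hγ.mem_cutPlane ⟨by linarith [ht.1.1], by linarith [ht.1.2]⟩)
      ((isCompact_Icc.inter_right isClosed_Icc).image_of_continuousOn
        (hγ.continuousOn.mono inter_subset_right))
    exact ⟨M, fun t ht => hM _ (mem_image_of_mem γ ht)⟩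
  refine ⟨C * v ^ (-(1 / 2) : ℝ) + C * v' ^ (-(1 / 2) : ℝ) + |M|, by positivity, fun t ht => ?_⟩
  have ht0 : 0 < t := ht.1
  have ht1 : 0 < 1 - t := by linarith [ht.2]
  have hp1 : 0 ≤ t ^ (-(1 / 2) : ℝ) := by positivity
  have hp2 : 0 ≤ (1 - t) ^ (-(1 / 2) : ℝ) := by positivity
  have hq1 : 0 ≤ C * v ^ (-(1 / 2) : ℝ) := by positivity
  have hq2 : 0 ≤ C * v' ^ (-(1 / 2) : ℝ) := by positivity
  have hM0 := abs_nonneg M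
  rcases lt_or_ge t δ with h1 | h1
  · obtain ⟨⟨ha, hb, hc⟩, hd⟩ := hδs ⟨ht0, h1⟩
    have h2 := hg (γ t) (by intro h0; rw [h0] at hc; simp at hc) hd hb
    have h3 : C * |(γ t).im| ^ (-(1 / 2) : ℝ) ≤ C * (v ^ (-(1 / 2) : ℝ) * t ^ (-(1 / 2) : ℝ)) := by
      gcongr
      exact key v _ t hv ht0 ha
    nlinarith [mul_nonneg hq2 hp1, mul_nonneg hM0 hp1, mul_nonneg hq1 hp2, mul_nonneg hq2 hp2,
      mul_nonneg hM0 hp2]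
  rcases lt_or_ge δ' t with h2 | h2
  · obtain ⟨⟨ha, hb, hc⟩, hd⟩ := hδf ⟨h2, ht.2⟩
    have h2 := hg (γ t) (by intro h0; rw [h0] at hc; simp at hc) hd hb
    have h3 : C * |(γ t).im| ^ (-(1 / 2) : ℝ) ≤
        C * (v' ^ (-(1 / 2) : ℝ) * (1 - t) ^ (-(1 / 2) : ℝ)) := by
      gcongr
      exact key v' _ (1 - t) hv' ht1 ha
    nlinarith [mul_nonneg hq2 hp1, mul_nonneg hM0 hp1, mul_nonneg hq1 hp2, mul_nonneg hq1 hp1,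
      mul_nonneg hM0 hp2]
  · have h3 := (hM t ⟨⟨by linarith, by linarith⟩, ht0.le, ht.2.le⟩).trans (le_abs_self M)
    nlinarith [mul_nonneg hq2 hp1, mul_nonneg hM0 hp1, mul_nonneg hq1 hp2, mul_nonneg hq1 hp1,
      mul_nonneg hM0 hp2, mul_nonneg hq2 hp2]

omit hγ in
lemma integrableOn_rpow_bound (A : ℝ) :
    IntegrableOn (fun t : ℝ => A * (t ^ (-(1 / 2) : ℝ) + (1 - t) ^ (-(1 / 2) : ℝ) + 1))
      (Ioo 0 1) volume := by
  have h1 : IntervalIntegrable (fun x : ℝ => x ^ (-(1 / 2) : ℝ)) volume 0 1 :=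
    intervalIntegral.intervalIntegrable_rpow' (by norm_num)
  have h2 := (h1.comp_sub_left 1).symm
  rw [sub_zero, sub_self] at h2
  have h3 := ((h1.add h2).add (intervalIntegrable_const (c := (1 : ℝ)))).const_mul A
  exact (intervalIntegrable_iff_integrableOn_Ioo_of_le zero_le_one).1 h3

/-- Integrands along the contour are measurable. -/
lemma aestronglyMeasurable {g : ℂ → ℂ} (hgc : ContinuousOn g (cutPlane H V)) :
    AEStronglyMeasurable (fun t => g (γ t) * deriv γ t) (volume.restrict (Ioo 0 1)) := by
  obtain ⟨S, C, hS1, hS2⟩ := hγ.piecewise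
  have hm : MeasurableSet (Ioo (0 : ℝ) 1 \ S) := measurableSet_Ioo.diff S.measurableSet
  have h1 : ContinuousOn (fun t => g (γ t) * deriv γ t) (Ioo 0 1 \ S) := by
    refine ContinuousOn.mul (hgc.comp (hγ.continuousOn.mono fun t ht => ?_) fun t ht =>
      hγ.mem_cutPlane ht.1) hS2
    exact Ioo_subset_Icc_self ht.1
  have h2 := h1.aestronglyMeasurable (μ := volume) hm
  rwa [Measure.restrict_congr_set (sdiff_null_ae_eq_self (S.finite_toSet.measure_zero volume))] at h2

lemma ae_deriv_le : ∃ C : ℝ, 0 ≤ C ∧ ∀ᵐ t ∂(volume.restrict (Ioo (0 : ℝ) 1)),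
    ‖deriv γ t‖ ≤ C := by
  obtain ⟨S, C, hS1, hS2⟩ := hγ.piecewise
  refine ⟨|C|, abs_nonneg _, ?_⟩
  rw [ae_restrict_iff' measurableSet_Ioo]
  have h0 : ∀ᵐ t ∂(volume : Measure ℝ), t ∉ (S : Set ℝ) :=
    measure_eq_zero_iff_ae_notMem.1 (S.finite_toSet.measure_zero volume)
  filter_upwards [h0] with t ht ht2
  exact ((hS1 t ⟨ht2, ht⟩).2).trans (le_abs_self C)

lemma intervalIntegrable {g : ℂ → ℂ} {C r : ℝ} (hC : 0 ≤ C) (hr : 0 < r)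
    (hgc : ContinuousOn g (cutPlane H V)) (hg : SectorBound g ν C r) :
    IntervalIntegrable (fun t => g (γ t) * deriv γ t) volume 0 1 := by
  obtain ⟨A, hA, hbound⟩ := hγ.exists_bound hC hr
    (fun K hK hKc => hKc.exists_bound_of_continuousOn (hgc.mono hK)) hg
  obtain ⟨B, hB, hderiv⟩ := hγ.ae_deriv_le
  rw [intervalIntegrable_iff_integrableOn_Ioo_of_le zero_le_one]
  refine Integrable.mono' (integrableOn_rpow_bound (A * B)) (hγ.aestronglyMeasurable hgc) ?_
  filter_upwards [hderiv, ae_restrict_mem measurableSet_Ioo] with t ht ht2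
  rw [norm_mul]
  calc ‖g (γ t)‖ * ‖deriv γ t‖ ≤
        (A * (t ^ (-(1 / 2) : ℝ) + (1 - t) ^ (-(1 / 2) : ℝ) + 1)) * B :=
        mul_le_mul (hbound t ht2) ht (norm_nonneg _) ((norm_nonneg _).trans (hbound t ht2))
    _ = _ := by ring

/-- The fundamental theorem of calculus along the contour. -/
lemma integral_eq {G g : ℂ → ℂ} {C r : ℝ} (hC : 0 ≤ C) (hr : 0 < r)
    (hgc : ContinuousOn g (cutPlane H V)) (hg : SectorBound g ν C r)
    (hG : ∀ z ∈ cutPlane H V, HasDerivAt G (g z) z) {G₁ G₂ : ℂ}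
    (h₁ : Tendsto (fun s : ℝ => G (ν + (1 * s : ℝ) * Complex.I)) (𝓝[>] 0) (𝓝 G₁))
    (h₂ : Tendsto (fun s : ℝ => G (ν + (-1 * s : ℝ) * Complex.I)) (𝓝[>] 0) (𝓝 G₂)) :
    ∫ t in (0 : ℝ)..1, g (γ t) * deriv γ t = G₂ - G₁ := by
  have hG' : ∀ z : ℂ, z.im ≠ 0 → HasDerivAt G (g z) z := fun z hz => hG z (Or.inl hz)
  obtain ⟨v, hv, hs⟩ := hγ.eventually_start
  obtain ⟨v', hv', hf⟩ := hγ.eventually_finish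
  have hl₁ : Tendsto (fun t => G (γ t)) (𝓝[>] 0) (𝓝 G₁) :=
    tendsto_of_sector hG' hC hr hg abs_one h₁ hγ.tendsto_start (hs.mono fun t ht => ⟨ht.2.2, ht.2.1⟩)
  have hl₂ : Tendsto (fun t => G (γ t)) (𝓝[<] 1) (𝓝 G₂) :=
    tendsto_of_sector hG' hC hr hg (by simp) h₂ hγ.tendsto_finish
      (hf.mono fun t ht => ⟨ht.2.2, ht.2.1⟩)
  obtain ⟨S, B, hS1, hS2⟩ := hγ.piecewise
  have hcont : ContinuousOn (fun t => G (γ t)) (Ioo 0 1) := fun t ht =>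
    ((hG _ (hγ.mem_cutPlane ht)).continuousAt.comp_continuousWithinAt
      ((hγ.continuousOn t (Ioo_subset_Icc_self ht)).mono Ioo_subset_Icc_self))
  -- Both ends of the contour sit at ν, where G has two different one-sided limits. The extension of
  -- t ↦ G(γ t) from the open interval has these limits as endpoint values, and the fundamental
  -- theorem applies to it.
  set Φ := extendFrom (Ioo 0 1) fun t => G (γ t) with hΦ
  have hΦc : ContinuousOn Φ (Icc 0 1) :=
    continuousOn_Icc_extendFrom_Ioo hcont hl₁ hl₂
  have hΦ0 : Φ 0 = G₁ := eq_lim_at_left_extendFrom_Ioo zero_lt_one hl₁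
  have hΦ1 : Φ 1 = G₂ := eq_lim_at_right_extendFrom_Ioo zero_lt_one hl₂
  have hΦt : ∀ t ∈ Ioo (0 : ℝ) 1, Φ t = G (γ t) := fun t ht => by
    refine extendFrom_eq (subset_closure ht) ?_
    exact (hcont t ht).tendsto
  have hInt := hγ.intervalIntegrable hC hr hgc hg
  rw [← hΦ0, ← hΦ1]
  refine MeasureTheory.integral_eq_of_hasDerivAt_off_countable_of_le Φ _ zero_le_one
    S.finite_toSet.countable hΦc (fun t ht => ?_) hInt
  have hd := (hG _ (hγ.mem_cutPlane ht.1)).comp t (hS1 t ht).1.hasDerivAt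
  refine hd.congr_of_eventuallyEq ?_
  filter_upwards [isOpen_Ioo.mem_nhds ht.1] with u hu using hΦt u hu

end IsFermiContour

/-! ### Cauchy's formula for Stieltjes transforms -/

section Circle

variable {a b ν : ℝ}

lemma circleMap_re (a ν θ : ℝ) :
    (circleMap (((a + ν) / 2 : ℝ) : ℂ) ((ν - a) / 2) θ).re =
      (a + ν) / 2 + (ν - a) / 2 * Real.cos θ := by
  simp [circleMap, Complex.exp_ofReal_mul_I_re, -Complex.ofReal_div, -Complex.ofReal_sub]

lemma circleMap_im (a ν θ : ℝ) :
    (circleMap (((a + ν) / 2 : ℝ) : ℂ) ((ν - a) / 2) θ).im = (ν - a) / 2 * Real.sin θ := by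
  simp [circleMap, Complex.exp_ofReal_mul_I_im, -Complex.ofReal_div, -Complex.ofReal_sub]

lemma circleMap_re_lt (ha : a < ν) {θ : ℝ} (hθ : θ ∈ Ioo 0 (2 * Real.pi)) :
    (circleMap (((a + ν) / 2 : ℝ) : ℂ) ((ν - a) / 2) θ).re < ν := by
  rw [circleMap_re]
  have h1 : Real.cos θ < 1 := (Real.cos_le_one θ).lt_of_ne fun h0 =>
    hθ.1.ne' ((Real.cos_eq_one_iff_of_lt_of_lt (by linarith [hθ.1, Real.pi_pos]) hθ.2).1 h0)
  nlinarith

lemma re_le_of_mem_closedBall {z : ℂ}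
    (hz : z ∈ Metric.closedBall (((a + ν) / 2 : ℝ) : ℂ) ((ν - a) / 2)) : z.re ≤ ν := by
  have h1 := (Complex.re_le_norm _).trans (mem_closedBall_iff_norm.1 hz)
  rw [Complex.sub_re, Complex.ofReal_re] at h1
  linarith

lemma mem_ball_of_lt {t : ℝ} (h1 : a < t) (h2 : t < ν) :
    (t : ℂ) ∈ Metric.ball (((a + ν) / 2 : ℝ) : ℂ) ((ν - a) / 2) := by
  rw [mem_ball_iff_norm, ← Complex.ofReal_sub, Complex.norm_real, Real.norm_eq_abs, abs_lt]
  constructor <;> linarith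

/-- On the circle with diameter `[a, ν]`, the distance to `ν` is controlled by the distance to
any point of `[b, ∞)`, `a < b`. -/
lemma exists_circle_dist_le (hab : a < b) (ha : a < ν) : ∃ c : ℝ, 0 ≤ c ∧
    ∀ z ∈ Metric.sphere (((a + ν) / 2 : ℝ) : ℂ) ((ν - a) / 2), ∀ t : ℝ, b ≤ t →
      ‖(ν : ℂ) - z‖ ≤ c * ‖z - t‖ := by
  set R := (ν - a) / 2 with hR
  have hR0 : 0 < R := by rw [hR]; linarith
  set d := b - a with hd
  have hd0 : 0 < d := by rw [hd]; linarith
  set q := 4 * R / d + 16 * R ^ 2 / d ^ 2 with hq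
  have hq0 : 0 ≤ q := by positivity
  refine ⟨√q, Real.sqrt_nonneg _, fun z hz t ht => ?_⟩
  have hz1 : (z.re - (a + ν) / 2) ^ 2 + z.im ^ 2 = R ^ 2 := by
    have h1 : ‖z - (((a + ν) / 2 : ℝ) : ℂ)‖ = R := mem_sphere_iff_norm.1 hz
    have h2 := Complex.normSq_eq_norm_sq (z - (((a + ν) / 2 : ℝ) : ℂ))
    rw [h1, Complex.normSq_apply] at h2
    simp only [Complex.sub_re, Complex.sub_im, Complex.ofReal_re, Complex.ofReal_im] at h2
    linarith
  have hn1 : ‖(ν : ℂ) - z‖ ^ 2 = (ν - z.re) ^ 2 + z.im ^ 2 := by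
    rw [← Complex.normSq_eq_norm_sq, Complex.normSq_apply]; simp; ring
  have hn2 : ‖z - t‖ ^ 2 = (z.re - t) ^ 2 + z.im ^ 2 := by
    rw [← Complex.normSq_eq_norm_sq, Complex.normSq_apply]; simp; ring
  have hx1 : z.re ≤ ν := re_le_of_mem_closedBall (Metric.sphere_subset_closedBall hz)
  have hx2 : a ≤ z.re := by
    have h1 : (z.re - (a + ν) / 2) ^ 2 ≤ R ^ 2 := by nlinarith
    have h2 := abs_le_of_sq_le_sq h1 hR0.le
    rw [abs_le] at h2
    linarith [h2.1]
  have him : z.im ^ 2 = (ν - z.re) * (z.re - a) := by rw [hR] at hz1; nlinarith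
  have hmain : ‖(ν : ℂ) - z‖ ^ 2 ≤ q * ‖z - t‖ ^ 2 := by
    rw [hn1, hn2, him]
    have e1 : (ν - z.re) ^ 2 + (ν - z.re) * (z.re - a) = 2 * R * (ν - z.re) := by rw [hR]; ring
    rw [e1]
    have hp1 : 0 ≤ (ν - z.re) * (z.re - a) := mul_nonneg (by linarith) (by linarith)
    -- On the circle (Im z)² = (ν - Re z)(Re z - a) and |ν - z|² = 2R (ν - Re z). Away from a the
    -- imaginary part alone is large enough; near a the real distance from t is at least d/2.
    rcases le_or_gt (a + d / 2) z.re with h | h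
    · have h1 : 2 * R * (ν - z.re) ≤ 4 * R / d * ((ν - z.re) * (z.re - a)) := by
        have : 2 * R * (ν - z.re) = 4 * R / d * ((ν - z.re) * (d / 2)) := by field_simp; ring
        rw [this]
        have : 0 ≤ ν - z.re := by linarith
        gcongr
        linarith
      calc _ ≤ 4 * R / d * ((ν - z.re) * (z.re - a)) := h1
        _ ≤ q * ((z.re - t) ^ 2 + (ν - z.re) * (z.re - a)) := by
          have : 4 * R / d ≤ q := by rw [hq]; linarith [show 0 ≤ 16 * R ^ 2 / d ^ 2 by positivity]
          have h2 : 0 ≤ (z.re - t) ^ 2 := by positivity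
          exact mul_le_mul this (by linarith) hp1 hq0
    · have h1 : (d / 2) ^ 2 ≤ (z.re - t) ^ 2 := by
        have : d / 2 ≤ t - z.re := by rw [hd] at h ⊢; linarith
        nlinarith
      have h2 : 2 * R * (ν - z.re) ≤ 16 * R ^ 2 / d ^ 2 * (d / 2) ^ 2 := by
        have e2 : 16 * R ^ 2 / d ^ 2 * (d / 2) ^ 2 = 2 * R * (2 * R) := by field_simp; ring
        rw [e2]
        gcongr
        rw [hR]; linarith
      refine h2.trans ?_
      have : 16 * R ^ 2 / d ^ 2 ≤ q := by rw [hq]; linarith [show 0 ≤ 4 * R / d by positivity]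
      exact mul_le_mul this (by linarith) (by positivity) hq0
  have h3 : ‖(ν : ℂ) - z‖ ^ 2 ≤ (√q * ‖z - t‖) ^ 2 := by
    rw [mul_pow, Real.sq_sqrt hq0]; exact hmain
  exact (pow_le_pow_iff_left₀ (norm_nonneg _) (by positivity) two_ne_zero).1 h3

/-- The weight vanishes at ν. For t = ν the pole on the contour is therefore cancelled, the
integrand becomes the holomorphic function -q, and the integral is zero; hence the open half-line on
the right. -/
lemma circleIntegral_kernel (hab : a < b) (ha : a < ν) {q : ℂ → ℂ}
    (hq : DifferentiableOn ℂ q (Metric.closedBall (((a + ν) / 2 : ℝ) : ℂ) ((ν - a) / 2)))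
    {t : ℝ} (ht : b < t) :
    (∮ z in C((((a + ν) / 2 : ℝ) : ℂ), ((ν - a) / 2)), (((ν : ℂ) - z) * q z) * (z - t)⁻¹) =
      2 * Real.pi * Complex.I * (Iio ν).indicator (fun t : ℝ => ((ν : ℂ) - t) * q t) t := by
  set c₀ : ℂ := (((a + ν) / 2 : ℝ) : ℂ) with hc₀
  set R := (ν - a) / 2 with hR
  have hR0 : 0 < R := by rw [hR]; linarith
  have hk : DifferentiableOn ℂ (fun z => ((ν : ℂ) - z) * q z) (Metric.closedBall c₀ R) :=
    ((differentiableOn_const _).sub differentiableOn_id).mul hq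
  rcases lt_trichotomy t ν with h | h | h
  · rw [indicator_of_mem (mem_Iio.2 h)]
    have h1 := hk.circleIntegral_sub_inv_smul (mem_ball_of_lt (hab.trans ht) h)
    simp only [smul_eq_mul] at h1
    rw [← h1]
    congr 1; ext z; ring
  · subst h
    rw [indicator_of_notMem (by simp), mul_zero]
    have h1 : (∮ z in C(c₀, R), -q z) = 0 :=
      DiffContOnCl.circleIntegral_eq_zero hR0.le
        (hq.neg.mono Metric.closure_ball_subset_closedBall).diffContOnCl
    rw [← h1, circleIntegral, circleIntegral, intervalIntegral.integral_of_le (by positivity),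
      intervalIntegral.integral_of_le (by positivity), integral_Ioc_eq_integral_Ioo,
      integral_Ioc_eq_integral_Ioo]
    refine setIntegral_congr_fun measurableSet_Ioo fun θ hθ => ?_
    have hne : circleMap c₀ R θ - (t : ℂ) ≠ 0 := fun h0 => by
      have h2 := circleMap_re_lt (a := a) (ν := t) (by linarith) hθ
      rw [sub_eq_zero.1 h0] at h2
      simp at h2
    congr 1
    rw [mul_right_comm, ← neg_sub, neg_mul, mul_inv_cancel₀ hne]
    ring
  · rw [indicator_of_notMem (by simpa using h.le), mul_zero]
    refine DiffContOnCl.circleIntegral_eq_zero hR0.le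
      (DifferentiableOn.mono ?_ Metric.closure_ball_subset_closedBall).diffContOnCl
    refine hk.mul (DifferentiableOn.inv (differentiableOn_id.sub (differentiableOn_const _))
      fun z hz h0 => ?_)
    have h2 := re_le_of_mem_closedBall hz
    rw [sub_eq_zero.1 h0] at h2
    simp at h2
    linarith

/-- Cauchy's formula, integrated with respect to a measure, for a weight that vanishes at `ν`. -/
lemma circleIntegral_stieltjes (hab : a < b) (ha : a < ν) {q : ℂ → ℂ}
    (hq : DifferentiableOn ℂ q (Metric.closedBall (((a + ν) / 2 : ℝ) : ℂ) ((ν - a) / 2)))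
    (μ : Measure ℝ) [IsFiniteMeasure μ] (hμ : ∀ᵐ t ∂μ, b < t) :
    CircleIntegrable (fun z => (((ν : ℂ) - z) * q z) * ∫ t : ℝ, (z - t)⁻¹ ∂μ)
      (((a + ν) / 2 : ℝ) : ℂ) ((ν - a) / 2) ∧
    (∮ z in C((((a + ν) / 2 : ℝ) : ℂ), ((ν - a) / 2)),
      (((ν : ℂ) - z) * q z) * ∫ t : ℝ, (z - t)⁻¹ ∂μ) =
      2 * Real.pi * Complex.I * ∫ t, (Iio ν).indicator (fun t : ℝ => ((ν : ℂ) - t) * q t) t ∂μ := by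
  obtain ⟨c, hc0, hc⟩ := exists_circle_dist_le hab ha
  set c₀ : ℂ := (((a + ν) / 2 : ℝ) : ℂ) with hc₀
  set R := (ν - a) / 2 with hR
  have hR0 : 0 < R := by rw [hR]; linarith
  obtain ⟨M, hM⟩ := (isCompact_closedBall c₀ R).exists_bound_of_continuousOn hq.continuousOn
  have hsph : ∀ θ, circleMap c₀ R θ ∈ Metric.closedBall c₀ R := fun θ =>
    Metric.sphere_subset_closedBall (circleMap_mem_sphere _ hR0.le θ)
  have hqc : Continuous fun θ => q (circleMap c₀ R θ) :=
    hq.continuousOn.comp_continuous (continuous_circleMap _ _) hsph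
  set F : ℝ → ℝ → ℂ := fun θ t => deriv (circleMap c₀ R) θ *
    ((((ν : ℂ) - circleMap c₀ R θ) * q (circleMap c₀ R θ)) * (circleMap c₀ R θ - t)⁻¹) with hF
  have hmeas : Measurable (Function.uncurry F) := by
    have m1 : Measurable fun p : ℝ × ℝ => circleMap c₀ R p.1 :=
      ((continuous_circleMap c₀ R).comp continuous_fst).measurable
    have m2 : Measurable fun p : ℝ × ℝ => deriv (circleMap c₀ R) p.1 := by
      simp only [deriv_circleMap]
      exact (((continuous_circleMap 0 R).comp continuous_fst).measurable).mul_const _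
    have m3 : Measurable fun p : ℝ × ℝ => q (circleMap c₀ R p.1) :=
      (hqc.comp continuous_fst).measurable
    have m4 : Measurable fun p : ℝ × ℝ => (p.2 : ℂ) :=
      Complex.measurable_ofReal.comp measurable_snd
    exact m2.mul (((measurable_const.sub m1).mul m3).mul (m1.sub m4).inv)
  -- By `exists_circle_dist_le` the zero of the weight at ν compensates |z - t|⁻¹ uniformly in t >
  -- b, so the double integrand is bounded and Fubini applies even if the measure charges every
  -- neighbourhood of ν.
  have hInt : Integrable (Function.uncurry F)
      ((volume.restrict (Ioc 0 (2 * Real.pi))).prod μ) := by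
    refine Integrable.of_bound (C := R * (c * |M|)) hmeas.aestronglyMeasurable ?_
    filter_upwards [Measure.quasiMeasurePreserving_snd.ae hμ] with p hp
    simp only [Function.uncurry, hF]
    rw [norm_mul, norm_mul, norm_mul, deriv_circleMap, norm_mul, norm_circleMap_zero,
      Complex.norm_I, mul_one, abs_of_pos hR0, norm_inv]
    have h1 := hc _ (circleMap_mem_sphere c₀ hR0.le p.1) p.2 hp.le
    have h2 := (hM _ (hsph p.1)).trans (le_abs_self M)
    refine mul_le_mul_of_nonneg_left ?_ hR0.le
    rw [← div_eq_mul_inv]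
    refine div_le_of_le_mul₀ (norm_nonneg _) (by positivity) ?_
    calc _ ≤ (c * ‖circleMap c₀ R p.1 - p.2‖) * |M| := by gcongr
      _ = _ := by ring
  have e1 : ∀ θ, deriv (circleMap c₀ R) θ • ((((ν : ℂ) - circleMap c₀ R θ) *
      q (circleMap c₀ R θ)) * ∫ t : ℝ, (circleMap c₀ R θ - t)⁻¹ ∂μ) = ∫ t, F θ t ∂μ := by
    intro θ
    simp only [hF, smul_eq_mul]
    rw [integral_const_mul, integral_const_mul]
  refine ⟨?_, ?_⟩
  · rw [circleIntegrable_iff, intervalIntegrable_iff_integrableOn_Ioc_of_le (by positivity)]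
    simp only [e1]
    exact hInt.integral_prod_left
  rw [circleIntegral, intervalIntegral.integral_of_le (by positivity)]
  simp only [e1]
  rw [integral_integral_swap hInt, ← integral_const_mul]
  refine integral_congr_ae ?_
  filter_upwards [hμ] with t ht
  rw [← circleIntegral_kernel hab ha hq ht, circleIntegral,
    intervalIntegral.integral_of_le (by positivity)]
  rfl

/-- The atom of a measure at `ν`, from the vertical limit of the Stieltjes transform. -/
lemma tendsto_stieltjes_atom (μ : Measure ℝ) [IsFiniteMeasure μ] :
    Tendsto (fun s : ℝ => (s * Complex.I) * ∫ t : ℝ, ((ν + s * Complex.I : ℂ) - t)⁻¹ ∂μ) (𝓝[>] 0)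
      (𝓝 (μ.real {ν} : ℂ)) := by
  have e0 : ((μ.real {ν} : ℝ) : ℂ) = ∫ t, ({ν} : Set ℝ).indicator (fun _ => (1 : ℂ)) t ∂μ := by
    rw [integral_indicator_const _ (measurableSet_singleton ν)]
    simp
  rw [e0]
  simp only [← integral_const_mul]
  have hnorm : ∀ s : ℝ, 0 < s → ∀ t : ℝ, s ≤ ‖(ν + s * Complex.I : ℂ) - t‖ := fun s hs t => by
    have := Complex.abs_im_le_norm ((ν + s * Complex.I : ℂ) - t)
    simpa [abs_of_pos hs] using this
  refine tendsto_integral_filter_of_dominated_convergence (fun _ => 1) ?_ ?_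
    (integrable_const _) ?_
  · refine Eventually.of_forall fun s => Measurable.aestronglyMeasurable ?_
    fun_prop
  · filter_upwards [self_mem_nhdsWithin] with s hs
    refine ae_of_all _ fun t => ?_
    have hs' : 0 < s := hs
    have h1 := hnorm s hs t
    rw [norm_mul, norm_mul, Complex.norm_I, mul_one, Complex.norm_real, Real.norm_eq_abs,
      abs_of_pos hs', norm_inv, ← div_eq_mul_inv]
    exact div_le_one_of_le₀ h1 (norm_nonneg _)
  · refine ae_of_all _ fun t => ?_
    rcases eq_or_ne t ν with rfl | hne
    · rw [indicator_of_mem (mem_singleton t)]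
      refine tendsto_const_nhds.congr' ?_
      filter_upwards [self_mem_nhdsWithin] with s hs
      have hs' : (s : ℂ) ≠ 0 := by simpa using ne_of_gt (mem_Ioi.1 hs)
      rw [add_sub_cancel_left, mul_inv_cancel₀ (mul_ne_zero hs' Complex.I_ne_zero)]
    · rw [indicator_of_notMem (by simpa using hne)]
      have hne' : ((ν : ℂ) + (0 : ℝ) * Complex.I) - t ≠ 0 := by
        simpa [sub_eq_zero] using hne.symm
      have h1 : ContinuousAt (fun s : ℝ => (s * Complex.I) * ((ν + s * Complex.I : ℂ) - t)⁻¹) 0 := by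
        refine ContinuousAt.mul (by fun_prop) (ContinuousAt.inv₀ (by fun_prop) hne')
      have h2 := h1.tendsto
      simp only [Complex.ofReal_zero, zero_mul] at h2
      exact h2.mono_left nhdsWithin_le_nhds

end Circle

/-! ### Removal of the condition that the weight vanish at ν. -/

section Circle

variable {a b ν : ℝ}

/-- The regularisation at `ν` of a weight. -/
def regularized (f : ℂ → ℂ) (ν : ℝ) (n : ℕ) (z : ℂ) : ℂ := f z / ((ν : ℂ) + ((n : ℂ) + 1)⁻¹ - z)

lemma regularized_denom (ν : ℝ) (n : ℕ) (z : ℂ) :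
    ((ν : ℂ) + ((n : ℂ) + 1)⁻¹ - z).re = ν + ((n : ℝ) + 1)⁻¹ - z.re ∧
      ((ν : ℂ) + ((n : ℂ) + 1)⁻¹ - z).im = -z.im := by
  have : ((n : ℂ) + 1)⁻¹ = ((((n : ℝ) + 1)⁻¹ : ℝ) : ℂ) := by push_cast; rfl
  rw [this]
  constructor <;> simp [-Complex.ofReal_inv]

lemma regularized_denom_ne_zero (n : ℕ) {z : ℂ} (hz : z.re ≤ ν) :
    (ν : ℂ) + ((n : ℂ) + 1)⁻¹ - z ≠ 0 := fun h0 => by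
  have h1 := (regularized_denom ν n z).1
  rw [h0, Complex.zero_re] at h1
  have : (0 : ℝ) < ((n : ℝ) + 1)⁻¹ := by positivity
  linarith

/-- For Re z ≤ ν, shifting the pole from ν to the right increases its distance from z. This provides
a bound independent of n. -/
lemma norm_mul_regularized_le (f : ℂ → ℂ) (n : ℕ) {z : ℂ} (hz : z.re ≤ ν) :
    ‖((ν : ℂ) - z) * regularized f ν n z‖ ≤ ‖f z‖ := by
  rw [regularized, mul_div_assoc', norm_div, norm_mul]
  have hpos : 0 < ‖(ν : ℂ) + ((n : ℂ) + 1)⁻¹ - z‖ :=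
    norm_pos_iff.2 (regularized_denom_ne_zero n hz)
  rw [div_le_iff₀ hpos, mul_comm]
  gcongr
  obtain ⟨h1, h2⟩ := regularized_denom ν n z
  have h3 : (0 : ℝ) < ((n : ℝ) + 1)⁻¹ := by positivity
  refine (pow_le_pow_iff_left₀ (norm_nonneg _) (norm_nonneg _) two_ne_zero).1 ?_
  rw [← Complex.normSq_eq_norm_sq, ← Complex.normSq_eq_norm_sq, Complex.normSq_apply,
    Complex.normSq_apply, h1, h2]
  simp only [Complex.sub_re, Complex.sub_im, Complex.ofReal_re, Complex.ofReal_im, zero_sub]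
  nlinarith

lemma tendsto_mul_regularized (f : ℂ → ℂ) {z : ℂ} (hz : z ≠ ν) :
    Tendsto (fun n => ((ν : ℂ) - z) * regularized f ν n z) atTop (𝓝 (f z)) := by
  have hne : (ν : ℂ) - z ≠ 0 := sub_ne_zero.2 hz.symm
  have h1 : Tendsto (fun n : ℕ => ((n : ℂ) + 1)⁻¹) atTop (𝓝 0) := by
    have := (Complex.continuous_ofReal.tendsto 0).comp
      (tendsto_one_div_add_atTop_nhds_zero_nat (𝕜 := ℝ))
    simpa [Function.comp_def] using this
  have h2 : Tendsto (fun n : ℕ => (ν : ℂ) + ((n : ℂ) + 1)⁻¹ - z) atTop (𝓝 ((ν : ℂ) + 0 - z)) :=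
    (h1.const_add _).sub_const z
  rw [add_zero] at h2
  have h3 := (tendsto_const_nhds (x := f z) (f := atTop)).div h2 hne |>.const_mul ((ν : ℂ) - z)
  rwa [mul_div_cancel₀ _ hne] at h3

lemma differentiableOn_regularized {f : ℂ → ℂ} (hf : Differentiable ℂ f) (n : ℕ) :
    DifferentiableOn ℂ (regularized f ν n)
      (Metric.closedBall (((a + ν) / 2 : ℝ) : ℂ) ((ν - a) / 2)) := by
  refine hf.differentiableOn.div ((differentiableOn_const _).sub differentiableOn_id) fun z hz => ?_
  exact regularized_denom_ne_zero n (re_le_of_mem_closedBall hz)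

lemma tendsto_integral_regularized {f : ℂ → ℂ} (hf : Continuous f) (μ : Measure ℝ)
    [IsFiniteMeasure μ] (hμ : ∀ᵐ t ∂μ, b < t) :
    Tendsto (fun n => ∫ t, (Iio ν).indicator
        (fun t : ℝ => ((ν : ℂ) - t) * regularized f ν n t) t ∂μ) atTop
      (𝓝 (∫ t, (Iio ν).indicator (fun t : ℝ => f t) t ∂μ)) := by
  obtain ⟨M, hM⟩ := (isCompact_Icc (a := b) (b := ν)).exists_bound_of_continuousOn
    (hf.comp Complex.continuous_ofReal).continuousOn
  refine tendsto_integral_of_dominated_convergence (fun _ => |M|) (fun n => ?_)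
    (integrable_const _) (fun n => ?_) ?_
  · refine ((Measurable.mul ?_ ?_).indicator measurableSet_Iio).aestronglyMeasurable
    · fun_prop
    · unfold regularized
      exact (hf.measurable.comp Complex.measurable_ofReal).div (by fun_prop)
  · filter_upwards [hμ] with t ht
    by_cases h : t < ν
    · rw [indicator_of_mem (mem_Iio.2 h)]
      refine (norm_mul_regularized_le f n (by simpa using h.le)).trans ?_
      exact (hM t ⟨ht.le, h.le⟩).trans (le_abs_self M)
    · rw [indicator_of_notMem (by simpa using h), norm_zero]
      exact abs_nonneg M
  · refine ae_of_all _ fun t => ?_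
    by_cases h : t < ν
    · simp only [indicator_of_mem (mem_Iio.2 h)]
      exact tendsto_mul_regularized f (by simpa using h.ne)
    · simp only [indicator_of_notMem (show t ∉ Iio ν by simpa using h)]
      exact tendsto_const_nhds

lemma integral_indicator_Iic {f : ℝ → ℂ} (hf : Continuous f) (μ : Measure ℝ)
    [IsFiniteMeasure μ] (hμ : ∀ᵐ t ∂μ, b < t) :
    ∫ t, (Iic ν).indicator f t ∂μ = (∫ t, (Iio ν).indicator f t ∂μ) + μ.real {ν} * f ν := by
  obtain ⟨M, hM⟩ := (isCompact_Icc (a := b) (b := ν)).exists_bound_of_continuousOn hf.continuousOn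
  have h1 : Integrable ((Iio ν).indicator f) μ := by
    refine Integrable.of_bound (C := |M|)
      (hf.measurable.indicator measurableSet_Iio).aestronglyMeasurable ?_
    filter_upwards [hμ] with t ht
    by_cases h : t < ν
    · rw [indicator_of_mem (mem_Iio.2 h)]
      exact (hM t ⟨ht.le, h.le⟩).trans (le_abs_self M)
    · rw [indicator_of_notMem (by simpa using h), norm_zero]
      exact abs_nonneg M
  have h2 : Integrable (({ν} : Set ℝ).indicator fun _ => f ν) μ :=
    (integrable_const _).indicator (measurableSet_singleton ν)
  have h3 : (μ.real {ν} : ℂ) * f ν = ∫ t, ({ν} : Set ℝ).indicator (fun _ => f ν) t ∂μ := by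
    rw [integral_indicator_const _ (measurableSet_singleton ν), Complex.real_smul]
  rw [h3, ← integral_add h1 h2]
  congr 1; ext t
  rcases lt_trichotomy t ν with h | rfl | h
  · simp [indicator, h.le, h, h.ne]
  · simp [indicator]
  · simp [indicator, not_le.2 h, not_lt.2 h.le, h.ne']

/-- Cauchy's formula on the circle with diameter `[a, ν]` for the difference of the Stieltjes
transforms of two measures with the same mass at `ν`. -/
lemma circleIntegral_stieltjes_sub (hab : a < b) (ha : a < ν) {f : ℂ → ℂ}
    (hf : Differentiable ℂ f) (μ μ' : Measure ℝ) [IsFiniteMeasure μ] [IsFiniteMeasure μ']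
    (hμ : ∀ᵐ t ∂μ, b < t) (hμ' : ∀ᵐ t ∂μ', b < t) (hatom : μ'.real {ν} = μ.real {ν})
    (hInt : CircleIntegrable (fun z => (∫ t : ℝ, (z - t)⁻¹ ∂μ') - ∫ t : ℝ, (z - t)⁻¹ ∂μ)
      (((a + ν) / 2 : ℝ) : ℂ) ((ν - a) / 2)) :
    (∮ z in C((((a + ν) / 2 : ℝ) : ℂ), ((ν - a) / 2)),
      f z * ((∫ t : ℝ, (z - t)⁻¹ ∂μ') - ∫ t : ℝ, (z - t)⁻¹ ∂μ)) =
      2 * Real.pi * Complex.I * ((∫ t, (Iic ν).indicator (fun t : ℝ => f t) t ∂μ') -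
        ∫ t, (Iic ν).indicator (fun t : ℝ => f t) t ∂μ) := by
  have hfr : Continuous fun t : ℝ => f t := hf.continuous.comp Complex.continuous_ofReal
  -- Regularised weights reach only the open half-line t < ν. The atoms at ν contribute equally to
  -- both measures and cancel.
  rw [integral_indicator_Iic hfr μ hμ, integral_indicator_Iic hfr μ' hμ', hatom,
    add_sub_add_right_eq_sub]
  set c₀ : ℂ := (((a + ν) / 2 : ℝ) : ℂ) with hc₀
  set R := (ν - a) / 2 with hR
  have hR0 : 0 < R := by rw [hR]; linarith
  set φ : ℂ → ℂ := fun z => (∫ t : ℝ, (z - t)⁻¹ ∂μ') - ∫ t : ℝ, (z - t)⁻¹ ∂μ with hφ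
  have hsph : ∀ θ, circleMap c₀ R θ ∈ Metric.closedBall c₀ R := fun θ =>
    Metric.sphere_subset_closedBall (circleMap_mem_sphere _ hR0.le θ)
  obtain ⟨M, hM⟩ := (isCompact_closedBall c₀ R).exists_bound_of_continuousOn
    hf.continuous.continuousOn
  have hsplit : ∀ n, CircleIntegrable (fun z => (((ν : ℂ) - z) * regularized f ν n z) * φ z) c₀ R ∧
      (∮ z in C(c₀, R), (((ν : ℂ) - z) * regularized f ν n z) * φ z) =
      2 * Real.pi * Complex.I * ((∫ t, (Iio ν).indicator
        (fun t : ℝ => ((ν : ℂ) - t) * regularized f ν n t) t ∂μ') - ∫ t, (Iio ν).indicator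
        (fun t : ℝ => ((ν : ℂ) - t) * regularized f ν n t) t ∂μ) := by
    intro n
    obtain ⟨i1, e1⟩ := circleIntegral_stieltjes hab ha (differentiableOn_regularized hf n) μ hμ
    obtain ⟨i2, e2⟩ := circleIntegral_stieltjes hab ha (differentiableOn_regularized hf n) μ' hμ'
    simp only [hφ, mul_sub]
    refine ⟨i2.sub i1, ?_⟩
    rw [circleIntegral.integral_sub i2 i1, e1, e2]
  -- Domination needs integrability only of the difference of the two transforms on the circle; each
  -- transform alone may be too singular at ν.
  have hlim1 : Tendsto (fun n => ∮ z in C(c₀, R), (((ν : ℂ) - z) * regularized f ν n z) * φ z)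
      atTop (𝓝 (∮ z in C(c₀, R), f z * φ z)) := by
    refine intervalIntegral.tendsto_integral_filter_of_dominated_convergence
      (fun θ => |M| * ‖deriv (circleMap c₀ R) θ • φ (circleMap c₀ R θ)‖)
      (Eventually.of_forall fun n => ?_) (Eventually.of_forall fun n => ?_) ?_ ?_
    · exact (intervalIntegrable_iff.1 ((circleIntegrable_iff R).1 (hsplit n).1)).aestronglyMeasurable
    · refine ae_of_all _ fun θ _ => ?_
      rw [smul_eq_mul, smul_eq_mul, norm_mul, norm_mul, norm_mul _ (φ _), mul_left_comm]
      have h1 := (norm_mul_regularized_le f n (re_le_of_mem_closedBall (hsph θ))).trans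
        ((hM _ (hsph θ)).trans (le_abs_self M))
      gcongr
    · exact ((circleIntegrable_iff R).1 hInt).norm.const_mul _
    · have h0 : ∀ᵐ θ : ℝ, θ ≠ 2 * Real.pi :=
        measure_eq_zero_iff_ae_notMem.1 (measure_singleton (2 * Real.pi))
      filter_upwards [h0] with θ hne hθ
      rw [uIoc_of_le (by positivity)] at hθ
      have hθ' : θ ∈ Ioo 0 (2 * Real.pi) := ⟨hθ.1, hθ.2.lt_of_ne hne⟩
      have hzne : circleMap c₀ R θ ≠ ν := fun h1 => by
        have := circleMap_re_lt ha hθ'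
        rw [← hc₀, ← hR, h1] at this
        simp at this
      exact ((tendsto_mul_regularized f hzne).mul_const _).const_smul _
  have hlim2 := ((tendsto_integral_regularized hf.continuous μ' hμ' (ν := ν)).sub
    (tendsto_integral_regularized hf.continuous μ hμ (ν := ν))).const_mul
      (2 * Real.pi * Complex.I : ℂ)
  exact tendsto_nhds_unique hlim1 (hlim2.congr fun n => ((hsplit n).2).symm)

end Circle

/-! ### Integrals of trace class operators -/

/-- Countability makes the filter of finite index sets countably generated, as dominated convergence
in `trace_integral` requires. Balls of radius 1/2 around the basis vectors are disjoint. -/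
lemma countable_basisIndex [TopologicalSpace.SeparableSpace E] : Countable (BasisIndex E) := by
  have hdist : ∀ i j : BasisIndex E, i ≠ j → 1 ≤ dist (basis E i) (basis E j) := by
    intro i j hij
    have h0 : ⟪basis E i, basis E j⟫_ℂ = 0 := (basis E).orthonormal.2 hij
    have h1 := norm_sub_sq (𝕜 := ℂ) (basis E i) (basis E j)
    rw [h0, norm_basis, norm_basis, map_zero] at h1
    rw [dist_eq_norm]
    nlinarith [norm_nonneg (basis E i - basis E j)]
  have hd : (univ : Set (BasisIndex E)).PairwiseDisjoint
      fun i => Metric.ball (basis E i) (1 / 2) := fun i _ j _ hij =>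
    Metric.ball_disjoint_ball (by norm_num; exact hdist i j hij)
  exact countable_univ_iff.1 (hd.countable_of_isOpen (fun _ _ => Metric.isOpen_ball)
    fun i _ => ⟨basis E i, Metric.mem_ball_self (by norm_num)⟩)

section IntegralTraceClass

variable {α : Type*} [MeasurableSpace α] {μ : Measure α} {T : α → E →L[ℂ] E}

lemma inner_integral_apply (hT : Integrable T μ) (x y : E) :
    ⟪y, (∫ t, T t ∂μ) x⟫_ℂ = ∫ t, ⟪y, T t x⟫_ℂ ∂μ := by
  rw [ContinuousLinearMap.integral_apply hT]
  exact ((innerSL ℂ y).integral_comp_comm (hT.apply_continuousLinearMap x)).symm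

lemma integrable_inner_apply (hT : Integrable T μ) (x y : E) :
    Integrable (fun t => ⟪y, T t x⟫_ℂ) μ :=
  (innerSL ℂ y).integrable_comp (hT.apply_continuousLinearMap x)

lemma sum_inner_integral_apply (hT : Integrable T μ) (W : E →L[ℂ] E)
    (s : Finset (BasisIndex E)) :
    ∑ i ∈ s, ⟪W (basis E i), (∫ t, T t ∂μ) (basis E i)⟫_ℂ =
      ∫ t, ∑ i ∈ s, ⟪W (basis E i), T t (basis E i)⟫_ℂ ∂μ := by
  simp only [inner_integral_apply hT]
  rw [integral_finsetSum _ fun i _ => integrable_inner_apply hT _ _]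

/-- The integral is a Bochner integral in operator norm. The duality criterion involves only finite
sums of matrix elements, which commute with it, so measurability in trace norm plays no role. -/
lemma isTraceClass_integral (hT : Integrable T μ) {β : α → ℝ} (hβ : Integrable β μ)
    (hb : ∀ᵐ t ∂μ, IsTraceClass (T t) ∧ trNorm (T t) ≤ β t) : IsTraceClass (∫ t, T t ∂μ) := by
  refine isTraceClass_of_bound (C := ∫ t, β t ∂μ) fun W hW s => ?_
  rw [sum_inner_integral_apply hT]
  refine norm_integral_le_of_norm_le hβ ?_
  filter_upwards [hb] with t ht
  exact (ht.1.norm_sum_contraction_le hW s).trans ht.2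

lemma trace_integral [TopologicalSpace.SeparableSpace E] (hT : Integrable T μ) {β : α → ℝ}
    (hβ : Integrable β μ) (hb : ∀ᵐ t ∂μ, IsTraceClass (T t) ∧ trNorm (T t) ≤ β t) :
    trace (∫ t, T t ∂μ) = ∫ t, trace (T t) ∂μ := by
  have := countable_basisIndex (E := E)
  have h1 := (isTraceClass_integral hT hβ hb).hasSum_trace
  refine tendsto_nhds_unique h1 ?_
  have hW : ‖(1 : E →L[ℂ] E)‖ ≤ 1 := ContinuousLinearMap.norm_id_le
  have h2 : ∀ s : Finset (BasisIndex E),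
      ∑ i ∈ s, ⟪basis E i, (∫ t, T t ∂μ) (basis E i)⟫_ℂ =
      ∫ t, ∑ i ∈ s, ⟪basis E i, T t (basis E i)⟫_ℂ ∂μ := fun s => by
    simpa using sum_inner_integral_apply hT 1 s
  refine Tendsto.congr (fun s => (h2 s).symm) ?_
  refine tendsto_integral_filter_of_dominated_convergence β (Eventually.of_forall fun s => ?_)
    (Eventually.of_forall fun s => ?_) hβ ?_
  · exact (integrable_finsetSum _ fun i _ =>
      integrable_inner_apply hT (basis E i) (basis E i)).aestronglyMeasurable
  · filter_upwards [hb] with t ht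
    exact (ht.1.norm_sum_contraction_le hW s).trans ht.2
  · filter_upwards [hb] with t ht using ht.1.hasSum_trace

end IntegralTraceClass

/-! ### Resolvent differences near a point of the real line -/

lemma IsTraceClass.trNorm_sandwich_le {A : E →L[ℂ] E} (hA : IsTraceClass A) {X Y : E →L[ℂ] E}
    {c : ℝ} (hX : ‖X‖ ≤ c) (hY : ‖Y‖ ≤ c) : trNorm (X * A * Y) ≤ c ^ 2 * trNorm A := by
  have hc : 0 ≤ c := (norm_nonneg _).trans hX
  have := trNorm_nonneg A
  calc trNorm (X * A * Y) ≤ ‖X‖ * trNorm A * ‖Y‖ := hA.trNorm_mul_mul_le X Y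
    _ ≤ c * trNorm A * c := by gcongr
    _ = c ^ 2 * trNorm A := by ring

namespace PerturbationData

variable {H : E →ₗ.[ℂ] E} {V J : E →L[ℂ] E} (h : PerturbationData H V J)

include h

lemma trNorm_resolventDiff_le {z w : ℂ} (hz : z ∉ jointSpectrum H V)
    (hw : w ∉ jointSpectrum H V) {c : ℝ} (h1 : ‖w - z‖ * ‖opResolvent H z‖ ≤ c)
    (h2 : ‖w - z‖ * ‖opResolvent (perturbed H V) z‖ ≤ c) :
    trNorm (resolventDiff H V z) ≤ (1 + c) ^ 2 * trNorm (resolventDiff H V w) := by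
  rw [resolventDiff_transfer (notMem_left hz) (notMem_right hz) (notMem_left hw)
    (notMem_right hw)]
  have hone : ‖(1 : E →L[ℂ] E)‖ ≤ 1 := ContinuousLinearMap.norm_id_le
  refine (h.isTraceClass_resolventDiff hw).trNorm_sandwich_le ?_ ?_
  · exact (norm_add_le _ _).trans (add_le_add hone (by rwa [norm_smul]))
  · exact (norm_add_le _ _).trans (add_le_add hone (by rwa [norm_smul]))

/-- The resolvent difference is bounded in trace norm on compact subsets of the cut plane. -/
lemma exists_trNorm_le_of_isCompact {K : Set ℂ} (hK : K ⊆ (jointSpectrum H V)ᶜ)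
    (hKc : IsCompact K) : ∃ M, ∀ z ∈ K, trNorm (resolventDiff H V z) ≤ M := by
  have hI : Complex.I ∉ jointSpectrum H V := h.notMem_of_im_ne_zero (by simp)
  have c1 : ContinuousOn (fun z => ‖Complex.I - z‖ * ‖opResolvent H z‖) K := fun z hz =>
    (ContinuousAt.mul (by fun_prop)
      (continuousAt_opResolvent (notMem_left (hK hz))).norm).continuousWithinAt
  have c2 : ContinuousOn (fun z => ‖Complex.I - z‖ * ‖opResolvent (perturbed H V) z‖) K :=
    fun z hz => (ContinuousAt.mul (by fun_prop)
      (continuousAt_opResolvent (notMem_right (hK hz))).norm).continuousWithinAt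
  obtain ⟨M₁, h₁⟩ := hKc.exists_bound_of_continuousOn c1
  obtain ⟨M₂, h₂⟩ := hKc.exists_bound_of_continuousOn c2
  refine ⟨(1 + max M₁ M₂) ^ 2 * trNorm (resolventDiff H V Complex.I), fun z hz => ?_⟩
  refine h.trNorm_resolventDiff_le (hK hz) hI ?_ ?_
  · exact (le_abs_self _).trans ((h₁ z hz).trans (le_max_left _ _))
  · exact (le_abs_self _).trans ((h₂ z hz).trans (le_max_right _ _))

/-- Compare z with w = ν + i |Im z|. Their distance is at most 3 |Im z| and both resolvents at z
have norm at most |Im z|⁻¹, so the transfer costs the factor (1 + 3)² = 16. -/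
lemma trNorm_resolventDiff_sector {ν C r : ℝ}
    (hb : ∀ s : ℝ, 0 < s → s < r → trNorm (resolventDiff H V (ν + s * Complex.I)) ≤ C) {z : ℂ}
    (hz : z.im ≠ 0) (hzr : |z.im| < r) (hsec : |z.re - ν| ≤ |z.im|) :
    trNorm (resolventDiff H V z) ≤ 16 * C := by
  set s := |z.im| with hs
  have hs0 : 0 < s := abs_pos.2 hz
  set w : ℂ := ν + s * Complex.I with hw
  have hwim : w.im = s := by simp [hw]
  have hwre : w.re = ν := by simp [hw]
  have hwn : w ∉ jointSpectrum H V := h.notMem_of_im_ne_zero (by rw [hwim]; exact hs0.ne')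
  have hzn : z ∉ jointSpectrum H V := h.notMem_of_im_ne_zero hz
  have hd : ‖w - z‖ ≤ 3 * s := by
    refine (Complex.norm_le_abs_re_add_abs_im _).trans ?_
    rw [Complex.sub_re, Complex.sub_im, hwim, hwre, abs_sub_comm]
    have : |s - z.im| ≤ |s| + |z.im| := abs_sub _ _
    rw [abs_of_pos hs0, ← hs] at this
    linarith
  have hR : ∀ H' : E →ₗ.[ℂ] E, IsSelfAdjoint H' → ‖w - z‖ * ‖opResolvent H' z‖ ≤ 3 := by
    intro H' hH'
    calc ‖w - z‖ * ‖opResolvent H' z‖ ≤ 3 * s * s⁻¹ := by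
          gcongr
          exact norm_opResolvent_le hH' hz
      _ = 3 := by field_simp
  have h1 := h.trNorm_resolventDiff_le hzn hwn (hR _ h.selfAdjoint) (hR _ h.selfAdjoint')
  have h2 := hb s hs0 hzr
  calc _ ≤ (1 + 3) ^ 2 * trNorm (resolventDiff H V w) := h1
    _ ≤ (1 + 3) ^ 2 * C := by gcongr
    _ = 16 * C := by norm_num

lemma continuousOn_resolventDiff : ContinuousOn (resolventDiff H V) (jointSpectrum H V)ᶜ :=
  fun _ hz => ((continuousAt_opResolvent (notMem_right hz)).sub
    (continuousAt_opResolvent (notMem_left hz))).continuousWithinAt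

end PerturbationData

lemma one_le_rpow_neg_half {y : ℝ} (hy : 0 < y) (hy1 : y ≤ 1) : 1 ≤ y ^ (-(1 / 2) : ℝ) :=
  Real.one_le_rpow_of_pos_of_le_one_of_nonpos hy hy1 (by norm_num)

/-! ### The circle as a contour -/

section CircleContour

/-- The circle with diameter `[a, ν]`, run through from `ν`. -/
def circleContour (a ν t : ℝ) : ℂ :=
  circleMap (((a + ν) / 2 : ℝ) : ℂ) ((ν - a) / 2) (2 * Real.pi * t)

variable {a ν : ℝ}

lemma hasDerivAt_circleContour (a ν t : ℝ) : HasDerivAt (circleContour a ν)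
    ((2 * Real.pi : ℝ) * deriv (circleMap (((a + ν) / 2 : ℝ) : ℂ) ((ν - a) / 2))
      (2 * Real.pi * t)) t := by
  have h1 : HasDerivAt (fun t : ℝ => 2 * Real.pi * t) (2 * Real.pi) t := by
    simpa using (hasDerivAt_id t).const_mul (2 * Real.pi)
  have h2 := ((differentiable_circleMap (((a + ν) / 2 : ℝ) : ℂ) ((ν - a) / 2))
    (2 * Real.pi * t)).hasDerivAt.scomp t h1
  rwa [Complex.real_smul] at h2

lemma circleContour_re (a ν t : ℝ) : (circleContour a ν t).re =
    (a + ν) / 2 + (ν - a) / 2 * Real.cos (2 * Real.pi * t) := circleMap_re a ν _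

lemma circleContour_im (a ν t : ℝ) : (circleContour a ν t).im =
    (ν - a) / 2 * Real.sin (2 * Real.pi * t) := circleMap_im a ν _

lemma circleContour_zero : circleContour a ν 0 = ν := by
  apply Complex.ext
  · rw [circleContour_re]; simp; ring
  · rw [circleContour_im]; simp

lemma circleContour_one : circleContour a ν 1 = ν := by
  apply Complex.ext
  · rw [circleContour_re]; simp; ring
  · rw [circleContour_im]; simp

lemma circleIntegral_eq_contour (g : ℂ → ℂ) :
    (∮ z in C((((a + ν) / 2 : ℝ) : ℂ), ((ν - a) / 2)), g z) =
      ∫ t in (0 : ℝ)..1, g (circleContour a ν t) * deriv (circleContour a ν) t := by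
  have h1 := intervalIntegral.smul_integral_comp_mul_left (a := 0) (b := 1) (fun θ : ℝ =>
    deriv (circleMap (((a + ν) / 2 : ℝ) : ℂ) ((ν - a) / 2)) θ •
      g (circleMap (((a + ν) / 2 : ℝ) : ℂ) ((ν - a) / 2) θ)) (2 * Real.pi)
  rw [mul_zero, mul_one] at h1
  rw [circleIntegral, ← h1, ← intervalIntegral.integral_smul]
  congr 1; ext t
  rw [(hasDerivAt_circleContour a ν t).deriv, Complex.real_smul, smul_eq_mul, circleContour]
  ring

lemma circleIntegrable_of_contour {g : ℂ → ℂ} (hg : IntervalIntegrable (fun t =>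
    g (circleContour a ν t) * deriv (circleContour a ν) t) volume 0 1) :
    CircleIntegrable g (((a + ν) / 2 : ℝ) : ℂ) ((ν - a) / 2) := by
  have hπ : (2 * Real.pi) ≠ 0 := by positivity
  rw [circleIntegrable_iff, ← IntervalIntegrable.comp_mul_left_iff hπ, zero_div, div_self hπ]
  refine (hg.const_mul ((2 * Real.pi : ℝ) : ℂ)⁻¹).congr fun t _ => ?_
  have hπ' : ((2 * Real.pi : ℝ) : ℂ) ≠ 0 := by exact_mod_cast hπ
  rw [(hasDerivAt_circleContour a ν t).deriv, smul_eq_mul, circleContour]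
  field_simp

lemma isFermiContour_circleContour {H : E →ₗ.[ℂ] E} {V : E →L[ℂ] E} (ha : IsBelowSpectra H V a)
    (haν : a < ν) : IsFermiContour H V ν (circleContour a ν) := by
  have hπ := Real.pi_pos
  have hcont : Continuous (circleContour a ν) :=
    continuous_iff_continuousAt.2 fun t => (hasDerivAt_circleContour a ν t).continuousAt
  have hd : deriv (circleContour a ν) = fun t => (2 * Real.pi : ℝ) *
      (circleMap 0 ((ν - a) / 2) (2 * Real.pi * t) * Complex.I) := by
    ext t
    rw [(hasDerivAt_circleContour a ν t).deriv, deriv_circleMap]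
  have hend : ∀ t : ℝ, circleMap 0 ((ν - a) / 2) (2 * Real.pi * t) = (((ν - a) / 2 : ℝ) : ℂ) →
      ∃ v : ℝ, 0 < v ∧ HasDerivAt (circleContour a ν) (v * Complex.I) t := fun t ht => by
    refine ⟨2 * Real.pi * ((ν - a) / 2), mul_pos (by positivity) (by linarith), ?_⟩
    have h1 := hasDerivAt_circleContour a ν t
    rw [deriv_circleMap, ht] at h1
    convert h1 using 1
    push_cast; ring
  have hsin : ∀ t : ℝ, Real.sin (2 * Real.pi * t) = -Real.sin (2 * Real.pi * t - Real.pi) :=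
    fun t => by rw [Real.sin_sub_pi, neg_neg]
  refine ⟨hcont.continuousOn, ⟨∅, 2 * Real.pi * ((ν - a) / 2), ?_, ?_⟩, circleContour_zero,
    circleContour_one, ?_, ?_, 1 / 2, by norm_num, ?_, ?_, ?_, ?_, ?_⟩
  · intro t _
    refine ⟨(hasDerivAt_circleContour a ν t).differentiableAt, le_of_eq ?_⟩
    rw [hd]
    simp only
    rw [norm_mul, norm_mul, Complex.norm_I, mul_one, norm_circleMap_zero, Complex.norm_real,
      Real.norm_of_nonneg (by positivity), abs_of_nonneg (by linarith)]
  · rw [hd]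
    have : Continuous fun t : ℝ => circleMap 0 ((ν - a) / 2) (2 * Real.pi * t) :=
      (continuous_circleMap _ _).comp (by fun_prop)
    exact (continuous_const.mul (this.mul continuous_const)).continuousOn
  · obtain ⟨v, hv, hv2⟩ := hend 0 (by simp [circleMap])
    exact ⟨v, hv, hv2.hasDerivWithinAt⟩
  · obtain ⟨v, hv, hv2⟩ := hend 1 (by simp [circleMap])
    exact ⟨v, hv, hv2.hasDerivWithinAt⟩
  · rw [circleContour_im]
    have : 2 * Real.pi * (1 / 2) = Real.pi := by ring
    rw [this, Real.sin_pi, mul_zero]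
  · rw [circleContour_re]
    have : 2 * Real.pi * (1 / 2) = Real.pi := by ring
    rw [this, Real.cos_pi]
    linarith
  · rw [circleContour_re]
    have : 2 * Real.pi * (1 / 2) = Real.pi := by ring
    rw [this, Real.cos_pi]
    convert ha using 1
    ring
  · intro t ht
    rw [circleContour_im]
    refine mul_pos (by linarith) (Real.sin_pos_of_pos_of_lt_pi ?_ ?_)
    · exact mul_pos (by positivity) ht.1
    · nlinarith [ht.2]
  · intro t ht
    rw [circleContour_im, hsin]
    have : 0 < Real.sin (2 * Real.pi * t - Real.pi) :=
      Real.sin_pos_of_pos_of_lt_pi (by nlinarith [ht.1]) (by nlinarith [ht.2])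
    have h2 : 0 < (ν - a) / 2 := by linarith
    nlinarith

end CircleContour

/-! ### The energy operator as a contour integral -/

namespace PerturbationData

variable {H : E →ₗ.[ℂ] E} {V J : E →L[ℂ] E} (h : PerturbationData H V J)

include h

lemma sectorBound_of_le_trNorm {ν C r A : ℝ} (hA : 0 ≤ A) (hC : 0 ≤ C)
    (hb : ∀ s : ℝ, 0 < s → s < r → trNorm (resolventDiff H V (ν + s * Complex.I)) ≤ C)
    {g : ℂ → ℂ} (hg : ∀ z : ℂ, z.im ≠ 0 → ‖g z‖ ≤ A * trNorm (resolventDiff H V z)) :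
    SectorBound g ν (A * (16 * C)) (min r 1) := by
  intro z hz hzr hsec
  have h1 := h.trNorm_resolventDiff_sector hb hz (hzr.trans_le (min_le_left _ _)) hsec
  calc ‖g z‖ ≤ A * trNorm (resolventDiff H V z) := hg z hz
    _ ≤ A * (16 * C) * 1 := by rw [mul_one]; gcongr
    _ ≤ _ := by
      gcongr
      exact one_le_rpow_neg_half (abs_pos.2 hz) (hzr.le.trans (min_le_right _ _))

lemma exists_contour_bound {ν C r : ℝ} (hC : 0 ≤ C) (hr : 0 < r)
    (hb : ∀ s : ℝ, 0 < s → s < r → trNorm (resolventDiff H V (ν + s * Complex.I)) ≤ C)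
    {γ : ℝ → ℂ} (hγ : IsFermiContour H V ν γ) {f : ℂ → ℂ} (hf : Continuous f) :
    ∃ β : ℝ → ℝ, IntegrableOn β (Ioo 0 1) ∧ ∀ᵐ t ∂(volume.restrict (Ioo (0 : ℝ) 1)),
      IsTraceClass ((f (γ t) * deriv γ t) • resolventDiff H V (γ t)) ∧
        trNorm ((f (γ t) * deriv γ t) • resolventDiff H V (γ t)) ≤ β t := by
  set g : ℂ → ℂ := fun z => ((trNorm (resolventDiff H V z) : ℝ) : ℂ) with hg
  have hgn : ∀ z, ‖g z‖ = trNorm (resolventDiff H V z) := fun z => by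
    rw [hg, Complex.norm_real, Real.norm_of_nonneg (trNorm_nonneg _)]
  have hsec : SectorBound g ν (1 * (16 * C)) (min r 1) :=
    h.sectorBound_of_le_trNorm zero_le_one hC hb fun z _ => by rw [hgn, one_mul]
  obtain ⟨A, hA, hbound⟩ := hγ.exists_bound (by positivity) (lt_min hr one_pos) (fun K hK hKc => by
    simp only [hgn]
    exact h.exists_trNorm_le_of_isCompact (fun z hz => h.notMem_of_mem_cutPlane (hK hz)) hKc) hsec
  obtain ⟨B, hB, hderiv⟩ := hγ.ae_deriv_le
  obtain ⟨M, hM⟩ := isCompact_Icc.exists_bound_of_continuousOn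
    (hf.comp_continuousOn hγ.continuousOn)
  refine ⟨_, IsFermiContour.integrableOn_rpow_bound (|M| * B * A), ?_⟩
  filter_upwards [hderiv, ae_restrict_mem measurableSet_Ioo] with t ht ht2
  have hD := h.isTraceClass_resolventDiff (h.notMem_of_mem_cutPlane (hγ.mem_cutPlane ht2))
  refine ⟨hD.smul _, (hD.trNorm_smul_le _).trans ?_⟩
  have h1 := hbound t ht2
  rw [hgn] at h1
  have h2 := (hM t (Ioo_subset_Icc_self ht2)).trans (le_abs_self M)
  rw [norm_mul]
  have h3 := trNorm_nonneg (resolventDiff H V (γ t))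
  calc _ ≤ |M| * B * (A * (t ^ (-(1 / 2) : ℝ) + (1 - t) ^ (-(1 / 2) : ℝ) + 1)) := by
        gcongr
        exact h2
    _ = _ := by ring

lemma integrable_contour {ν C r : ℝ} (hC : 0 ≤ C) (hr : 0 < r)
    (hb : ∀ s : ℝ, 0 < s → s < r → trNorm (resolventDiff H V (ν + s * Complex.I)) ≤ C)
    {γ : ℝ → ℂ} (hγ : IsFermiContour H V ν γ) {f : ℂ → ℂ} (hf : Continuous f) :
    IntegrableOn (fun t => (f (γ t) * deriv γ t) • resolventDiff H V (γ t)) (Ioo 0 1) := by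
  obtain ⟨β, hβ, hbd⟩ := h.exists_contour_bound hC hr hb hγ hf
  refine Integrable.mono' hβ ?_ (hbd.mono fun t ht => ht.1.norm_le_trNorm.trans ht.2)
  obtain ⟨S, B, hS1, hS2⟩ := hγ.piecewise
  have hm : MeasurableSet (Ioo (0 : ℝ) 1 \ S) := measurableSet_Ioo.diff S.measurableSet
  have hγc : ContinuousOn γ (Ioo 0 1 \ S) :=
    hγ.continuousOn.mono fun t ht => Ioo_subset_Icc_self ht.1
  have h1 : ContinuousOn (fun t => (f (γ t) * deriv γ t) • resolventDiff H V (γ t))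
      (Ioo 0 1 \ S) :=
    ((hf.comp_continuousOn hγc).mul hS2).smul (h.continuousOn_resolventDiff.comp hγc fun t ht =>
      h.notMem_of_mem_cutPlane (hγ.mem_cutPlane ht.1))
  have h2 := h1.aestronglyMeasurable (μ := volume) hm
  rwa [Measure.restrict_congr_set
    (sdiff_null_ae_eq_self (S.finite_toSet.measure_zero volume))] at h2

lemma isFiniteMeasure (x : E) : IsFiniteMeasure (spectralMeasure H x) := by
  obtain ⟨a, ha⟩ := h.exists_below
  exact isFiniteMeasure_spectralMeasure h.selfAdjoint (notMem_left (ha.notMem le_rfl)) x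

lemma isFiniteMeasure' (x : E) : IsFiniteMeasure (spectralMeasure (perturbed H V) x) := by
  obtain ⟨a, ha⟩ := h.exists_below
  exact isFiniteMeasure_spectralMeasure h.selfAdjoint' (notMem_right (ha.notMem le_rfl)) x

lemma inner_resolventDiff {z : ℂ} (hz : z ∉ jointSpectrum H V) (x : E) :
    ⟪x, resolventDiff H V z x⟫_ℂ = (∫ t : ℝ, (z - t)⁻¹ ∂(spectralMeasure (perturbed H V) x)) -
      ∫ t : ℝ, (z - t)⁻¹ ∂(spectralMeasure H x) := by
  obtain ⟨a, ha⟩ := h.exists_below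
  rw [resolventDiff, sub_apply, inner_sub_right,
    inner_opResolvent_eq h.selfAdjoint' (notMem_right (ha.notMem le_rfl)) (notMem_right hz),
    inner_opResolvent_eq h.selfAdjoint (notMem_left (ha.notMem le_rfl)) (notMem_left hz)]

lemma norm_inner_resolventDiff_le {z : ℂ} (hz : z ∉ jointSpectrum H V) (x : E) :
    ‖⟪x, resolventDiff H V z x⟫_ℂ‖ ≤ ‖x‖ ^ 2 * trNorm (resolventDiff H V z) := by
  refine (norm_inner_le_norm _ _).trans ?_
  have h1 := (resolventDiff H V z).le_opNorm x
  have h2 := (h.isTraceClass_resolventDiff hz).norm_le_trNorm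
  calc ‖x‖ * ‖resolventDiff H V z x‖ ≤ ‖x‖ * (trNorm (resolventDiff H V z) * ‖x‖) := by
        gcongr
        exact h1.trans (by gcongr)
    _ = _ := by ring

/-- `H` and `H_V` have the same eigenprojection at `ν`, if the resolvent difference is bounded. -/
lemma atom_eq {ν C r : ℝ} (hr : 0 < r)
    (hb : ∀ s : ℝ, 0 < s → s < r → trNorm (resolventDiff H V (ν + s * Complex.I)) ≤ C) (x : E) :
    (spectralMeasure (perturbed H V) x).real {ν} = (spectralMeasure H x).real {ν} := by
  have := h.isFiniteMeasure x
  have := h.isFiniteMeasure' x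
  have h1 := (tendsto_stieltjes_atom (ν := ν) (spectralMeasure (perturbed H V) x)).sub
    (tendsto_stieltjes_atom (ν := ν) (spectralMeasure H x))
  -- Multiplication by is extracts the atoms at ν from the two transforms as s → +0, whereas the
  -- bounded difference contributes only O(s).
  have h2 : Tendsto (fun s : ℝ => s * (‖x‖ ^ 2 * C)) (𝓝[>] 0) (𝓝 0) := by
    have : Tendsto (fun s : ℝ => s * (‖x‖ ^ 2 * C)) (𝓝 0) (𝓝 (0 * (‖x‖ ^ 2 * C))) :=
      (continuous_id.mul continuous_const).tendsto 0
    rw [zero_mul] at this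
    exact this.mono_left nhdsWithin_le_nhds
  have h3 : Tendsto (fun s : ℝ => (s * Complex.I) * (∫ t : ℝ, ((ν + s * Complex.I : ℂ) - t)⁻¹
      ∂(spectralMeasure (perturbed H V) x)) - (s * Complex.I) *
      ∫ t : ℝ, ((ν + s * Complex.I : ℂ) - t)⁻¹ ∂(spectralMeasure H x)) (𝓝[>] 0) (𝓝 0) := by
    refine squeeze_zero_norm' ?_ h2
    filter_upwards [Ioo_mem_nhdsGT hr] with s hs
    have hz : (ν + s * Complex.I : ℂ) ∉ jointSpectrum H V :=
      h.notMem_of_im_ne_zero (by simpa using hs.1.ne')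
    rw [← mul_sub, ← h.inner_resolventDiff hz, norm_mul, norm_mul, Complex.norm_I, mul_one,
      Complex.norm_real, Real.norm_of_nonneg hs.1.le]
    have hs0 := hs.1
    gcongr
    refine (h.norm_inner_resolventDiff_le hz x).trans ?_
    gcongr
    exact hb s hs.1 hs.2
  have h4 := tendsto_nhds_unique h1 h3
  exact_mod_cast sub_eq_zero.1 h4

lemma isBorelCalculus_cutCalculus {f : ℂ → ℂ} (hf : Continuous f) (ν : ℝ) :
    IsBorelCalculus H ((Iic ν).indicator fun t : ℝ => f (t : ℂ)) (cutCalculus H f ν) := by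
  obtain ⟨a, ha⟩ := h.exists_below
  exact isBorelCalculus_borelCalculus (exists_isBorelCalculus_cut (a := min a (ν - 1))
    h.selfAdjoint (fun w hw => (min_le_left _ _).trans_lt (ha w (Or.inl hw)))
    ((min_le_right _ _).trans_lt (by linarith)) (hf.comp Complex.continuous_ofReal))

lemma isBorelCalculus_cutCalculus' {f : ℂ → ℂ} (hf : Continuous f) (ν : ℝ) :
    IsBorelCalculus (perturbed H V) ((Iic ν).indicator fun t : ℝ => f (t : ℂ))
      (cutCalculus (perturbed H V) f ν) := by
  obtain ⟨a, ha⟩ := h.exists_below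
  exact isBorelCalculus_borelCalculus (exists_isBorelCalculus_cut (a := min a (ν - 1))
    h.selfAdjoint' (fun w hw => (min_le_left _ _).trans_lt (ha w (Or.inr hw)))
    ((min_le_right _ _).trans_lt (by linarith)) (hf.comp Complex.continuous_ofReal))

/-- For each vector x the identity of quadratic forms is Cauchy's formula for the Stieltjes
transforms of its two spectral measures; equality of the forms determines the operators. Only the
resolvent difference is integrated, since the separate resolvents may fail to be integrable along a
contour through ν. -/
lemma energyOperator_eq {ν C r : ℝ} (hC : 0 ≤ C) (hr : 0 < r)
    (hb : ∀ s : ℝ, 0 < s → s < r → trNorm (resolventDiff H V (ν + s * Complex.I)) ≤ C)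
    {f : ℂ → ℂ} (hf : Differentiable ℂ f) {a : ℝ} (ha : IsBelowSpectra H V a) (haν : a < ν) :
    energyOperator H V f ν = (2 * Real.pi * Complex.I : ℂ)⁻¹ •
      ∫ t in Ioo (0 : ℝ) 1, (f (circleContour a ν t) * deriv (circleContour a ν) t) •
        resolventDiff H V (circleContour a ν t) := by
  have hγ := isFermiContour_circleContour ha haν
  have hInt := h.integrable_contour hC hr hb hγ hf.continuous
  obtain ⟨b, hab, hbb⟩ := h.exists_gt_isBelowSpectra ha
  have hkey : ∀ x : E, ⟪x, energyOperator H V f ν x⟫_ℂ = ⟪x, ((2 * Real.pi * Complex.I : ℂ)⁻¹ •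
      ∫ t in Ioo (0 : ℝ) 1, (f (circleContour a ν t) * deriv (circleContour a ν) t) •
        resolventDiff H V (circleContour a ν t)) x⟫_ℂ := by
    intro x
    set μ := spectralMeasure H x with hμ
    set μ' := spectralMeasure (perturbed H V) x with hμ'
    have := h.isFiniteMeasure x
    have := h.isFiniteMeasure' x
    have hae : ∀ᵐ t ∂μ, b < t := ae_lt_spectralMeasure h.selfAdjoint
      (fun w hw => hbb w (Or.inl hw)) x
    have hae' : ∀ᵐ t ∂μ', b < t := ae_lt_spectralMeasure h.selfAdjoint'
      (fun w hw => hbb w (Or.inr hw)) x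
    set φ : ℂ → ℂ := fun z => (∫ t : ℝ, (z - t)⁻¹ ∂μ') - ∫ t : ℝ, (z - t)⁻¹ ∂μ with hφ
    have hφD : ∀ z ∈ cutPlane H V, φ z = ⟪x, resolventDiff H V z x⟫_ℂ := fun z hz =>
      (h.inner_resolventDiff (h.notMem_of_mem_cutPlane hz) x).symm
    have hφc : ContinuousOn φ (cutPlane H V) := by
      refine ContinuousOn.congr ?_ hφD
      have h1 : ContinuousOn (fun z => resolventDiff H V z x) (cutPlane H V) :=
        (h.continuousOn_resolventDiff.mono fun z hz => h.notMem_of_mem_cutPlane hz).clm_apply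
          continuousOn_const
      exact continuousOn_const.inner h1
    have hφs : SectorBound φ ν (‖x‖ ^ 2 * (16 * C)) (min r 1) :=
      h.sectorBound_of_le_trNorm (by positivity) hC hb fun z hz => by
        rw [hφD z (Or.inl hz)]
        exact h.norm_inner_resolventDiff_le (h.notMem_of_im_ne_zero hz) x
    have hci : CircleIntegrable φ (((a + ν) / 2 : ℝ) : ℂ) ((ν - a) / 2) :=
      circleIntegrable_of_contour (hγ.intervalIntegrable (by positivity) (lt_min hr one_pos)
        hφc hφs)
    have h1 := circleIntegral_stieltjes_sub hab haν hf μ μ' hae hae' (h.atom_eq hr hb x) hci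
    rw [circleIntegral_eq_contour, intervalIntegral.integral_of_le zero_le_one,
      integral_Ioc_eq_integral_Ioo] at h1
    have h2 : ⟪x, energyOperator H V f ν x⟫_ℂ =
        (∫ t, (Iic ν).indicator (fun t : ℝ => f t) t ∂μ') -
        ∫ t, (Iic ν).indicator (fun t : ℝ => f t) t ∂μ := by
      rw [energyOperator, sub_apply, inner_sub_right,
        (h.isBorelCalculus_cutCalculus' hf.continuous ν x).2,
        (h.isBorelCalculus_cutCalculus hf.continuous ν x).2]
    have hπ : (2 * Real.pi * Complex.I : ℂ) ≠ 0 := Complex.two_pi_I_ne_zero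
    rw [h2, smul_apply, inner_smul_right, inner_integral_apply hInt, eq_inv_mul_iff_mul_eq₀ hπ,
      ← h1]
    refine setIntegral_congr_fun measurableSet_Ioo fun t ht => ?_
    have h3 := hφD _ (hγ.mem_cutPlane ht)
    simp only [hφ] at h3
    simp only [smul_apply, inner_smul_right]
    rw [h3]
    ring
  refine ContinuousLinearMap.coe_injective ((ext_inner_map _ _).1 fun x => ?_)
  have h1 := congrArg (starRingEnd ℂ) (hkey x)
  rwa [inner_conj_symm, inner_conj_symm] at h1

lemma isTraceClass_energyOperator {ν C r : ℝ} (hC : 0 ≤ C) (hr : 0 < r)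
    (hb : ∀ s : ℝ, 0 < s → s < r → trNorm (resolventDiff H V (ν + s * Complex.I)) ≤ C)
    {f : ℂ → ℂ} (hf : Differentiable ℂ f) : IsTraceClass (energyOperator H V f ν) := by
  obtain ⟨a₀, ha₀⟩ := h.exists_below
  have ha : IsBelowSpectra H V (min a₀ (ν - 1)) := ha₀.mono (min_le_left _ _)
  have haν : min a₀ (ν - 1) < ν := (min_le_right _ _).trans_lt (by linarith)
  rw [h.energyOperator_eq hC hr hb hf ha haν]
  have hγ := isFermiContour_circleContour ha haν
  obtain ⟨β, hβ, hbd⟩ := h.exists_contour_bound hC hr hb hγ hf.continuous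
  exact (isTraceClass_integral (h.integrable_contour hC hr hb hγ hf.continuous) hβ hbd).smul _

lemma trace_energyOperator [TopologicalSpace.SeparableSpace E] {ν C r : ℝ} (hC : 0 ≤ C)
    (hr : 0 < r)
    (hb : ∀ s : ℝ, 0 < s → s < r → trNorm (resolventDiff H V (ν + s * Complex.I)) ≤ C)
    {f : ℂ → ℂ} (hf : Differentiable ℂ f) {a : ℝ} (ha : IsBelowSpectra H V a) (haν : a < ν) :
    trace (energyOperator H V f ν) = (2 * Real.pi * Complex.I : ℂ)⁻¹ *
      ∫ t in (0 : ℝ)..1, (f (circleContour a ν t) *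
        trace (resolventDiff H V (circleContour a ν t))) * deriv (circleContour a ν) t := by
  have hγ := isFermiContour_circleContour ha haν
  obtain ⟨β, hβ, hbd⟩ := h.exists_contour_bound hC hr hb hγ hf.continuous
  rw [h.energyOperator_eq hC hr hb hf ha haν, trace_smul,
    trace_integral (h.integrable_contour hC hr hb hγ hf.continuous) hβ hbd,
    intervalIntegral.integral_of_le zero_le_one, integral_Ioc_eq_integral_Ioo]
  congr 1
  refine setIntegral_congr_fun measurableSet_Ioo fun t ht => ?_
  simp only [trace_smul]
  ring

end PerturbationData

/-! ### The trace formula at a point with bounded resolvent difference -/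

/-- A continuous factor preserves sector bounds. -/
lemma SectorBound.exists_mul {g f : ℂ → ℂ} {ν C r : ℝ} (hC : 0 ≤ C) (hg : SectorBound g ν C r)
    (hf : Continuous f) : ∃ C', 0 ≤ C' ∧ SectorBound (fun z => f z * g z) ν C' (min r 1) := by
  obtain ⟨M, hM⟩ := (isCompact_closedBall (ν : ℂ) 2).exists_bound_of_continuousOn hf.continuousOn
  refine ⟨|M| * C, by positivity, fun z hz hzr hsec => ?_⟩
  have h1 := hg z hz (hzr.trans_le (min_le_left _ _)) hsec
  have hz1 : |z.im| < 1 := hzr.trans_le (min_le_right _ _)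
  have h2 : ‖f z‖ ≤ |M| := by
    refine (hM z ?_).trans (le_abs_self M)
    rw [mem_closedBall_iff_norm]
    refine (Complex.norm_le_abs_re_add_abs_im _).trans ?_
    simp only [Complex.sub_re, Complex.sub_im, Complex.ofReal_re, Complex.ofReal_im, sub_zero]
    linarith
  rw [norm_mul, mul_assoc]
  gcongr

lemma convex_upper_sector (ν r : ℝ) :
    Convex ℝ {z : ℂ | 0 < z.im ∧ z.im < r ∧ |z.re - ν| ≤ z.im} := by
  intro z hz w hw a b ha hb hab
  obtain ⟨h1, h2, h3⟩ := hz
  obtain ⟨h4, h5, h6⟩ := hw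
  have him : (a • z + b • w).im = a * z.im + b * w.im := by simp
  have hre : (a • z + b • w).re = a * z.re + b * w.re := by simp
  have hre' : a * z.re + b * w.re - ν = a * (z.re - ν) + b * (w.re - ν) := by
    linear_combination ν * hab
  refine ⟨?_, ?_, ?_⟩
  · rw [him]
    rcases ha.eq_or_lt with rfl | ha
    · rw [zero_add] at hab
      simpa [hab] using h4
    · exact add_pos_of_pos_of_nonneg (mul_pos ha h1) (mul_nonneg hb h4.le)
  · rw [him]
    rcases ha.eq_or_lt with rfl | ha
    · rw [zero_add] at hab
      simpa [hab] using h5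
    · calc a * z.im + b * w.im < a * r + b * r :=
            add_lt_add_of_lt_of_le (mul_lt_mul_of_pos_left h2 ha)
              (mul_le_mul_of_nonneg_left h5.le hb)
        _ = r := by rw [← add_mul, hab, one_mul]
  · rw [him, hre, hre']
    refine (abs_add_le _ _).trans (add_le_add ?_ ?_)
    · rw [abs_mul, abs_of_nonneg ha]; gcongr
    · rw [abs_mul, abs_of_nonneg hb]; gcongr

namespace PerturbationData

variable {H : E →ₗ.[ℂ] E} {V J : E →L[ℂ] E} (h : PerturbationData H V J)
  {L : ℂ → ℂ} (hL : ∀ z ∈ cutPlane H V, HasDerivAt L (trace (resolventDiff H V z)) z)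
  (hLc : ∀ z ∈ cutPlane H V, L (starRingEnd ℂ z) = starRingEnd ℂ (L z))
  {ν : ℝ}

include h

lemma sectorBound_trace {C r : ℝ} (hC : 0 ≤ C)
    (hb : ∀ s : ℝ, 0 < s → s < r → trNorm (resolventDiff H V (ν + s * Complex.I)) ≤ C) :
    SectorBound (fun z => trace (resolventDiff H V z)) ν (1 * (16 * C)) (min r 1) :=
  h.sectorBound_of_le_trNorm zero_le_one hC hb fun z hz => by
    rw [one_mul]
    exact (h.isTraceClass_resolventDiff (h.notMem_of_im_ne_zero hz)).norm_trace_le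

-- In the upper half of the sector, which is convex, the derivative tr(R_V - R) is bounded and hence
-- so is L; conjugation treats the lower half. At heights below 1 boundedness is stronger than the
-- sector bound.
include hL hLc in
lemma sectorBound_logDet {C r : ℝ} (hC : 0 ≤ C) (hr : 0 < r)
    (hb : ∀ s : ℝ, 0 < s → s < r → trNorm (resolventDiff H V (ν + s * Complex.I)) ≤ C) :
    ∃ C', 0 ≤ C' ∧ SectorBound L ν C' (min r 1) := by
  set r' := min r 1 with hr'
  have hr0 : 0 < r' := lt_min hr one_pos
  set z₀ : ℂ := ⟨ν, r' / 2⟩ with hz₀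
  have hz₀m : z₀ ∈ {z : ℂ | 0 < z.im ∧ z.im < r' ∧ |z.re - ν| ≤ z.im} := by
    refine ⟨half_pos hr0, half_lt_self hr0, ?_⟩
    simp only [hz₀, sub_self, abs_zero]
    linarith
  have hup : ∀ z ∈ {z : ℂ | 0 < z.im ∧ z.im < r' ∧ |z.re - ν| ≤ z.im},
      ‖L z‖ ≤ ‖L z₀‖ + 16 * C * 2 := by
    intro z hz
    have h1 := (convex_upper_sector ν r').norm_image_sub_le_of_norm_hasDerivWithin_le
      (f := L) (f' := fun z => trace (resolventDiff H V z)) (C := 16 * C)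
      (fun w hw => (hL w (Or.inl hw.1.ne')).hasDerivWithinAt)
      (fun w hw => by
        have hn := h.notMem_of_im_ne_zero hw.1.ne'
        refine ((h.isTraceClass_resolventDiff hn).norm_trace_le).trans ?_
        refine h.trNorm_resolventDiff_sector hb hw.1.ne' ?_ ?_
        · rw [abs_of_pos hw.1]; exact hw.2.1.trans_le (min_le_left _ _)
        · rw [abs_of_pos hw.1]; exact hw.2.2) hz₀m hz
    have h2 : ‖z - z₀‖ ≤ 2 := by
      refine (Complex.norm_le_abs_re_add_abs_im _).trans ?_
      have hr1 : r' ≤ 1 := min_le_right _ _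
      have h3 : |(z - z₀).im| ≤ 1 := by
        rw [Complex.sub_im, abs_le]
        simp only [hz₀]
        constructor <;> linarith [hz.1, hz.2.1]
      have h4 : |(z - z₀).re| ≤ 1 := by
        rw [Complex.sub_re]
        exact hz.2.2.trans (hz.2.1.le.trans hr1)
      linarith
    calc ‖L z‖ = ‖L z₀ + (L z - L z₀)‖ := by rw [add_sub_cancel]
      _ ≤ ‖L z₀‖ + ‖L z - L z₀‖ := norm_add_le _ _
      _ ≤ ‖L z₀‖ + 16 * C * 2 := by
        gcongr
        exact h1.trans (by gcongr)
  refine ⟨‖L z₀‖ + 16 * C * 2, by positivity, fun z hz hzr hsec => ?_⟩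
  have hone := one_le_rpow_neg_half (abs_pos.2 hz) (hzr.le.trans (min_le_right _ _))
  have h5 : ‖L z‖ ≤ ‖L z₀‖ + 16 * C * 2 := by
    rcases hz.lt_or_gt with him | him
    · have h6 := hup (starRingEnd ℂ z) (by
        rw [abs_of_neg him] at hzr hsec
        exact ⟨by simpa using him, by simpa using hzr, by simpa using hsec⟩)
      rwa [hLc z (Or.inl hz), RCLike.norm_conj] at h6
    · rw [abs_of_pos him] at hzr hsec
      exact hup z ⟨him, hzr, hsec⟩
  calc ‖L z‖ ≤ (‖L z₀‖ + 16 * C * 2) * 1 := by rw [mul_one]; exact h5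
    _ ≤ _ := by gcongr

include hL in
lemma exists_tendsto_logDet {C r : ℝ} (hC : 0 ≤ C) (hr : 0 < r)
    (hb : ∀ s : ℝ, 0 < s → s < r → trNorm (resolventDiff H V (ν + s * Complex.I)) ≤ C) :
    ∃ l : ℂ, Tendsto (fun s : ℝ => L (ν + (1 * s : ℝ) * Complex.I)) (𝓝[>] 0) (𝓝 l) := by
  obtain ⟨l, hl, -⟩ := exists_tendsto_vertical (σ := 1)
    (fun z hz => hL z (Or.inl hz)) (by positivity)
    (lt_min hr one_pos) (h.sectorBound_trace hC hb) abs_one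
  exact ⟨l, hl⟩

omit h in
lemma hasSpectralShift_of_tendsto {l : ℂ}
    (hl : Tendsto (fun s : ℝ => L (ν + (1 * s : ℝ) * Complex.I)) (𝓝[>] 0) (𝓝 l)) :
    HasSpectralShift L ν (Real.pi⁻¹ * l.im) := by
  have := ((Complex.continuous_im.tendsto l).comp hl).const_mul (Real.pi⁻¹)
  simpa [HasSpectralShift, Function.comp_def] using this

include hL hLc in
/-- The trace of the energy operator in terms of the boundary values of a primitive of
`f' ln Δ`. -/
lemma trace_energyOperator_eq [TopologicalSpace.SeparableSpace E] {C r : ℝ} (hC : 0 ≤ C)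
    (hr : 0 < r)
    (hb : ∀ s : ℝ, 0 < s → s < r → trNorm (resolventDiff H V (ν + s * Complex.I)) ≤ C)
    {ξ : ℝ} (hξ : HasSpectralShift L ν ξ) {f : ℂ → ℂ} (hf : Differentiable ℂ f) {G : ℂ → ℂ}
    (hG : ∀ z ∈ cutPlane H V, HasDerivAt G (deriv f z * L z) z) {G₁ G₂ : ℂ}
    (h₁ : Tendsto (fun s : ℝ => G (ν + (1 * s : ℝ) * Complex.I)) (𝓝[>] 0) (𝓝 G₁))
    (h₂ : Tendsto (fun s : ℝ => G (ν + (-1 * s : ℝ) * Complex.I)) (𝓝[>] 0) (𝓝 G₂)) :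
    trace (energyOperator H V f ν) =
      -f ν * ξ - (2 * Real.pi * Complex.I)⁻¹ * (G₂ - G₁) := by
  obtain ⟨a₀, ha₀⟩ := h.exists_below
  have ha : IsBelowSpectra H V (min a₀ (ν - 1)) := ha₀.mono (min_le_left _ _)
  have haν : min a₀ (ν - 1) < ν := (min_le_right _ _).trans_lt (by linarith)
  have hγ := isFermiContour_circleContour ha haν
  obtain ⟨l, hl⟩ := h.exists_tendsto_logDet hL hC hr hb
  have hξl : ξ = Real.pi⁻¹ * l.im := tendsto_nhds_unique hξ (hasSpectralShift_of_tendsto hl)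
  have hl' : Tendsto (fun s : ℝ => L (ν + (-1 * s : ℝ) * Complex.I)) (𝓝[>] 0)
      (𝓝 (starRingEnd ℂ l)) := by
    refine ((Complex.continuous_conj.tendsto l).comp hl).congr' ?_
    filter_upwards [self_mem_nhdsWithin] with s hs
    have hs' : s ≠ 0 := ne_of_gt hs
    rw [Function.comp, ← hLc _ (Or.inl (by simpa using hs'))]
    congr 1
    simp
  have hft : ∀ σ : ℝ, Tendsto (fun s : ℝ => f (ν + (σ * s : ℝ) * Complex.I)) (𝓝[>] 0)
      (𝓝 (f ν)) := fun σ => by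
    have h3 : Continuous fun s : ℝ => f (ν + (σ * s : ℝ) * Complex.I) :=
      hf.continuous.comp (by fun_prop)
    have h4 := h3.tendsto 0
    simp only [mul_zero, Complex.ofReal_zero, zero_mul, add_zero] at h4
    exact h4.mono_left nhdsWithin_le_nhds
  obtain ⟨C', hC', hsec⟩ := (h.sectorBound_trace hC hb).exists_mul (by positivity) hf.continuous
  have hcont : ContinuousOn (fun z => f z * trace (resolventDiff H V z)) (cutPlane H V) :=
    hf.continuous.continuousOn.mul (h.differentiableOn_trace_resolventDiff.continuousOn.mono
      fun z hz => h.notMem_of_mem_cutPlane hz)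
  -- Integration by parts: f L - G is a primitive of f tr(R_V - R). Between its two boundary values
  -- at ν the term f L jumps by f(ν)(conj l - l) = -2πi f(ν) ξ. The result mentions G only through
  -- its boundary values, and no longer the circle.
  have hder : ∀ z ∈ cutPlane H V, HasDerivAt (fun z => f z * L z - G z)
      (f z * trace (resolventDiff H V z)) z := fun z hz => by
    refine (((hf z).hasDerivAt.mul (hL z hz)).sub (hG z hz)).congr_deriv ?_
    ring
  have h5 := hγ.integral_eq hC' (lt_min (lt_min hr one_pos) one_pos) hcont hsec hder
    (((hft 1).mul hl).sub h₁) (((hft (-1)).mul hl').sub h₂)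
  rw [h.trace_energyOperator hC hr hb hf ha haν, h5, hξl]
  have h6 : starRingEnd ℂ l = l - (2 * l.im : ℝ) * Complex.I := by
    apply Complex.ext
    · simp
    · simp; ring
  rw [h6]
  have hπ : (Real.pi : ℂ) ≠ 0 := by exact_mod_cast Real.pi_ne_zero
  push_cast
  field_simp
  ring_nf

include hL in
lemma differentiableOn_logDet : DifferentiableOn ℂ L (cutPlane H V) := fun z hz =>
  (hL z hz).differentiableAt.differentiableWithinAt

include hL in
lemma exists_primitive_deriv_mul {f : ℂ → ℂ} (hf : Differentiable ℂ f) :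
    ∃ G : ℂ → ℂ, ∀ z ∈ cutPlane H V, HasDerivAt G (deriv f z * L z) z :=
  h.exists_primitive_cutPlane
    (hf.deriv.differentiableOn.mul (h.differentiableOn_logDet hL))

include hL hLc in
/-- The energy formula at a point where the resolvent difference has bounded trace norm. -/
lemma energyFormula_of_bound [TopologicalSpace.SeparableSpace E] {C r : ℝ} (hC : 0 ≤ C)
    (hr : 0 < r)
    (hb : ∀ s : ℝ, 0 < s → s < r → trNorm (resolventDiff H V (ν + s * Complex.I)) ≤ C)
    {ξ : ℝ} (hξ : HasSpectralShift L ν ξ) {f : ℂ → ℂ} (hf : Differentiable ℂ f) {γ : ℝ → ℂ}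
    (hγ : IsFermiContour H V ν γ) : EnergyFormula H V L f ν ξ γ := by
  obtain ⟨G, hG⟩ := h.exists_primitive_deriv_mul hL hf
  obtain ⟨C', hC', hsec⟩ := h.sectorBound_logDet hL hLc hC hr hb
  obtain ⟨C₂, hC₂, hsec₂⟩ := hsec.exists_mul hC' hf.deriv.continuous
  have hr2 : 0 < min (min r 1) 1 := lt_min (lt_min hr one_pos) one_pos
  have hG' : ∀ z : ℂ, z.im ≠ 0 → HasDerivAt G (deriv f z * L z) z := fun z hz => hG z (Or.inl hz)
  obtain ⟨G₁, h₁, -⟩ := exists_tendsto_vertical (σ := 1) hG' hC₂ hr2 hsec₂ abs_one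
  obtain ⟨G₂, h₂, -⟩ := exists_tendsto_vertical (σ := -1) hG' hC₂ hr2 hsec₂ (by simp)
  have hcont : ContinuousOn (fun z => deriv f z * L z) (cutPlane H V) :=
    hf.deriv.continuous.continuousOn.mul (h.differentiableOn_logDet hL).continuousOn
  refine ⟨h.isBorelCalculus_cutCalculus hf.continuous ν,
    h.isBorelCalculus_cutCalculus' hf.continuous ν, h.isTraceClass_energyOperator hC hr hb hf,
    hγ.intervalIntegrable hC₂ hr2 hcont hsec₂, ?_⟩
  -- The integral along the given contour depends on the same two boundary values of G that express
  -- the trace, so the circle need not be deformed into it.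
  rw [hγ.integral_eq hC₂ hr2 hcont hsec₂ hG h₁ h₂]
  exact h.trace_energyOperator_eq hL hLc hC hr hb hξ hf hG h₁ h₂

end PerturbationData

/-! ### Isolated energies -/

/-- An integrable bound for `g` near `ν`, off the real axis. -/
def BoxBound (g : ℂ → ℂ) (ν C η : ℝ) : Prop :=
  ∀ z : ℂ, z.im ≠ 0 → |z.im| < η → |z.re - ν| < η → ‖g z‖ ≤ C * |z.im| ^ (-(1 / 2) : ℝ)

/-- A bound on a box around ν yields sector bounds, with one constant, at all nearby vertices. This
uniformity allows the limit from ν + u to ν. -/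
lemma BoxBound.sectorBound {g : ℂ → ℂ} {ν C η : ℝ} (hg : BoxBound g ν C η) {ν' : ℝ}
    (hν' : |ν' - ν| < η / 2) : SectorBound g ν' C (η / 2) := by
  intro z hz hzr hsec
  have hη : 0 < η := by linarith [abs_nonneg (ν' - ν)]
  refine hg z hz (by linarith) ?_
  have := abs_sub_le z.re ν' ν
  linarith

lemma BoxBound.exists_mul {g f : ℂ → ℂ} {ν C η : ℝ} (hC : 0 ≤ C) (hg : BoxBound g ν C η)
    (hf : Continuous f) : ∃ C', 0 ≤ C' ∧ BoxBound (fun z => f z * g z) ν C' η := by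
  obtain ⟨M, hM⟩ := (isCompact_closedBall (ν : ℂ) (2 * η)).exists_bound_of_continuousOn
    hf.continuousOn
  refine ⟨|M| * C, by positivity, fun z hz hzr hre => ?_⟩
  have h2 : ‖f z‖ ≤ |M| := by
    refine (hM z ?_).trans (le_abs_self M)
    rw [mem_closedBall_iff_norm]
    refine (Complex.norm_le_abs_re_add_abs_im _).trans ?_
    simp only [Complex.sub_re, Complex.sub_im, Complex.ofReal_re, Complex.ofReal_im, sub_zero]
    linarith
  have h3 := hg z hz hzr hre
  rw [norm_mul, mul_assoc]
  gcongr

/-- Boundary values depend continuously on the point of the real line. -/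
lemma BoxBound.exists_boundary_values {G g : ℂ → ℂ} {ν C η : ℝ}
    (hG : ∀ z : ℂ, z.im ≠ 0 → HasDerivAt G (g z) z) (hC : 0 ≤ C) (hη : 0 < η)
    (hg : BoxBound g ν C η) {σ : ℝ} (hσ : |σ| = 1) :
    ∃ (l₀ : ℂ) (l : ℝ → ℂ),
      Tendsto (fun s : ℝ => G (ν + (σ * s : ℝ) * Complex.I)) (𝓝[>] 0) (𝓝 l₀) ∧
      (∀ u ∈ Ioo 0 (η / 2), Tendsto (fun s : ℝ => G ((ν + u : ℝ) + (σ * s : ℝ) * Complex.I))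
        (𝓝[>] 0) (𝓝 (l u))) ∧ Tendsto l (𝓝[>] 0) (𝓝 l₀) := by
  have hη2 : 0 < η / 2 := half_pos hη
  have hsec : ∀ u ∈ Ioo 0 (η / 2), SectorBound g (ν + u) C (η / 2) := fun u hu =>
    hg.sectorBound (by rw [add_sub_cancel_left, abs_of_pos hu.1]; exact hu.2)
  have hsec₀ : SectorBound g ν C (η / 2) := hg.sectorBound (by simpa using hη2)
  obtain ⟨l₀, hl₀, -⟩ := exists_tendsto_vertical hG hC hη2 hsec₀ hσ
  choose! l hl hl' using fun u hu => exists_tendsto_vertical hG hC hη2 (hsec u hu) hσ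
  refine ⟨l₀, l, hl₀, hl, ?_⟩
  -- The diagonal point z(u) lies in the sector with vertex ν, so G(z(u)) tends to the boundary
  -- value at ν. It also lies at height u on the vertical line through ν + u, so it differs from the
  -- boundary value there by at most 2C √u.
  set z : ℝ → ℂ := fun u => (ν + u : ℝ) + (σ * u : ℝ) * Complex.I with hz
  have hzim : ∀ u, (z u).im = σ * u := fun u => by simp [hz]
  have hzre : ∀ u, (z u).re = ν + u := fun u => by simp [hz]
  have hσσ : σ * σ = 1 := by rw [← abs_mul_abs_self, hσ, one_mul]
  have hzt : Tendsto z (𝓝[>] 0) (𝓝 (ν : ℂ)) := by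
    have h1 : Continuous z := by rw [hz]; fun_prop
    have h2 := h1.tendsto 0
    simp only [hz, add_zero, mul_zero, Complex.ofReal_zero, zero_mul] at h2
    exact h2.mono_left nhdsWithin_le_nhds
  have h3 : Tendsto (fun u => G (z u)) (𝓝[>] 0) (𝓝 l₀) := by
    refine tendsto_of_sector hG hC hη2 hsec₀ hσ hl₀ hzt ?_
    filter_upwards [self_mem_nhdsWithin] with u hu
    have hu' : 0 < u := hu
    rw [hzim, hzre, add_sub_cancel_left, abs_mul, hσ, one_mul, ← mul_assoc, hσσ, one_mul]
    exact ⟨hu', le_rfl⟩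
  have h4 : Tendsto (fun u => l u - G (z u)) (𝓝[>] 0) (𝓝 0) := by
    have h5 : Tendsto (fun u : ℝ => 2 * C * √u) (𝓝[>] 0) (𝓝 0) := by
      have h6 : Continuous fun u : ℝ => 2 * C * √u := by fun_prop
      have h7 := h6.tendsto 0
      simp only [Real.sqrt_zero, mul_zero] at h7
      exact h7.mono_left nhdsWithin_le_nhds
    refine squeeze_zero_norm' ?_ h5
    filter_upwards [Ioo_mem_nhdsGT hη2] with u hu
    rw [norm_sub_rev]
    exact hl' u hu u hu
  simpa using h4.add h3

namespace PerturbationData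

variable {H : E →ₗ.[ℂ] E} {V J : E →L[ℂ] E} (h : PerturbationData H V J)
  {L : ℂ → ℂ} (hL : ∀ z ∈ cutPlane H V, HasDerivAt L (trace (resolventDiff H V z)) z)
  (hLc : ∀ z ∈ cutPlane H V, L (starRingEnd ℂ z) = starRingEnd ℂ (L z))
  {ν : ℝ}

omit [CompleteSpace E] in
lemma exists_radius (hiso : IsIsolatedEnergy H V ν) : ∃ ρ > 0, ∀ x : ℝ, x ≠ ν → |x - ν| < ρ →
    (x : ℂ) ∉ jointSpectrum H V := by
  obtain ⟨ρ, hρ, hball⟩ := Metric.mem_nhdsWithin_iff.1 hiso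
  exact ⟨ρ, hρ, fun x hx hd => hball ⟨by
    rwa [mem_ball_iff_norm, ← Complex.ofReal_sub, Complex.norm_real], by simpa using hx⟩⟩

include h

section Isolated

variable {ρ : ℝ} (hiso : ∀ x : ℝ, x ≠ ν → |x - ν| < ρ → (x : ℂ) ∉ jointSpectrum H V)

include hiso

lemma notMem_of_norm_lt {z : ℂ} (hz : z ≠ ν) (hzρ : ‖z - ν‖ < ρ) : z ∉ jointSpectrum H V := by
  rcases eq_or_ne z.im 0 with him | him
  · have h1 : z = (z.re : ℂ) := Complex.ext rfl (by simp [him])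
    rw [h1] at hz hzρ ⊢
    refine hiso _ (by simpa using hz) ?_
    rwa [← Complex.ofReal_sub, Complex.norm_real] at hzρ
  · exact h.notMem_of_im_ne_zero him

/-- Stieltjes transforms have at most a simple pole at an isolated point of the spectrum. -/
lemma norm_mul_inner_resolventDiff_le {z : ℂ} (hz : z ≠ ν) (hzρ : ‖z - ν‖ < ρ / 2) (x : E) :
    ‖(z - ν) * ⟪x, resolventDiff H V z x⟫_ℂ‖ ≤
      (spectralMeasure (perturbed H V) x).real univ + (spectralMeasure H x).real univ := by
  obtain ⟨a, ha⟩ := h.exists_below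
  have hρ : 0 < ρ / 2 := (norm_nonneg _).trans_lt hzρ
  rw [h.inner_resolventDiff (h.notMem_of_norm_lt hiso hz (by linarith)) x, mul_sub]
  have key : ∀ μ : Measure ℝ, IsFiniteMeasure μ → (∀ᵐ t : ℝ ∂μ, (t : ℂ) ∈ jointSpectrum H V) →
      ‖(z - ν) * ∫ t : ℝ, (z - t)⁻¹ ∂μ‖ ≤ μ.real univ := by
    intro μ hμ hae
    rw [← integral_const_mul]
    have h1 := norm_integral_le_of_norm_le_const (μ := μ) (C := 1)
      (f := fun t : ℝ => (z - ν) * (z - t)⁻¹) (by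
        filter_upwards [hae] with t ht
        -- Every spectral point other than ν has distance at least ρ from ν, and |z - ν| < ρ/2;
        -- hence ν is the spectral candidate closest to z.
        have h2 : ‖z - ν‖ ≤ ‖z - t‖ := by
          rcases eq_or_ne t ν with rfl | hne
          · exact le_rfl
          · have h3 : ρ ≤ |t - ν| := by
              by_contra! hlt
              exact hiso t hne hlt ht
            have h4 : |t - ν| = ‖(t : ℂ) - ν‖ := by
              rw [← Complex.ofReal_sub, Complex.norm_real, Real.norm_eq_abs]
            have h5 : ‖(t : ℂ) - ν‖ ≤ ‖z - t‖ + ‖z - ν‖ := by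
              have := norm_sub_le (z - ν) (z - t)
              rw [sub_sub_sub_cancel_left] at this
              linarith
            linarith
        rw [norm_mul, norm_inv, ← div_eq_mul_inv]
        exact div_le_one_of_le₀ h2 (norm_nonneg _))
    simpa using h1
  refine (norm_sub_le _ _).trans (add_le_add ?_ ?_)
  · exact key _ (h.isFiniteMeasure' x) ((ae_spectralMeasure_mem h.selfAdjoint'
      (notMem_right (ha.notMem le_rfl)) x).mono fun t ht => Or.inr ht)
  · exact key _ (h.isFiniteMeasure x) ((ae_spectralMeasure_mem h.selfAdjoint
      (notMem_left (ha.notMem le_rfl)) x).mono fun t ht => Or.inl ht)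

/-- The trace of the resolvent difference has at most a simple pole at an isolated point. -/
lemma exists_trace_pole_bound (hρ : 0 < ρ) : ∃ A, 0 ≤ A ∧ ∀ z : ℂ, z ≠ ν → ‖z - ν‖ < ρ / 4 →
    ‖trace (resolventDiff H V z)‖ ≤ A / ‖z - ν‖ := by
  have hK : Metric.sphere (ν : ℂ) (ρ / 4) ⊆ (jointSpectrum H V)ᶜ := fun z hz => by
    have h1 : ‖z - ν‖ = ρ / 4 := mem_sphere_iff_norm.1 hz
    refine h.notMem_of_norm_lt hiso (fun h0 => ?_) (by linarith)
    rw [h0, sub_self, norm_zero] at h1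
    linarith
  obtain ⟨M, hM⟩ := h.exists_trNorm_le_of_isCompact hK (isCompact_sphere _ _)
  refine ⟨ρ / 4 * |M|, by positivity, fun z hz hzρ => ?_⟩
  have hzpos : 0 < ‖z - ν‖ := norm_pos_iff.2 (sub_ne_zero.2 hz)
  have hzn := h.notMem_of_norm_lt hiso hz (by linarith)
  rw [le_div_iff₀ hzpos, mul_comm, ← norm_mul]
  -- The pole estimate for single matrix elements is not summable over the basis. For a finite
  -- partial sum it makes the singularity at ν removable, and the maximum principle on the disc of
  -- radius ρ/4 then replaces it by the trace norm bound on the boundary circle, which does not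
  -- depend on `s`.
  have hsum : ∀ s : Finset (BasisIndex E),
      ‖(z - ν) * ∑ i ∈ s, ⟪basis E i, resolventDiff H V z (basis E i)⟫_ℂ‖ ≤ ρ / 4 * |M| := by
    intro s
    set F : ℂ → ℂ := fun w =>
      (w - ν) * ∑ i ∈ s, ⟪basis E i, resolventDiff H V w (basis E i)⟫_ℂ with hF
    have hball : ∀ w ∈ Metric.ball (ν : ℂ) (ρ / 2) \ {(ν : ℂ)}, w ∉ jointSpectrum H V :=
      fun w hw => h.notMem_of_norm_lt hiso hw.2
        ((mem_ball_iff_norm.1 hw.1).trans (by linarith))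
    have hd : DifferentiableOn ℂ F (Metric.ball (ν : ℂ) (ρ / 2) \ {(ν : ℂ)}) := by
      refine (differentiableOn_id.sub (differentiableOn_const _)).mul
        (DifferentiableOn.fun_sum fun i _ => ?_)
      intro w hw
      have h1 : DifferentiableAt ℂ (resolventDiff H V) w :=
        (hasDerivAt_opResolvent (notMem_right (hball w hw))).differentiableAt.sub
          (hasDerivAt_opResolvent (notMem_left (hball w hw))).differentiableAt
      have h2 : DifferentiableAt ℂ (fun w => resolventDiff H V w (basis E i)) w :=
        h1.clm_apply (differentiableAt_const _)
      exact ((innerSL ℂ (basis E i)).differentiableAt.comp w h2).differentiableWithinAt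
    have hb : BddAbove (norm ∘ F '' (Metric.ball (ν : ℂ) (ρ / 2) \ {(ν : ℂ)})) := by
      refine ⟨∑ i ∈ s, ((spectralMeasure (perturbed H V) (basis E i)).real univ +
        (spectralMeasure H (basis E i)).real univ), ?_⟩
      rintro _ ⟨w, hw, rfl⟩
      simp only [Function.comp, hF, Finset.mul_sum]
      refine (norm_sum_le _ _).trans (Finset.sum_le_sum fun i _ => ?_)
      exact h.norm_mul_inner_resolventDiff_le hiso hw.2 (mem_ball_iff_norm.1 hw.1) _
    have hd' := Complex.differentiableOn_update_limUnder_of_bddAbove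
      (Metric.ball_mem_nhds (ν : ℂ) (half_pos hρ)) hd hb
    set F' := Function.update F ν (limUnder (𝓝[≠] (ν : ℂ)) F) with hF'
    have hF'eq : ∀ w : ℂ, w ≠ ν → F' w = F w := fun w hw => Function.update_of_ne hw _ _
    have hmax := Complex.norm_le_of_forall_mem_frontier_norm_le (f := F') (C := ρ / 4 * |M|)
      (Metric.isBounded_ball (x := (ν : ℂ)) (r := ρ / 4))
      ((hd'.mono (Metric.closure_ball_subset_closedBall.trans
        (Metric.closedBall_subset_ball (by linarith)))).diffContOnCl)
      (fun w hw => by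
        have hw' : w ∈ Metric.sphere (ν : ℂ) (ρ / 4) := Metric.frontier_ball_subset_sphere hw
        have h1 : ‖w - ν‖ = ρ / 4 := mem_sphere_iff_norm.1 hw'
        have hwne : w ≠ ν := fun h0 => by
          rw [h0, sub_self, norm_zero] at h1
          linarith
        rw [hF'eq w hwne, hF, norm_mul, h1]
        have h2 := (h.isTraceClass_resolventDiff (hK hw')).sum_norm_diag_le s
        have h3 := (hM w hw').trans (le_abs_self M)
        gcongr
        exact (norm_sum_le _ _).trans (h2.trans h3))
      (subset_closure (mem_ball_iff_norm.2 hzρ))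
    rwa [hF'eq z hz] at hmax
  have hlim := ((h.isTraceClass_resolventDiff hzn).hasSum_trace.const_mul (z - ν)).norm
  refine le_of_tendsto hlim (Eventually.of_forall fun s => hsum s)

end Isolated

end PerturbationData

namespace PerturbationData

variable {H : E →ₗ.[ℂ] E} {V J : E →L[ℂ] E} (h : PerturbationData H V J)
  {L : ℂ → ℂ} (hL : ∀ z ∈ cutPlane H V, HasDerivAt L (trace (resolventDiff H V z)) z)
  (hLc : ∀ z ∈ cutPlane H V, L (starRingEnd ℂ z) = starRingEnd ℂ (L z))
  {ν : ℝ}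

include h

section Isolated

variable {ρ : ℝ} (hiso : ∀ x : ℝ, x ≠ ν → |x - ν| < ρ → (x : ℂ) ∉ jointSpectrum H V)

include hiso

include hL in
/-- Vertical integration of the pole bound. -/
lemma norm_logDet_sub_le {A : ℝ} (hA : 0 ≤ A)
    (hpole : ∀ z : ℂ, z ≠ ν → ‖z - ν‖ < ρ / 4 → ‖trace (resolventDiff H V z)‖ ≤ A / ‖z - ν‖)
    {η : ℝ} (hη1 : η ≤ 1) (hηρ : η ≤ ρ / 16) {x y : ℝ} (hx : |x - ν| < η)
    (hy : 0 < y) (hyη : y < η) :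
    ‖L (x + y * Complex.I) - L (x + η * Complex.I)‖ ≤ 2 * A * y ^ (-(1 / 2) : ℝ) := by
  have hη : 0 < η := hy.trans hyη
  -- With Im z = u⁻² the pole bound reads A u² and the speed is 2 u⁻³, so the derivative of L along
  -- the path is at most 2A/u ≤ 2A for u ≥ 1. The parameter interval has length at most y^(-1/2).
  set p : ℝ → ℂ := fun u => x + ((u ^ 2)⁻¹ : ℝ) * Complex.I with hp
  have hpre : ∀ u, (p u).re = x := fun u => by simp [hp, -Complex.ofReal_inv, -Complex.ofReal_pow]
  have hpim : ∀ u, (p u).im = (u ^ 2)⁻¹ := fun u => by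
    simp [hp, -Complex.ofReal_inv, -Complex.ofReal_pow]
  set u₀ := (√η)⁻¹ with hu₀
  set u₁ := (√y)⁻¹ with hu₁
  have hsη : 0 < √η := Real.sqrt_pos.2 hη
  have hsy : 0 < √y := Real.sqrt_pos.2 hy
  have hu₀1 : 1 ≤ u₀ := (one_le_inv₀ hsη).2 (Real.sqrt_le_one.2 hη1)
  have hu₀₁ : u₀ ≤ u₁ := inv_anti₀ hsy (Real.sqrt_le_sqrt hyη.le)
  have hp₀ : p u₀ = x + η * Complex.I := by
    simp only [hp, hu₀, inv_pow, inv_inv, Real.sq_sqrt hη.le]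
  have hp₁ : p u₁ = x + y * Complex.I := by
    simp only [hp, hu₁, inv_pow, inv_inv, Real.sq_sqrt hy.le]
  have hd : ∀ u ∈ Icc u₀ u₁, HasDerivWithinAt (fun u => L (p u))
      (trace (resolventDiff H V (p u)) * ((-(2 * u) / (u ^ 2) ^ 2 : ℝ) * Complex.I))
      (Icc u₀ u₁) u := by
    intro u hu
    have hu0 : 0 < u := by linarith [hu.1]
    have h1 : HasDerivAt (fun u : ℝ => (u ^ 2)⁻¹) (-(2 * u) / (u ^ 2) ^ 2) u := by
      have := (hasDerivAt_pow 2 u).fun_inv (by positivity)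
      exact this.congr_deriv (by simp)
    have h2 : HasDerivAt p ((-(2 * u) / (u ^ 2) ^ 2 : ℝ) * Complex.I) u :=
      (h1.ofReal_comp.mul_const Complex.I).const_add _
    have him : (p u).im ≠ 0 := by rw [hpim]; positivity
    exact ((hL _ (Or.inl him)).comp u h2).hasDerivWithinAt
  have hbound : ∀ u ∈ Icc u₀ u₁, ‖trace (resolventDiff H V (p u)) *
      ((-(2 * u) / (u ^ 2) ^ 2 : ℝ) * Complex.I)‖ ≤ 2 * A := by
    intro u hu
    have hu1 : 1 ≤ u := hu₀1.trans hu.1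
    have hu0 : 0 < u := by linarith
    have him : (p u).im ≠ 0 := by rw [hpim]; positivity
    have hle : (u ^ 2)⁻¹ ≤ ‖p u - ν‖ := by
      have := Complex.abs_im_le_norm (p u - ν)
      rw [Complex.sub_im, hpim, Complex.ofReal_im, sub_zero, abs_of_pos (by positivity)] at this
      exact this
    have hinv : (u ^ 2)⁻¹ ≤ η := by
      have h3 : (u ^ 2)⁻¹ ≤ (u₀ ^ 2)⁻¹ :=
        inv_anti₀ (by positivity) (pow_le_pow_left₀ (by linarith) hu.1 2)
      rwa [hu₀, inv_pow, inv_inv, Real.sq_sqrt hη.le] at h3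
    have hlt : ‖p u - ν‖ < ρ / 4 := by
      refine (Complex.norm_le_abs_re_add_abs_im _).trans_lt ?_
      rw [Complex.sub_im, Complex.sub_re, hpim, hpre, Complex.ofReal_im, Complex.ofReal_re,
        sub_zero, abs_of_pos (a := (u ^ 2)⁻¹) (by positivity)]
      linarith
    have hne : p u ≠ ν := fun h0 => him (by rw [h0, Complex.ofReal_im])
    have h4 := hpole (p u) hne hlt
    have h5 : A / ‖p u - ν‖ ≤ A * u ^ 2 := by
      rw [div_eq_mul_inv]
      gcongr
      rw [inv_le_comm₀ (lt_of_lt_of_le (by positivity) hle) (by positivity)]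
      exact hle
    rw [norm_mul, norm_mul, Complex.norm_I, mul_one, Complex.norm_real, Real.norm_eq_abs, abs_div,
      abs_neg, abs_of_pos (a := 2 * u) (by positivity),
      abs_of_pos (a := (u ^ 2) ^ 2) (by positivity)]
    calc ‖trace (resolventDiff H V (p u))‖ * (2 * u / (u ^ 2) ^ 2)
        ≤ A * u ^ 2 * (2 * u / (u ^ 2) ^ 2) := by gcongr; exact h4.trans h5
      _ = 2 * A * u⁻¹ := by field_simp
      _ ≤ 2 * A * 1 := by gcongr; exact inv_le_one_of_one_le₀ hu1
      _ = 2 * A := mul_one _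
  have h6 := (convex_Icc u₀ u₁).norm_image_sub_le_of_norm_hasDerivWithin_le hd hbound
    (left_mem_Icc.2 hu₀₁) (right_mem_Icc.2 hu₀₁)
  rw [hp₀, hp₁] at h6
  refine h6.trans ?_
  have h7 : y ^ (-(1 / 2) : ℝ) = u₁ := by rw [hu₁, Real.sqrt_eq_rpow, Real.rpow_neg hy.le]
  rw [h7, Real.norm_of_nonneg (by linarith)]
  gcongr
  linarith

include hL hLc in
lemma exists_boxBound_logDet (hρ : 0 < ρ) :
    ∃ C η : ℝ, 0 ≤ C ∧ 0 < η ∧ η < ρ ∧ BoxBound L ν C η := by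
  obtain ⟨A, hA, hpole⟩ := h.exists_trace_pole_bound hiso hρ
  set η := min (ρ / 16) 1 with hη'
  have hη : 0 < η := lt_min (by positivity) one_pos
  have hη1 : η ≤ 1 := min_le_right _ _
  have hηρ : η ≤ ρ / 16 := min_le_left _ _
  obtain ⟨M, hM⟩ : ∃ M, ∀ x ∈ Icc (ν - η) (ν + η), ‖L ((x : ℝ) + η * Complex.I)‖ ≤ M := by
    refine isCompact_Icc.exists_bound_of_continuousOn fun x _ => ?_
    have h1 : ContinuousAt L ((x : ℝ) + η * Complex.I) :=
      (hL _ (Or.inl (by simpa using hη.ne'))).continuousAt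
    have h2 : ContinuousAt (fun x : ℝ => (x : ℂ) + η * Complex.I) x := by fun_prop
    exact (ContinuousAt.comp (f := fun x : ℝ => (x : ℂ) + η * Complex.I) h1 h2).continuousWithinAt
  have hup : ∀ z : ℂ, 0 < z.im → z.im < η → |z.re - ν| < η →
      ‖L z‖ ≤ (|M| + 2 * A) * z.im ^ (-(1 / 2) : ℝ) := by
    intro z hz hzη hre
    have h1 := h.norm_logDet_sub_le hL hiso hA hpole hη1 hηρ hre hz hzη
    rw [Complex.re_add_im] at h1
    have h2 := (hM z.re (by rw [abs_lt] at hre; constructor <;> linarith)).trans (le_abs_self M)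
    have h3 := one_le_rpow_neg_half hz (hzη.le.trans hη1)
    calc ‖L z‖ = ‖(L z - L (z.re + η * Complex.I)) + L (z.re + η * Complex.I)‖ := by
          rw [sub_add_cancel]
      _ ≤ 2 * A * z.im ^ (-(1 / 2) : ℝ) + |M| * 1 := by
          refine (norm_add_le _ _).trans (add_le_add h1 ?_)
          rwa [mul_one]
      _ ≤ 2 * A * z.im ^ (-(1 / 2) : ℝ) + |M| * z.im ^ (-(1 / 2) : ℝ) := by gcongr
      _ = _ := by ring
  refine ⟨|M| + 2 * A, η, by positivity, hη, by linarith, fun z hz hzη hre => ?_⟩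
  rcases hz.lt_or_gt with him | him
  · have h1 := hup (starRingEnd ℂ z) (by simpa using him)
      (by rw [abs_of_neg him] at hzη; simpa using hzη) (by simpa using hre)
    rwa [hLc z (Or.inl hz), RCLike.norm_conj, Complex.conj_im, ← abs_of_neg him] at h1
  · rw [abs_of_pos him] at hzη ⊢
    exact hup z him hzη hre

/-- The energy operator does not change as long as no spectrum is crossed. -/
lemma energyOperator_congr (f : ℂ → ℂ) {ν' : ℝ} (hν' : ν < ν') (hρ : ν' - ν < ρ) :
    energyOperator H V f ν' = energyOperator H V f ν := by
  obtain ⟨a, ha⟩ := h.exists_below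
  have key : ∀ t : ℝ, (t : ℂ) ∈ jointSpectrum H V →
      (Iic ν').indicator (fun t : ℝ => f (t : ℂ)) t = (Iic ν).indicator (fun t : ℝ => f t) t := by
    intro t ht
    rcases le_or_gt t ν with h1 | h1
    · rw [indicator_of_mem (mem_Iic.2 h1), indicator_of_mem (mem_Iic.2 (h1.trans hν'.le))]
    · rw [indicator_of_notMem (show t ∉ Iic ν by simpa using h1), indicator_of_notMem]
      intro h2
      refine hiso t h1.ne' ?_ ht
      rw [abs_of_pos (by linarith)]
      linarith [mem_Iic.1 h2]
  have h1 : cutCalculus H f ν' = cutCalculus H f ν := borelCalculus_congr fun x =>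
    (ae_spectralMeasure_mem h.selfAdjoint (notMem_left (ha.notMem le_rfl)) x).mono fun t ht =>
      key t (Or.inl ht)
  have h2 : cutCalculus (perturbed H V) f ν' = cutCalculus (perturbed H V) f ν :=
    borelCalculus_congr fun x => (ae_spectralMeasure_mem h.selfAdjoint'
      (notMem_right (ha.notMem le_rfl)) x).mono fun t ht => key t (Or.inr ht)
  rw [energyOperator, energyOperator, h1, h2]

end Isolated

lemma exists_bound_of_notMem (hν : (ν : ℂ) ∉ jointSpectrum H V) : ∃ C, 0 ≤ C ∧
    ∀ s : ℝ, 0 < s → s < 1 → trNorm (resolventDiff H V (ν + s * Complex.I)) ≤ C := by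
  have hc : Continuous fun s : ℝ => (ν : ℂ) + s * Complex.I := by fun_prop
  obtain ⟨M, hM⟩ := h.exists_trNorm_le_of_isCompact
    (K := (fun s : ℝ => (ν : ℂ) + s * Complex.I) '' Icc 0 1) (by
      rintro _ ⟨s, hs, rfl⟩
      rcases hs.1.eq_or_lt with rfl | hs0
      · simpa using hν
      · exact h.notMem_of_im_ne_zero (by simpa using hs0.ne')) (isCompact_Icc.image hc)
  exact ⟨|M|, abs_nonneg M, fun s hs hs1 =>
    (hM _ (mem_image_of_mem _ ⟨hs.le, hs1.le⟩)).trans (le_abs_self M)⟩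

include hL hLc in
/-- The energy formula at an isolated point of the spectra. -/
lemma energyFormula_of_isolated [TopologicalSpace.SeparableSpace E]
    (hiso : IsIsolatedEnergy H V ν) :
    ∃ ξ : ℝ, (∀ᶠ x in 𝓝[>] ν, HasSpectralShift L x ξ) ∧
      ∀ f : ℂ → ℂ, Differentiable ℂ f → ∀ γ : ℝ → ℂ, IsFermiContour H V ν γ →
        EnergyFormula H V L f ν ξ γ := by
  obtain ⟨ρ, hρ, hfree⟩ := exists_radius hiso
  obtain ⟨C, η, hC, hη, hηρ, hbox⟩ := h.exists_boxBound_logDet hL hLc hfree hρ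
  have hbd : ∀ u ∈ Ioo 0 (η / 2), ∃ C, 0 ≤ C ∧ ∀ s : ℝ, 0 < s → s < 1 →
      trNorm (resolventDiff H V ((ν + u : ℝ) + s * Complex.I)) ≤ C := fun u hu =>
    h.exists_bound_of_notMem (hfree _ (by linarith [hu.1]) (by
      rw [add_sub_cancel_left, abs_of_pos hu.1]; linarith [hu.2]))
  have hcongr : ∀ f, ∀ u ∈ Ioo 0 (η / 2),
      energyOperator H V f (ν + u) = energyOperator H V f ν := fun f u hu =>
    h.energyOperator_congr hfree f (by linarith [hu.1]) (by linarith [hu.2])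
  -- For f = 1 the contour term vanishes and the formula at ν + u says that the trace is -ξ(ν + u).
  -- Since the operator difference is the same for all small u > 0, this value is constant; the
  -- trace is real, so taking its real part loses nothing.
  set ξ : ℝ := -(trace (energyOperator H V (fun _ => 1) ν)).re with hξ
  have hshift : ∀ u ∈ Ioo 0 (η / 2), HasSpectralShift L (ν + u) ξ := by
    intro u hu
    obtain ⟨B, hB, hb⟩ := hbd u hu
    obtain ⟨l, hl⟩ := h.exists_tendsto_logDet hL hB one_pos hb
    have h1 := hasSpectralShift_of_tendsto hl
    have h2 := h.trace_energyOperator_eq hL hLc hB one_pos hb h1 (f := fun _ => 1)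
      (differentiable_const _) (G := fun _ => 0) (fun z _ => by
        simpa using hasDerivAt_const z (0 : ℂ)) tendsto_const_nhds tendsto_const_nhds
    rw [hcongr _ u hu] at h2
    have h3 : ξ = Real.pi⁻¹ * l.im := by
      rw [hξ, h2]
      simp [-Complex.ofReal_mul, -Complex.ofReal_inv]
    rw [h3]
    exact h1
  refine ⟨ξ, ?_, fun f hf γ hγ => ?_⟩
  · filter_upwards [Ioo_mem_nhdsGT (show ν < ν + η / 2 by linarith)] with x hx
    have := hshift (x - ν) ⟨by linarith [hx.1], by linarith [hx.2]⟩
    rwa [add_sub_cancel] at this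
  obtain ⟨G, hG⟩ := h.exists_primitive_deriv_mul hL hf
  have hG' : ∀ z : ℂ, z.im ≠ 0 → HasDerivAt G (deriv f z * L z) z := fun z hz => hG z (Or.inl hz)
  obtain ⟨C', hC', hbox'⟩ := hbox.exists_mul hC hf.deriv.continuous
  obtain ⟨G₁, l₁, h₁, hl₁, ht₁⟩ := hbox'.exists_boundary_values hG' hC' hη (σ := 1) abs_one
  obtain ⟨G₂, l₂, h₂, hl₂, ht₂⟩ := hbox'.exists_boundary_values hG' hC' hη (σ := -1) (by simp)
  have hsec := hbox'.sectorBound (ν' := ν) (by simpa using half_pos hη)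
  have hcont : ContinuousOn (fun z => deriv f z * L z) (cutPlane H V) :=
    hf.deriv.continuous.continuousOn.mul (h.differentiableOn_logDet hL).continuousOn
  have hη2 : 0 < η / 2 := half_pos hη
  refine ⟨h.isBorelCalculus_cutCalculus hf.continuous ν,
    h.isBorelCalculus_cutCalculus' hf.continuous ν, ?_,
    hγ.intervalIntegrable hC' hη2 hcont hsec, ?_⟩
  -- Any point slightly to the right of ν has the same operator difference and lies in both
  -- resolvent sets; η/4 is one such shift.
  · have hu : η / 4 ∈ Ioo 0 (η / 2) := ⟨by positivity, by linarith⟩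
    obtain ⟨B, hB, hb⟩ := hbd _ hu
    rw [← hcongr f _ hu]
    exact h.isTraceClass_energyOperator hB one_pos hb hf
  rw [hγ.integral_eq hC' hη2 hcont hsec hG h₁ h₂]
  have hft : Tendsto (fun u : ℝ => f ((ν + u : ℝ) : ℂ)) (𝓝[>] 0) (𝓝 (f ν)) := by
    have h3 : Continuous fun u : ℝ => f ((ν + u : ℝ) : ℂ) := hf.continuous.comp (by fun_prop)
    have h4 := h3.tendsto 0
    simp only [add_zero] at h4
    exact h4.mono_left nhdsWithin_le_nhds
  -- The formula holds at ν + u with the fixed value ξ and the same primitive G. Its left side is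
  -- constant in u, and its right side converges as u → +0.
  have hlim := (hft.neg.mul_const (ξ : ℂ)).sub
    ((ht₂.sub ht₁).const_mul ((2 * Real.pi * Complex.I : ℂ)⁻¹))
  refine tendsto_nhds_unique (tendsto_const_nhds.congr' ?_) hlim
  filter_upwards [Ioo_mem_nhdsGT hη2] with u hu
  obtain ⟨B, hB, hb⟩ := hbd u hu
  rw [← hcongr f u hu]
  exact h.trace_energyOperator_eq hL hLc hB one_pos hb (hshift u hu) hf hG (hl₁ u hu) (hl₂ u hu)

end PerturbationData

/-- Under the limiting absorption principle the resolvent difference is bounded in trace norm. -/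
lemma HasTraceNormLimit.exists_bound {F : ℝ → E →L[ℂ] E} (hF : ∀ s, 0 < s → IsTraceClass (F s))
    (hlim : HasTraceNormLimit F) : ∃ C r : ℝ, 0 ≤ C ∧ 0 < r ∧
      ∀ s, 0 < s → s < r → trNorm (F s) ≤ C := by
  obtain ⟨T, hT, ht⟩ := hlim
  obtain ⟨r, hr, hsub⟩ := mem_nhdsGT_iff_exists_Ioo_subset.1
    (ht.eventually_le_const (zero_lt_one (α := ℝ≥0∞)))
  refine ⟨1 + trNorm T, r, add_nonneg zero_le_one (trNorm_nonneg T), hr, fun s hs hsr => ?_⟩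
  have h1 : traceNorm (F s - T) ≤ 1 := hsub ⟨hs, hsr⟩
  have h2 : trNorm (F s - T) ≤ 1 := ENNReal.toReal_le_of_le_ofReal zero_le_one (by simpa using h1)
  have h3 := ((hF s hs).sub hT).trNorm_add_le hT
  rw [sub_add_cancel] at h3
  linarith

end EnergyDifference

end

/-! ### The two cases of the theorem. -/

theorem mainTheorem3 {E : Type*} [NormedAddCommGroup E] [InnerProductSpace ℂ E] [CompleteSpace E]
    [TopologicalSpace.SeparableSpace E]
    (H : E →ₗ.[ℂ] E) (hH : IsSelfAdjoint H)
    (V J : E →L[ℂ] E) (hV : IsSelfAdjoint V) (hJ : EnergyDifference.IsRollnikSign V J)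
    (hHb : EnergyDifference.SemiboundedBelow H)
    (hVb : EnergyDifference.SemiboundedBelow (EnergyDifference.perturbed H V))
    (ν : ℝ) :
    -- limiting absorption at `ν` (possibly inside the essential spectrum)
    (EnergyDifference.LimitingAbsorption H V J ν →
      ∃ (L : ℂ → ℂ) (ξ : ℝ), EnergyDifference.IsLogDet H V J L ∧
        EnergyDifference.HasSpectralShift L ν ξ ∧
        ∀ f : ℂ → ℂ, Differentiable ℂ f → ∀ γ : ℝ → ℂ,
          EnergyDifference.IsFermiContour H V ν γ →
            EnergyDifference.EnergyFormula H V L f ν ξ γ) ∧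
    -- `ν` an isolated eigenvalue of `H` or `H_V`; `ξ` is the right-continuous value at `ν`
    (EnergyDifference.TraceClassAbove H V J ν → EnergyDifference.IsIsolatedEnergy H V ν →
      ∃ (L : ℂ → ℂ) (ξ : ℝ), EnergyDifference.IsLogDet H V J L ∧
        (∀ᶠ x in 𝓝[>] ν, EnergyDifference.HasSpectralShift L x ξ) ∧
        ∀ f : ℂ → ℂ, Differentiable ℂ f → ∀ γ : ℝ → ℂ,
          EnergyDifference.IsFermiContour H V ν γ →
            EnergyDifference.EnergyFormula H V L f ν ξ γ) := by
  refine ⟨fun hlap => ?_, fun htc hiso => ?_⟩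
  · have h := EnergyDifference.perturbationData_of_traceClassAbove hH hV hJ hHb hVb
      hlap.toTraceClassAbove
    obtain ⟨L, hLog, hL, hLc⟩ := h.exists_logDet
    obtain ⟨C, r, hC, hr, hb⟩ := hlap.resolventDiff_lim.exists_bound hlap.resolventDiff_mem
    obtain ⟨l, hl⟩ := h.exists_tendsto_logDet hL hC hr hb
    have hξ := EnergyDifference.PerturbationData.hasSpectralShift_of_tendsto hl
    exact ⟨L, _, hLog, hξ, fun f hf γ hγ => h.energyFormula_of_bound hL hLc hC hr hb hξ hf hγ⟩
  · have h := EnergyDifference.perturbationData_of_traceClassAbove hH hV hJ hHb hVb htc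
    obtain ⟨L, hLog, hL, hLc⟩ := h.exists_logDet
    obtain ⟨ξ, hξ, hformula⟩ := h.energyFormula_of_isolated hL hLc hiso
    exact ⟨L, ξ, hLog, hξ, hformula⟩
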